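/- **Theorem (Null weighted Raychaudhuri equation).** *Setting.* Let $n\ge 2$, let $M$ be a connected $C^\infty$-manifold of dimension $n+1$ without boundary, and let $L:TM\to\mathbb R$ be a Lorentz–Finsler structure: $L\in C^\infty(TM\setminus\{0\})$, $L(cv)=c^2L(v)$ for $c>0$, and $g_{\alpha\beta}(v)=\frac{\partial^2L}{\partial v^\alpha\partial v^\beta}(v)$ has signature $(-,+,\dots,+)$ for every $v\ne0$; put $g_v(a,b)=\sum_{\alpha,\beta} g_{\alpha\beta}(v)a^\alpha b^\beta$. Let $(M,L)$ be time oriented by a smooth vector field $X$ with $L(X)<0$. With $\Omega'_x=\{v\in T_xM: L(v)<0\}$, a vector $v\in T_xM$ is future-directed causal if it lies in the connected component of $\overline{\Omega'_x}\setminus\{0\}$ containing $X(x)$. Let the weight $\psi$ be a $C^\infty$, positively $0$-homogeneous real function on the set of future-directed causal vectors. *Connection and curvature.* In local coordinates set $$\widetilde\Gamma^\alpha_{\beta\gamma}=\tfrac12\sum_\delta g^{\alpha\delta}\Big(\frac{\partial g_{\delta\gamma}}{\partial x^\beta}+\frac{\partial g_{\beta\delta}}{\partial x^\gamma}-\frac{\partial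 g_{\beta\gamma}}{\partial x^\delta}\Big),\quad G^\alpha(v)=\tfrac12\sum_{\beta,\gamma}\widetilde\Gamma^\alpha_{\beta\gamma}(v)v^\beta v^\gamma,\quad N^\alpha_\beta=\frac{\partial G^\alpha}{\partial v^\beta},$$ $$\Gamma^\alpha_{\beta\gamma}=\widetilde\Gamma^\alpha_{\beta\gamma}-\tfrac12\sum_{\delta,\mu}g^{\alpha\delta}\Big(\frac{\partial g_{\delta\gamma}}{\partial v^\mu}N^\mu_\beta+\frac{\partial g_{\beta\delta}}{\partial v^\mu}N^\mu_\gamma-\frac{\partial g_{\beta\gamma}}{\partial v^\mu}N^\mu_\delta\Big),$$ $$R^\alpha_\beta(v)=2\frac{\partial G^\alpha}{\partial x^\beta}-\sum_\gamma\Big(\frac{\partial N^\alpha_\beta}{\partial x^\gamma}v^\gamma-2\frac{\partial N^\alpha_\beta}{\partial v^\gamma}G^\gamma\Big)-\sum_\gamma N^\alpha_\gamma N^\gamma_\beta .$$ Let $R_v$ be the endomorphism of $T_xM$ with matrix $(R^\alpha_\beta(v))$, and $\mathrm{Ric}(v)=\mathrm{trace}(R_v)$. A future-directed causal geodesic is a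 smooth curve $\eta$ on a nondegenerate interval with future-directed causal velocity and $\ddot\eta^\alpha+\sum\widetilde\Gamma^\alpha_{\beta\gamma}(\dot\eta)\dot\eta^\beta\dot\eta^\gamma=0$; put $\psi_\eta(t)=\psi(\dot\eta(t))$. The covariant derivative of a vector field $Y$ along $\eta$ is $(Y')^\alpha=\dot Y^\alpha+\sum\Gamma^\alpha_{\beta\gamma}(\dot\eta)\dot\eta^\beta Y^\gamma$. For a future-directed causal vector $v$ let $\gamma$ be the geodesic with $\dot\gamma(0)=v$; define, for $N\in\mathbb R\setminus\{n\}$, $$\mathrm{Ric}_N(v)=\mathrm{Ric}(v)+\psi_\gamma''(0)-\frac{\psi_\gamma'(0)^2}{N-n},\qquad \mathrm{Ric}_\infty(v)=\mathrm{Ric}(v)+\psi_\gamma''(0).$$ *Lagrange tensor fields.* Let $\eta:I\to M$ be a future-directed lightlike geodesic, i.e. in addition $L(\dot\eta)=0$, $\dot\eta\ne0$. Put $N_\eta(t)=\{w\in T_{\eta(t)}M: g_{\dot\eta(t)}(\dot\eta(t),w)=0\}$ and $Q_\eta(t)=N_\eta(t)/\mathbb R\dot\eta(t)$, which has dimension $n-1$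 and carries the metric $h$ induced by $g_{\dot\eta}$. The covariant derivative and $R_{\dot\eta}$ descend to $Q_\eta$; for fields $A$ of endomorphisms of $Q_\eta$, $A'(q)=(Aq)'-A(q')$. A Lagrange tensor field along $\eta$ is a smooth field $J$ of endomorphisms of $Q_\eta$ with $J''+RJ=0$ ($R$ being induced by $R_{\dot\eta}$), $\ker J(t)\cap\ker J'(t)=\{0\}$ for all $t\in I$, and $(J')^{T}J-J^{T}J'=0$, the transpose being taken with respect to $h$. It is nonsingular if $J(t)$ is invertible for every $t\in I$. *$\epsilon$-quantities.* Let $\epsilon\in\mathbb R$ and $\tau_\epsilon(t)=\int_{t_0}^t e^{\frac{2(\epsilon-1)}{n-1}\psi_\eta(s)}\,ds$ with $t_0\in I$, and denote by ${}^*$ the (covariant) derivative with respect to $\tau_\epsilon$; in particular $\eta^*=e^{\frac{2(1-\epsilon)}{n-1}\psi_\eta}\dot\eta$. Put $$J_\psi=e^{-\psi_\eta/(n-1)}J,\quad B_\epsilon=J_\psi^*J_\psi^{-1},\quad \theta_\epsilon=\mathrm{trace}(B_\epsilon),\quad \sigma_\epsilon=B_\epsilon-\frac{\theta_\epsilon}{n-1}I_{n-1}.$$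 *Statement.* Let $J$ be a nonsingular Lagrange tensor field along a future-directed lightlike geodesic $\eta:I\to M$, and let $\epsilon\in\mathbb R$. Then $\theta_\epsilon$ is differentiable on $I$, and on $I$ the following hold. 1. For $N=1$: $$\theta_\epsilon^*+\frac{2\epsilon}{n-1}\psi_\eta^*\theta_\epsilon+\frac{\theta_\epsilon^2}{n-1}+\mathrm{trace}(\sigma_\epsilon^2)+\mathrm{Ric}_1(\eta^*)=0.$$ 2. For every $N\in\mathbb R\setminus\{1,n\}$: $$\theta_\epsilon^*+\Big(1-\epsilon^2\frac{N-n}{N-1}\Big)\frac{\theta_\epsilon^2}{n-1}+\frac{(N-1)(N-n)}{n-1}\Big(\frac{\epsilon\theta_\epsilon}{N-1}+\frac{\psi_\eta^*}{N-n}\Big)^2+\mathrm{trace}(\sigma_\epsilon^2)+\mathrm{Ric}_N(\eta^*)=0.$$ 3. For $N=+\infty$: $$\theta_\epsilon^*+(1-\epsilon^2)\frac{\theta_\epsilon^2}{n-1}+\frac1{n-1}\big(\epsilon\theta_\epsilon+\psi_\eta^*\big)^2+\mathrm{trace}(\sigma_\epsilon^2)+\mathrm{Ric}_\infty(\eta^*)=0.$$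 -/

import Mathlib

open scoped Manifold ContDiff

noncomputable section

namespace LorentzFinsler

/-- The model space `ℝⁿ⁺¹`. The manifold has dimension `n + 1`; indices run over `0, …, n`. -/
abbrev Coord (n : ℕ) : Type := EuclideanSpace ℝ (Fin (n + 1))

/-- The tangent bundle of a manifold modelled on `ℝⁿ⁺¹`. -/
abbrev TB (n : ℕ) (M : Type*) [TopologicalSpace M] [ChartedSpace (Coord n) M]
    [IsManifold 𝓘(ℝ, Coord n) ∞ M] : Type _ :=
  TangentBundle 𝓘(ℝ, Coord n) M

section Coordinates

variable {n : ℕ}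

/-- `∂f/∂x^α` for a function of the bundle coordinates `(x, v)`. -/
def dX (f : Coord n × Coord n → ℝ) (α : Fin (n + 1)) (z : Coord n × Coord n) : ℝ :=
  fderiv ℝ f z (EuclideanSpace.single α 1, 0)

/-- `∂f/∂v^α` for a function of the bundle coordinates `(x, v)`. -/
def dV (f : Coord n × Coord n → ℝ) (α : Fin (n + 1)) (z : Coord n × Coord n) : ℝ :=
  fderiv ℝ f z (0, EuclideanSpace.single α 1)

/-- `g_{αβ} = ∂²ℓ/∂v^α∂v^β`; here `ℓ` is the coordinate expression of the Lagrangian. -/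
def gMat (ℓ : Coord n × Coord n → ℝ) (z : Coord n × Coord n) :
    Matrix (Fin (n + 1)) (Fin (n + 1)) ℝ :=
  Matrix.of fun α β => dV (dV ℓ β) α z

/-- The formal Christoffel symbols `Γ̃^α_{βγ}`. -/
def christoffel (ℓ : Coord n × Coord n → ℝ) (α β γ : Fin (n + 1)) (z : Coord n × Coord n) : ℝ :=
  1 / 2 * ∑ δ, (gMat ℓ z)⁻¹ α δ *
    (dX (fun u => gMat ℓ u δ γ) β z + dX (fun u => gMat ℓ u β δ) γ z
      - dX (fun u => gMat ℓ u β γ) δ z)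

/-- The geodesic spray coefficients `G^α = ½ Γ̃^α_{βγ} v^β v^γ`. -/
def spray (ℓ : Coord n × Coord n → ℝ) (α : Fin (n + 1)) (z : Coord n × Coord n) : ℝ :=
  1 / 2 * ∑ β, ∑ γ, christoffel ℓ α β γ z * z.2 β * z.2 γ

/-- The nonlinear connection `N^α_β = ∂G^α/∂v^β`. -/
def nlConn (ℓ : Coord n × Coord n → ℝ) (α β : Fin (n + 1)) (z : Coord n × Coord n) : ℝ :=
  dV (spray ℓ α) β z

/-- The coefficients `Γ^α_{βγ}` of the Chern connection. -/
def chern (ℓ : Coord n × Coord n → ℝ) (α β γ : Fin (n + 1)) (z : Coord n × Coord n) : ℝ :=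
  christoffel ℓ α β γ z - 1 / 2 * ∑ δ, ∑ μ, (gMat ℓ z)⁻¹ α δ *
    (dV (fun u => gMat ℓ u δ γ) μ z * nlConn ℓ μ β z
      + dV (fun u => gMat ℓ u β δ) μ z * nlConn ℓ μ γ z
      - dV (fun u => gMat ℓ u β γ) μ z * nlConn ℓ μ δ z)

/-- The components `R^α_β` of the curvature endomorphism. -/
def curvMat (ℓ : Coord n × Coord n → ℝ) (z : Coord n × Coord n) :
    Matrix (Fin (n + 1)) (Fin (n + 1)) ℝ :=
  Matrix.of fun α β =>
    2 * dX (spray ℓ α) β z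
      - ∑ γ, (dX (nlConn ℓ α β) γ z * z.2 γ - 2 * dV (nlConn ℓ α β) γ z * spray ℓ γ z)
      - ∑ γ, nlConn ℓ α γ z * nlConn ℓ γ β z

end Coordinates

variable {n : ℕ} {M : Type*} [TopologicalSpace M] [ChartedSpace (Coord n) M]
  [IsManifold 𝓘(ℝ, Coord n) ∞ M]

/-- The bundle chart `(x^α, v^β)` of `TM` induced by the chart of `M` around `x₀`. -/
def tchart (x₀ : M) : PartialEquiv (TB n M) (Coord n × Coord n) :=
  extChartAt (𝓘(ℝ, Coord n).tangent) (⟨x₀, 0⟩ : TB n M)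

/-- The Lagrangian in the bundle coordinates around `x₀`. -/
def localL (L : TB n M → ℝ) (x₀ : M) : Coord n × Coord n → ℝ :=
  fun z => L ((tchart x₀).symm z)

/-- The components of `w ∈ T_xM` in the chart around `x` itself. In Mathlib, `T_xM` is a copy of the
model space, identified with it through this chart. -/
def components (x : M) : TangentSpace 𝓘(ℝ, Coord n) x →ₗ[ℝ] Coord n :=
  (LinearMap.id : Coord n →ₗ[ℝ] Coord n)

/-- `g_v(w₁, w₂)` for `v = p ∈ T_xM`. -/
def gForm (L : TB n M → ℝ) (p : TB n M) (w₁ w₂ : TangentSpace 𝓘(ℝ, Coord n) p.1) : ℝ :=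
  ∑ α, ∑ β, components p.1 w₁ α * components p.1 w₂ β *
    gMat (localL L p.1) (tchart p.1 p) α β

/-- The curvature endomorphism `R_v : T_xM → T_xM` for `v = p ∈ T_xM`. -/
def curv (L : TB n M → ℝ) (p : TB n M) :
    TangentSpace 𝓘(ℝ, Coord n) p.1 →ₗ[ℝ] TangentSpace 𝓘(ℝ, Coord n) p.1 :=
  (Matrix.toEuclideanLin (curvMat (localL L p.1) (tchart p.1 p)) : Coord n →ₗ[ℝ] Coord n)

/-- The Ricci curvature `Ric(v) = trace R_v`. -/
def ric (L : TB n M → ℝ) (p : TB n M) : ℝ :=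
  LinearMap.trace ℝ (TangentSpace 𝓘(ℝ, Coord n) p.1) (curv L p)

/-- Lorentz–Finsler structures (in the sense of Beem). -/
structure IsLorentzFinsler (L : TB n M → ℝ) : Prop where
  smooth : ContMDiffOn (𝓘(ℝ, Coord n).tangent) 𝓘(ℝ, ℝ) ∞ L {p | p.2 ≠ 0}
  homog : ∀ (x : M) (v : TangentSpace 𝓘(ℝ, Coord n) x) (c : ℝ), 0 < c →
    L ⟨x, c • v⟩ = c ^ 2 * L ⟨x, v⟩
  signature : ∀ p : TB n M, p.2 ≠ 0 →
    ∃ b : Module.Basis (Fin (n + 1)) ℝ (TangentSpace 𝓘(ℝ, Coord n) p.1),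
      ∀ i j, gForm L p (b i) (b j) = if i = j then (if i = 0 then -1 else 1) else 0

/-- `X` is a smooth timelike vector field; it time-orients `(M, L)`. -/
structure IsTimeOrientation (L : TB n M → ℝ) (X : ∀ x : M, TangentSpace 𝓘(ℝ, Coord n) x) :
    Prop where
  smooth : ContMDiff 𝓘(ℝ, Coord n) (𝓘(ℝ, Coord n).tangent) ∞ (fun x => (⟨x, X x⟩ : TB n M))
  timelike : ∀ x, L ⟨x, X x⟩ < 0

/-- The bundle of future-directed causal vectors: those lying in the connected component of
`closure Ω'_x \ {0}` that contains `X x`, where `Ω'_x` is the set of timelike vectors. -/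
def futureCausal (L : TB n M → ℝ) (X : ∀ x : M, TangentSpace 𝓘(ℝ, Coord n) x) : Set (TB n M) :=
  {p | p.2 ∈ connectedComponentIn
    (closure {v : TangentSpace 𝓘(ℝ, Coord n) p.1 | L ⟨p.1, v⟩ < 0} \ {0}) (X p.1)}

/-- Weight functions: `C^∞` and positively `0`-homogeneous on the bundle of future-directed causal
vectors. The values of `ψ` elsewhere are irrelevant. -/
structure IsWeight (L : TB n M → ℝ) (X : ∀ x : M, TangentSpace 𝓘(ℝ, Coord n) x)
    (ψ : TB n M → ℝ) : Prop where
  smooth : ContMDiffOn (𝓘(ℝ, Coord n).tangent) 𝓘(ℝ, ℝ) ∞ ψ (futureCausal L X)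
  homog : ∀ p ∈ futureCausal L X, ∀ c : ℝ, 0 < c → ψ ⟨p.1, c • p.2⟩ = ψ p

/-- The velocity `η̇(t)` of a curve `η : I → M` (one-sided at end points of `I`). Curves are
functions on `ℝ`, of which only the restriction to `I` matters. -/
def velocity (η : ℝ → M) (I : Set ℝ) (t : ℝ) : TB n M :=
  ⟨η t, mfderivWithin 𝓘(ℝ, ℝ) 𝓘(ℝ, Coord n) η I t (1 : ℝ)⟩

/-- `η : I → M` is a future-directed causal geodesic on the nondegenerate interval `I`: a smooth
future-directed causal curve with `η̈^α + Γ̃^α_{βγ}(η̇) η̇^β η̇^γ = 0` in local coordinates. -/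
structure IsCausalGeodesic (L : TB n M → ℝ) (X : ∀ x : M, TangentSpace 𝓘(ℝ, Coord n) x)
    (η : ℝ → M) (I : Set ℝ) : Prop where
  interval : I.OrdConnected
  nontrivial : I.Nontrivial
  smooth : ContMDiffOn 𝓘(ℝ, ℝ) 𝓘(ℝ, Coord n) ∞ η I
  causal : ∀ t ∈ I, velocity η I t ∈ futureCausal L X
  geodesic : ∀ x₀ : M, ∀ t ∈ I, η t ∈ (chartAt (Coord n) x₀).source → ∀ α : Fin (n + 1),
    derivWithin (fun s => (tchart x₀ (velocity η I s)).2 α) I t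
      + ∑ β, ∑ γ, christoffel (localL L x₀) α β γ (tchart x₀ (velocity η I t))
          * (tchart x₀ (velocity η I t)).2 β * (tchart x₀ (velocity η I t)).2 γ = 0

/-- A future-directed lightlike geodesic. -/
structure IsLightlikeGeodesic (L : TB n M → ℝ) (X : ∀ x : M, TangentSpace 𝓘(ℝ, Coord n) x)
    (η : ℝ → M) (I : Set ℝ) : Prop extends IsCausalGeodesic L X η I where
  null : ∀ t ∈ I, L (velocity η I t) = 0
  ne_zero : ∀ t ∈ I, (velocity (n := n) η I t).2 ≠ 0

/-- `ψ_η(t) = ψ(η̇(t))`. -/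
def psiAlong (ψ : TB n M → ℝ) (η : ℝ → M) (I : Set ℝ) (t : ℝ) : ℝ := ψ (velocity η I t)

/-- The geodesic `γ` with `γ̇(0) = p`, together with an interval around `0` on which it is
considered. (By uniqueness of geodesics its germ does not depend on the choice. One-sided intervals
`[0, ε)`, `(-ε, 0]` are permitted; derivatives at `0` are then one-sided.) -/
def geodesicFrom (L : TB n M → ℝ) (X : ∀ x : M, TangentSpace 𝓘(ℝ, Coord n) x) (p : TB n M) :
    Set ℝ × (ℝ → M) :=
  haveI : Nonempty (Set ℝ × (ℝ → M)) := ⟨(∅, fun _ => p.1)⟩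
  Classical.epsilon fun Sγ : Set ℝ × (ℝ → M) =>
    (0 : ℝ) ∈ Sγ.1 ∧ IsCausalGeodesic L X Sγ.2 Sγ.1 ∧ velocity Sγ.2 Sγ.1 0 = p

/-- `ψ_γ'(0)` for the geodesic `γ` with `γ̇(0) = p`. -/
def psiDot (L : TB n M → ℝ) (X : ∀ x : M, TangentSpace 𝓘(ℝ, Coord n) x) (ψ : TB n M → ℝ)
    (p : TB n M) : ℝ :=
  derivWithin (psiAlong ψ (geodesicFrom L X p).2 (geodesicFrom L X p).1) (geodesicFrom L X p).1 0

/-- `ψ_γ''(0)` for the geodesic `γ` with `γ̇(0) = p`. -/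
def psiDDot (L : TB n M → ℝ) (X : ∀ x : M, TangentSpace 𝓘(ℝ, Coord n) x) (ψ : TB n M → ℝ)
    (p : TB n M) : ℝ :=
  derivWithin (derivWithin (psiAlong ψ (geodesicFrom L X p).2 (geodesicFrom L X p).1)
    (geodesicFrom L X p).1) (geodesicFrom L X p).1 0

/-- The weighted Ricci curvature `Ric_N(p)`, for `N ∈ ℝ \ {n}`. -/
def ricN (L : TB n M → ℝ) (X : ∀ x : M, TangentSpace 𝓘(ℝ, Coord n) x) (ψ : TB n M → ℝ)
    (N : ℝ) (p : TB n M) : ℝ :=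
  ric L p + psiDDot L X ψ p - psiDot L X ψ p ^ 2 / (N - n)

/-- The weighted Ricci curvature `Ric_∞(p)`. -/
def ricInfty (L : TB n M → ℝ) (X : ∀ x : M, TangentSpace 𝓘(ℝ, Coord n) x) (ψ : TB n M → ℝ)
    (p : TB n M) : ℝ :=
  ric L p + psiDDot L X ψ p

/-- `{w ∈ T_xM | g_v(v, w) = 0}` for `v = p ∈ T_xM`. -/
def orth (L : TB n M → ℝ) (p : TB n M) : Submodule ℝ (TangentSpace 𝓘(ℝ, Coord n) p.1) where
  carrier := {w | gForm L p p.2 w = 0}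
  zero_mem' := by simp [gForm]
  add_mem' := by
    intro a b ha hb
    simp only [Set.mem_ofPred_eq, gForm] at ha hb ⊢
    simp only [map_add, PiLp.add_apply, mul_add, add_mul, Finset.sum_add_distrib, ha, hb, add_zero]
  smul_mem' := by
    intro c a ha
    simp only [Set.mem_ofPred_eq, gForm] at ha ⊢
    simp only [map_smul, PiLp.smul_apply, smul_eq_mul]
    rw [← mul_zero c, ← ha, Finset.mul_sum]
    refine Finset.sum_congr rfl fun α _ => ?_
    rw [Finset.mul_sum]
    exact Finset.sum_congr rfl fun β _ => by ring

/-- The quotient `Q = {w | g_v(v, w) = 0} / ℝ v` for a lightlike vector `v = p`. -/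
abbrev quot (L : TB n M → ℝ) (p : TB n M) : Type :=
  ↥(orth L p) ⧸ (Submodule.comap (orth L p).subtype (Submodule.span ℝ {p.2}))

/-- The projection of `{w | g_v(v, w) = 0}` onto `Q`. -/
def toQuot (L : TB n M → ℝ) (p : TB n M) : ↥(orth L p) →ₗ[ℝ] quot L p :=
  Submodule.mkQ _

/-- The metric `h` induced by `g_v` on `Q` (independent of the representatives). -/
def quotMetric (L : TB n M → ℝ) (p : TB n M) (q₁ q₂ : quot L p) : ℝ :=
  gForm L p (Quotient.out q₁ : ↥(orth L p)) (Quotient.out q₂ : ↥(orth L p))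

/-- `Y : U → TM` is a smooth vector field along `η : I → M`, defined on `U ⊆ I`, and `Y'` is its
covariant derivative `D^{η̇}_{η̇} Y`: in all local coordinates of the atlas around points `x₀`,
`(Y')^α = dY^α/dt + Γ^α_{βγ}(η̇) η̇^β Y^γ`. -/
def IsCovDeriv (L : TB n M → ℝ) (η : ℝ → M) (I U : Set ℝ)
    (Y Y' : ∀ t : ℝ, TangentSpace 𝓘(ℝ, Coord n) (η t)) : Prop :=
  ContMDiffOn 𝓘(ℝ, ℝ) (𝓘(ℝ, Coord n).tangent) ∞ (fun t => (⟨η t, Y t⟩ : TB n M)) U ∧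
  ∀ x₀ : M, ∀ t ∈ U, η t ∈ (chartAt (Coord n) x₀).source → ∀ α : Fin (n + 1),
    (tchart x₀ (⟨η t, Y' t⟩ : TB n M)).2 α =
      derivWithin (fun s => (tchart x₀ (⟨η s, Y s⟩ : TB n M)).2 α) I t
      + ∑ β, ∑ γ, chern (localL L x₀) α β γ (tchart x₀ (velocity η I t))
          * (tchart x₀ (velocity η I t)).2 β * (tchart x₀ (⟨η t, Y t⟩ : TB n M)).2 γ

/-- `q` is a smooth section over `U ⊆ I` of the bundle `Q_η` along `η : I → M`, and `q'` is its
covariant derivative: `q` is the class of a smooth vector field `Y` orthogonal to `η̇`, and `q'` is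
the class of `Y'`. -/
def IsCovDerivSection (L : TB n M → ℝ) (η : ℝ → M) (I U : Set ℝ)
    (q q' : ∀ t : ℝ, quot L (velocity η I t)) : Prop :=
  ∃ Y Y' : ∀ t : ℝ, ↥(orth L (velocity η I t)),
    IsCovDeriv L η I U (fun t => (orth L (velocity η I t)).subtype (Y t))
      (fun t => (orth L (velocity η I t)).subtype (Y' t)) ∧
    ∀ t ∈ U, toQuot L _ (Y t) = q t ∧ toQuot L _ (Y' t) = q' t

/-- Fields of endomorphisms of `Q_η`. Only the values on `I` matter. -/
abbrev EndField (L : TB n M → ℝ) (η : ℝ → M) (I : Set ℝ) : Type :=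
  ∀ t : ℝ, Module.End ℝ (quot L (velocity η I t))

/-- `A` is a smooth field of endomorphisms of `Q_η` with covariant derivative `A'`: on every
relatively open subset of `I`, `A` maps smooth sections to smooth sections, and the Leibniz rule
`(A q)' = A' q + A q'` holds. -/
def IsCovDerivEnd (L : TB n M → ℝ) (η : ℝ → M) (I : Set ℝ) (A A' : EndField L η I) : Prop :=
  ∀ O : Set ℝ, IsOpen O → ∀ q q' : ∀ t : ℝ, quot L (velocity η I t),
    IsCovDerivSection L η I (I ∩ O) q q' →
      IsCovDerivSection L η I (I ∩ O) (fun t => A t (q t)) (fun t => A' t (q t) + A t (q' t))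

/-- Smooth fields of endomorphisms of `Q_η`. -/
def IsSmoothEnd (L : TB n M → ℝ) (η : ℝ → M) (I : Set ℝ) (A : EndField L η I) : Prop :=
  ∃ A' : EndField L η I, IsCovDerivEnd L η I A A'

/-- The covariant derivative `A'` of a smooth field of endomorphisms `A` of `Q_η` (unique on `I`;
zero by convention if `A` is not smooth). -/
def covDerivEnd (L : TB n M → ℝ) (η : ℝ → M) (I : Set ℝ) (A : EndField L η I) : EndField L η I :=
  open Classical in
  if h : IsSmoothEnd L η I A then Classical.choose h else 0

/-- Jacobi tensor fields along the lightlike geodesic `η`. The equation `J'' + R J = 0`, where `R` is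
the endomorphism of `Q_η` induced by `R_{η̇}`, is expressed through representatives `y`, `z` of
`J'' q` and `J q`: it says that `y + R_{η̇}(z)` vanishes modulo `ℝ η̇`. -/
structure IsJacobiTensor (L : TB n M → ℝ) (η : ℝ → M) (I : Set ℝ) (J : EndField L η I) :
    Prop where
  smooth : IsSmoothEnd L η I J
  smooth_deriv : IsSmoothEnd L η I (covDerivEnd L η I J)
  jacobi : ∀ t ∈ I, ∀ (q : quot L (velocity η I t)) (y z : ↥(orth L (velocity η I t))),
    toQuot L _ y = covDerivEnd L η I (covDerivEnd L η I J) t q → toQuot L _ z = J t q →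
      (y : TangentSpace 𝓘(ℝ, Coord n) (velocity η I t).1) + curv L (velocity η I t) z ∈
        Submodule.span ℝ {(velocity η I t).2}
  ker : ∀ t ∈ I, LinearMap.ker (J t) ⊓ LinearMap.ker (covDerivEnd L η I J t) = ⊥

/-- Lagrange tensor fields: `(J')ᵀ J - Jᵀ J' = 0`, the transpose being taken with respect to `h`. -/
structure IsLagrangeTensor (L : TB n M → ℝ) (η : ℝ → M) (I : Set ℝ) (J : EndField L η I) :
    Prop extends IsJacobiTensor L η I J where
  lagrange : ∀ t ∈ I, ∀ q₁ q₂ : quot L (velocity η I t),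
    quotMetric L _ (J t q₁) (covDerivEnd L η I J t q₂) =
      quotMetric L _ (covDerivEnd L η I J t q₁) (J t q₂)

/-- The parameter `τ_ε(t) = ∫_{t₀}^t exp (2(ε - 1)/(n - 1) ψ_η(s)) ds`. -/
def epsTime (ψ : TB n M → ℝ) (ε : ℝ) (η : ℝ → M) (I : Set ℝ) (t₀ t : ℝ) : ℝ :=
  ∫ s in t₀..t, Real.exp (2 * (ε - 1) / ((n : ℝ) - 1) * psiAlong ψ η I s)

/-- The derivative `f^* = d(f ∘ τ_ε⁻¹)/dτ_ε` of a real function `f` on `I`, at `τ_ε(t)`. -/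
def starDeriv (ψ : TB n M → ℝ) (ε : ℝ) (η : ℝ → M) (I : Set ℝ) (t₀ : ℝ) (f : ℝ → ℝ) (t : ℝ) : ℝ :=
  derivWithin (fun r => f (Function.invFunOn (epsTime ψ ε η I t₀) I r))
    (epsTime ψ ε η I t₀ '' I) (epsTime ψ ε η I t₀ t)

/-- `dt/dτ_ε`, so that `D/dτ_ε = (dt/dτ_ε) D/dt` for fields along `η`. -/
def timeRate (ψ : TB n M → ℝ) (ε : ℝ) (η : ℝ → M) (I : Set ℝ) (t₀ t : ℝ) : ℝ :=
  (derivWithin (epsTime ψ ε η I t₀) I t)⁻¹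

/-- `η^* = dη/dτ_ε`. -/
def etaStar (ψ : TB n M → ℝ) (ε : ℝ) (η : ℝ → M) (I : Set ℝ) (t₀ t : ℝ) : TB n M :=
  ⟨η t, timeRate ψ ε η I t₀ t • (velocity η I t).2⟩

/-- The weighted Jacobi endomorphism `J_ψ = exp (-ψ_η/(n - 1)) J`. -/
def weightedJ (L : TB n M → ℝ) (ψ : TB n M → ℝ) (η : ℝ → M) (I : Set ℝ) (J : EndField L η I) :
    EndField L η I :=
  fun t => Real.exp (-psiAlong ψ η I t / ((n : ℝ) - 1)) • J t

/-- `B_ε = J_ψ^* J_ψ⁻¹`. -/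
def epsB (L : TB n M → ℝ) (ψ : TB n M → ℝ) (ε : ℝ) (η : ℝ → M) (I : Set ℝ) (t₀ : ℝ)
    (J : EndField L η I) : EndField L η I :=
  fun t => (timeRate ψ ε η I t₀ t • covDerivEnd L η I (weightedJ L ψ η I J) t) *
    Ring.inverse (weightedJ L ψ η I J t)

/-- The `ε`-expansion scalar `θ_ε = trace B_ε`. -/
def epsTheta (L : TB n M → ℝ) (ψ : TB n M → ℝ) (ε : ℝ) (η : ℝ → M) (I : Set ℝ) (t₀ : ℝ)
    (J : EndField L η I) (t : ℝ) : ℝ :=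
  LinearMap.trace ℝ (quot L (velocity η I t)) (epsB L ψ ε η I t₀ J t)

/-- The `ε`-shear tensor `σ_ε = B_ε - θ_ε/(n - 1) I_{n-1}`. -/
def epsSigma (L : TB n M → ℝ) (ψ : TB n M → ℝ) (ε : ℝ) (η : ℝ → M) (I : Set ℝ) (t₀ : ℝ)
    (J : EndField L η I) : EndField L η I :=
  fun t => epsB L ψ ε η I t₀ J t - (epsTheta L ψ ε η I t₀ J t / ((n : ℝ) - 1)) • 1

/-- `trace (σ_ε²)`. -/
def epsShearSq (L : TB n M → ℝ) (ψ : TB n M → ℝ) (ε : ℝ) (η : ℝ → M) (I : Set ℝ) (t₀ : ℝ)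
    (J : EndField L η I) (t : ℝ) : ℝ :=
  LinearMap.trace ℝ (quot L (velocity η I t))
    (epsSigma L ψ ε η I t₀ J t * epsSigma L ψ ε η I t₀ J t)

end LorentzFinsler

end

open LorentzFinsler

/-!
Let `η` be a lightlike geodesic, `J` a nonsingular Jacobi tensor field on the bundle `Q_η`,
`B = J' J⁻¹` and `θ = trace B`. The unweighted Raychaudhuri equation `θ' = - Ric (η̇) - trace B²` is
the trace of the Riccati equation `B' = - R - B²`; the weighted equations follow from it by
algebra.

For the Riccati equation one needs that the covariant derivative on `Q_η` is determined by the
definitions and can be computed. Along `η̇`, the Chern connection acts through the nonlinear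
connection, `∑ Γ^α_{βγ}(v) v^β Y^γ = N^α_γ(v) Y^γ` (`IsLocalLagrangian.chern_sum`), and the nonlinear
connection is the fibre derivative of the spray. Since the spray is characterized by the
Euler–Lagrange equation, it transforms correctly under changes of coordinates
(`sprayVec_changeOfCoordinates`, `fderiv_sprayVec_changeOfCoordinates`), so that a covariant derivative
may be computed in a single chart (`IsCausalGeodesic.isCovDeriv_of_chart`). The Lagrangian is constant
along horizontal directions, so covariant differentiation preserves orthogonality to `η̇`
(`IsCausalGeodesic.momentum_covDeriv`). This yields local frames of `Q_η`
(`IsLightlikeGeodesic.exists_localFrame`), in which fields of endomorphisms become matrices and the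
covariant derivative becomes `A' + [Γ, A]`. The commutator terms drop out of the trace, whence
`IsJacobiTensor.raychaudhuri`. The trace of `R` on `Q_η` is the full trace `Ric (η̇)` because `R_v` kills
`v` and takes values in the orthogonal space of `v` (`IsLorentzFinsler.trace_quot_curv`).

For the weighted version, `B_ε = (dt/dτ) (B - ψ_η'/(n - 1))`, which gives `θ_ε` and `trace σ_ε²`
in terms of `θ`, `trace B²` and `ψ_η'`. The quantity `Ric_N (η^*)` involves a geodesic with initial
velocity `η^* = (dt/dτ) η̇`. The first two derivatives of `ψ` along a geodesic depend only on its
velocity (`IsWeight.exists_derivs`, by the chain rule in a chart, since geodesics are integral curves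
of the spray), and an affine reparametrization of `η` is such a geodesic; so they equal
`(dt/dτ) ψ_η'` and `(dt/dτ)² ψ_η''`. Likewise `Ric (η^*) = (dt/dτ)² Ric (η̇)` by homogeneity. Substituting
all this, each of the three equations becomes an identity of rational functions.
-/

noncomputable section

namespace LorentzFinsler

/-! ### Calculus of Lagrangians in bundle coordinates -/

section LocalLagrangian

variable {n : ℕ}

/-- The part of the bundle chart domain over `D` that lies off the zero section. -/
def slit (D : Set (Coord n)) : Set (Coord n × Coord n) := D ×ˢ {0}ᶜ

/-- A Lagrangian in bundle coordinates over `D`: smooth off the zero section, positively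
`2`-homogeneous in the fibre, with nondegenerate fibre Hessian. -/
structure IsLocalLagrangian (ℓ : Coord n × Coord n → ℝ) (D : Set (Coord n)) : Prop where
  isOpen : IsOpen D
  smooth : ContDiffOn ℝ ∞ ℓ (slit D)
  homog : ∀ x ∈ D, ∀ (v : Coord n) (c : ℝ), 0 < c → ℓ (x, c • v) = c ^ 2 * ℓ (x, v)
  nondeg : ∀ z ∈ slit D, ∀ a : Coord n,
    (∀ b : Coord n, fderiv ℝ (fderiv ℝ ℓ) z (0, a) (0, b) = 0) → a = 0

/-- The spray coefficients `G^α`, as a vector. -/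
def sprayVec (ℓ : Coord n × Coord n → ℝ) (z : Coord n × Coord n) : Coord n :=
  WithLp.toLp 2 fun α => spray ℓ α z

section Smooth

variable {F : Type*} [NormedAddCommGroup F] [NormedSpace ℝ F]
variable {H : Type*} [NormedAddCommGroup H] [NormedSpace ℝ H]

theorem smooth_fderiv {f : F → H} {s : Set F} (hs : IsOpen s) (hf : ContDiffOn ℝ ∞ f s) :
    ContDiffOn ℝ ∞ (fderiv ℝ f) s :=
  hf.fderiv_of_isOpen hs (by simp)

theorem smooth_differentiableAt {f : F → H} {s : Set F} (hs : IsOpen s) (hf : ContDiffOn ℝ ∞ f s)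
    {z : F} (hz : z ∈ s) : DifferentiableAt ℝ f z :=
  (hf.contDiffAt (hs.mem_nhds hz)).differentiableAt (by simp)

theorem smooth_fderiv_apply {f : F → H} {s : Set F} (hs : IsOpen s) (hf : ContDiffOn ℝ ∞ f s)
    (a : F) : ContDiffOn ℝ ∞ (fun z => fderiv ℝ f z a) s :=
  (smooth_fderiv hs hf).clm_apply contDiffOn_const

theorem fderiv_fderiv_apply {f : F → H} {s : Set F} (hs : IsOpen s) (hf : ContDiffOn ℝ ∞ f s)
    {z : F} (hz : z ∈ s) (X Y : F) :
    fderiv ℝ (fun z => fderiv ℝ f z Y) z X = fderiv ℝ (fderiv ℝ f) z X Y := by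
  rw [fderiv_clm_apply (smooth_differentiableAt hs (smooth_fderiv hs hf) hz)
    (differentiableAt_const Y)]
  simp

theorem fderiv_fderiv_symm {f : F → H} {s : Set F} (hs : IsOpen s) (hf : ContDiffOn ℝ ∞ f s)
    {z : F} (hz : z ∈ s) (X Y : F) :
    fderiv ℝ (fderiv ℝ f) z X Y = fderiv ℝ (fderiv ℝ f) z Y X :=
  ((hf.contDiffAt (hs.mem_nhds hz)).isSymmSndFDerivAt (by
    rw [minSmoothness_of_isRCLikeNormedField]; exact WithTop.coe_le_coe.2 (le_top : (2 : ℕ∞) ≤ ⊤))).eq X Y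

/-- Symmetry of the third derivative in its last two arguments. -/
theorem fderiv3_symm {f : F → H} {s : Set F} (hs : IsOpen s) (hf : ContDiffOn ℝ ∞ f s)
    {z : F} (hz : z ∈ s) (X Y Z : F) :
    fderiv ℝ (fderiv ℝ (fderiv ℝ f)) z X Y Z = fderiv ℝ (fderiv ℝ (fderiv ℝ f)) z X Z Y := by
  have h1 := smooth_fderiv hs hf
  have key : ∀ Y Z : F, fderiv ℝ (fun z => fderiv ℝ (fderiv ℝ f) z Y Z) z X =
      fderiv ℝ (fderiv ℝ (fderiv ℝ f)) z X Y Z := by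
    intro Y Z
    rw [fderiv_clm_apply (smooth_differentiableAt hs (smooth_fderiv_apply hs h1 Y) hz)
      (differentiableAt_const Z)]
    simp [fderiv_fderiv_apply hs h1 hz X Y]
  rw [← key Y Z, ← key Z Y]
  refine congrArg (fun T : F →L[ℝ] H => T X) (Filter.EventuallyEq.fderiv_eq ?_)
  filter_upwards [hs.mem_nhds hz] with y hy using fderiv_fderiv_symm hs hf hy Y Z

/-- If two functions agree on an open set, so do their derivatives there. -/
theorem fderiv_congr_of_isOpen {f g : F → H} {s : Set F} (hs : IsOpen s)
    (h : ∀ z ∈ s, f z = g z) {z : F} (hz : z ∈ s) : fderiv ℝ f z = fderiv ℝ g z :=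
  Filter.EventuallyEq.fderiv_eq (Filter.eventuallyEq_of_mem (hs.mem_nhds hz) h)

end Smooth

theorem isOpen_slit {D : Set (Coord n)} (hD : IsOpen D) : IsOpen (slit D) :=
  hD.prod isOpen_compl_singleton

/-- A linear map out of the model space, evaluated through components. -/
theorem sum_smul_single {H : Type*} [AddCommGroup H] [Module ℝ H] (T : Coord n →ₗ[ℝ] H)
    (a : Coord n) : ∑ α, a α • T (EuclideanSpace.single α 1) = T a := by
  conv_rhs => rw [← (EuclideanSpace.basisFun (Fin (n + 1)) ℝ).sum_repr a]
  simp [map_sum]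

/-- Euler's relation for functions that are positively `k`-homogeneous in the fibre. -/
theorem euler_of_homog {H : Type*} [NormedAddCommGroup H] [NormedSpace ℝ H]
    {f : Coord n × Coord n → H} {D : Set (Coord n)} {k : ℕ}
    (hh : ∀ z ∈ slit D, ∀ c : ℝ, 0 < c → f (z.1, c • z.2) = c ^ k • f z)
    {z : Coord n × Coord n} (hz : z ∈ slit D) (hf : DifferentiableAt ℝ f z) :
    fderiv ℝ f z (0, z.2) = (k : ℝ) • f z := by
  have h1 : HasDerivAt (fun c : ℝ => (z.1, c • z.2)) ((0 : Coord n), z.2) 1 := by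
    simpa using (hasDerivAt_const (1 : ℝ) z.1).prodMk ((hasDerivAt_id (1 : ℝ)).smul_const z.2)
  have h2 : HasDerivAt (fun c : ℝ => f (z.1, c • z.2)) (fderiv ℝ f z (0, z.2)) 1 := by
    refine HasFDerivAt.comp_hasDerivAt (1 : ℝ) ?_ h1
    simpa using hf.hasFDerivAt
  have h3 : HasDerivAt (fun c : ℝ => c ^ k • f z) ((k : ℝ) • f z) 1 := by
    simpa using (hasDerivAt_pow k (1 : ℝ)).smul_const (f z)
  refine h2.unique (h3.congr_of_eventuallyEq ?_)
  filter_upwards [lt_mem_nhds (zero_lt_one' ℝ)] with c hc using hh z hz c hc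

theorem gMat_eq_of_smooth {ℓ : Coord n × Coord n → ℝ} {D : Set (Coord n)} (hD : IsOpen D)
    (hs : ContDiffOn ℝ ∞ ℓ (slit D)) {z : Coord n × Coord n} (hz : z ∈ slit D)
    (α β : Fin (n + 1)) : gMat ℓ z α β =
      fderiv ℝ (fderiv ℝ ℓ) z (0, EuclideanSpace.single α 1) (0, EuclideanSpace.single β 1) := by
  simp only [gMat, Matrix.of_apply, dV]
  exact fderiv_fderiv_apply (isOpen_slit hD) hs hz _ _

/-- The bilinear form of the fundamental tensor is the fibre Hessian of the Lagrangian. -/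
theorem gMat_sum_of_smooth {ℓ : Coord n × Coord n → ℝ} {D : Set (Coord n)} (hD : IsOpen D)
    (hs : ContDiffOn ℝ ∞ ℓ (slit D)) {z : Coord n × Coord n} (hz : z ∈ slit D) (a b : Coord n) :
    ∑ α, ∑ β, a α * b β * gMat ℓ z α β = fderiv ℝ (fderiv ℝ ℓ) z (0, a) (0, b) := by
  simp_rw [gMat_eq_of_smooth hD hs hz, mul_assoc, ← Finset.mul_sum]
  have h1 : ∀ X : Coord n × Coord n, ∑ β, b β * fderiv ℝ (fderiv ℝ ℓ) z X
      (0, EuclideanSpace.single β 1) = fderiv ℝ (fderiv ℝ ℓ) z X (0, b) := fun X =>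
    sum_smul_single ((fderiv ℝ (fderiv ℝ ℓ) z X).toLinearMap ∘ₗ LinearMap.inr ℝ _ _) b
  simp_rw [h1]
  exact sum_smul_single ((ContinuousLinearMap.apply ℝ ℝ ((0 : Coord n), b)).toLinearMap ∘ₗ
    (fderiv ℝ (fderiv ℝ ℓ) z).toLinearMap ∘ₗ LinearMap.inr ℝ _ _) a

namespace IsLocalLagrangian

variable {ℓ : Coord n × Coord n → ℝ} {D : Set (Coord n)} (h : IsLocalLagrangian ℓ D)
include h

theorem isOpen_slit : IsOpen (slit D) := LorentzFinsler.isOpen_slit h.isOpen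

theorem differentiableAt {z : Coord n × Coord n} (hz : z ∈ slit D) : DifferentiableAt ℝ ℓ z :=
  smooth_differentiableAt h.isOpen_slit h.smooth hz

theorem smooth1 : ContDiffOn ℝ ∞ (fderiv ℝ ℓ) (slit D) := smooth_fderiv h.isOpen_slit h.smooth

theorem smooth2 : ContDiffOn ℝ ∞ (fderiv ℝ (fderiv ℝ ℓ)) (slit D) :=
  smooth_fderiv h.isOpen_slit h.smooth1

theorem symm2 {z : Coord n × Coord n} (hz : z ∈ slit D) (X Y : Coord n × Coord n) :
    fderiv ℝ (fderiv ℝ ℓ) z X Y = fderiv ℝ (fderiv ℝ ℓ) z Y X :=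
  fderiv_fderiv_symm h.isOpen_slit h.smooth hz X Y

/-- Euler's relation for the Lagrangian. -/
theorem euler1 {z : Coord n × Coord n} (hz : z ∈ slit D) :
    fderiv ℝ ℓ z (0, z.2) = 2 * ℓ z := by
  simpa using euler_of_homog (k := 2) (fun z hz c hc => h.homog z.1 hz.1 z.2 c hc) hz
    (h.differentiableAt hz)

omit h in
theorem hasFDerivAt_zero_snd (z : Coord n × Coord n) :
    HasFDerivAt (fun z : Coord n × Coord n => ((0 : Coord n), z.2))
      ((0 : Coord n × Coord n →L[ℝ] Coord n).prod (ContinuousLinearMap.snd ℝ _ _)) z :=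
  (hasFDerivAt_const (0 : Coord n) z).prodMk hasFDerivAt_snd

/-- Euler's relation, differentiated. -/
theorem euler2 {z : Coord n × Coord n} (hz : z ∈ slit D) (Y : Coord n × Coord n) :
    fderiv ℝ (fderiv ℝ ℓ) z Y (0, z.2) = 2 * fderiv ℝ ℓ z Y - fderiv ℝ ℓ z (0, Y.2) := by
  have h1 := (smooth_differentiableAt h.isOpen_slit h.smooth1 hz).hasFDerivAt.clm_apply
    (hasFDerivAt_zero_snd z)
  have h2 := (h.differentiableAt hz).hasFDerivAt.const_mul 2
  have h3 := h1.unique (h2.congr_of_eventuallyEq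
    (Filter.eventuallyEq_of_mem (h.isOpen_slit.mem_nhds hz) fun y hy => h.euler1 hy))
  have h4 := congrArg (fun T : Coord n × Coord n →L[ℝ] ℝ => T Y) h3
  simp at h4
  linarith

/-- Euler's relation, differentiated twice. -/
theorem euler3 {z : Coord n × Coord n} (hz : z ∈ slit D) (X Y : Coord n × Coord n) :
    fderiv ℝ (fderiv ℝ (fderiv ℝ ℓ)) z X Y (0, z.2) =
      2 * fderiv ℝ (fderiv ℝ ℓ) z X Y - fderiv ℝ (fderiv ℝ ℓ) z X (0, Y.2)
        - fderiv ℝ (fderiv ℝ ℓ) z Y (0, X.2) := by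
  have d2 := smooth_differentiableAt h.isOpen_slit h.smooth2 hz
  have d1 := smooth_differentiableAt h.isOpen_slit h.smooth1 hz
  have h1 := (d2.hasFDerivAt.clm_apply (hasFDerivAt_const Y z)).clm_apply (hasFDerivAt_zero_snd z)
  have h2 := ((d1.hasFDerivAt.clm_apply (hasFDerivAt_const Y z)).const_mul 2).sub
    (d1.hasFDerivAt.clm_apply (hasFDerivAt_const ((0 : Coord n), Y.2) z))
  have h3 := h1.unique (h2.congr_of_eventuallyEq
    (Filter.eventuallyEq_of_mem (h.isOpen_slit.mem_nhds hz) fun y hy => h.euler2 hy Y))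
  have h4 := congrArg (fun T : Coord n × Coord n →L[ℝ] ℝ => T X) h3
  simp at h4
  linarith

theorem gMat_eq {z : Coord n × Coord n} (hz : z ∈ slit D) (α β : Fin (n + 1)) :
    gMat ℓ z α β = fderiv ℝ (fderiv ℝ ℓ) z (0, EuclideanSpace.single α 1)
      (0, EuclideanSpace.single β 1) :=
  gMat_eq_of_smooth h.isOpen h.smooth hz α β

theorem fderiv_gMat {z : Coord n × Coord n} (hz : z ∈ slit D) (α β : Fin (n + 1))
    (X : Coord n × Coord n) :
    fderiv ℝ (fun u => gMat ℓ u α β) z X = fderiv ℝ (fderiv ℝ (fderiv ℝ ℓ)) z X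
      (0, EuclideanSpace.single α 1) (0, EuclideanSpace.single β 1) := by
  rw [fderiv_congr_of_isOpen h.isOpen_slit (fun y hy => h.gMat_eq hy α β) hz,
    fderiv_clm_apply (smooth_differentiableAt h.isOpen_slit
      (smooth_fderiv_apply h.isOpen_slit h.smooth1 _) hz) (differentiableAt_const _)]
  simp [fderiv_fderiv_apply h.isOpen_slit h.smooth1 hz]

theorem smooth_gMat (α β : Fin (n + 1)) : ContDiffOn ℝ ∞ (fun z => gMat ℓ z α β) (slit D) :=
  ((h.smooth2.clm_apply contDiffOn_const).clm_apply contDiffOn_const).congr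
    fun _ hz => h.gMat_eq hz α β

theorem gMat_sum {z : Coord n × Coord n} (hz : z ∈ slit D) (a b : Coord n) :
    ∑ α, ∑ β, a α * b β * gMat ℓ z α β = fderiv ℝ (fderiv ℝ ℓ) z (0, a) (0, b) :=
  gMat_sum_of_smooth h.isOpen h.smooth hz a b

theorem det_gMat_ne_zero {z : Coord n × Coord n} (hz : z ∈ slit D) : (gMat ℓ z).det ≠ 0 := by
  intro h0
  obtain ⟨a, ha, hb⟩ := Matrix.exists_mulVec_eq_zero_iff.2 h0
  apply ha
  have := h.nondeg z hz (WithLp.toLp 2 a) (fun b => by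
    rw [h.symm2 hz, ← h.gMat_sum hz]
    refine Finset.sum_eq_zero fun α _ => ?_
    have := congrFun hb α
    simp only [Matrix.mulVec, dotProduct, Pi.zero_apply] at this
    calc _ = b α * ∑ β, gMat ℓ z α β * a β := by
          rw [Finset.mul_sum]; exact Finset.sum_congr rfl fun β _ => by simp; ring
      _ = 0 := by rw [this, mul_zero])
  simpa using congrArg WithLp.ofLp this

theorem smooth_gInv (α β : Fin (n + 1)) :
    ContDiffOn ℝ ∞ (fun z => (gMat ℓ z)⁻¹ α β) (slit D) := by
  have hdet : ∀ A : Coord n × Coord n → Matrix (Fin (n + 1)) (Fin (n + 1)) ℝ,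
      (∀ i j, ContDiffOn ℝ ∞ (fun z => A z i j) (slit D)) →
      ContDiffOn ℝ ∞ (fun z => (A z).det) (slit D) := by
    intro A hA
    simp_rw [Matrix.det_apply']
    exact ContDiffOn.sum fun σ _ => contDiffOn_const.mul (contDiffOn_prod fun i _ => hA _ _)
  simp only [Matrix.inv_def, Ring.inverse_eq_inv', Matrix.smul_apply, smul_eq_mul,
    Matrix.adjugate_apply]
  refine ((hdet _ h.smooth_gMat).inv fun z hz => h.det_gMat_ne_zero hz).mul (hdet _ fun i j => ?_)
  by_cases hi : i = β
  · simp only [Matrix.updateRow_apply, hi, if_true]; exact contDiffOn_const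
  · simp only [Matrix.updateRow_apply, hi, if_false]; exact h.smooth_gMat i j

theorem smooth_christoffel (α β γ : Fin (n + 1)) :
    ContDiffOn ℝ ∞ (christoffel ℓ α β γ) (slit D) := by
  have hd : ∀ i j k, ContDiffOn ℝ ∞ (fun z => dX (fun u => gMat ℓ u i j) k z) (slit D) :=
    fun i j k => smooth_fderiv_apply h.isOpen_slit (h.smooth_gMat i j) _
  exact contDiffOn_const.mul (ContDiffOn.sum fun δ _ => (h.smooth_gInv α δ).mul
    (((hd _ _ _).add (hd _ _ _)).sub (hd _ _ _)))

theorem smooth_spray (α : Fin (n + 1)) : ContDiffOn ℝ ∞ (spray ℓ α) (slit D) := by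
  have hv : ∀ β : Fin (n + 1), ContDiffOn ℝ ∞ (fun z : Coord n × Coord n => z.2 β) (slit D) :=
    fun β => ((EuclideanSpace.proj (𝕜 := ℝ) β).contDiff.comp contDiff_snd).contDiffOn
  exact contDiffOn_const.mul (ContDiffOn.sum fun β _ => ContDiffOn.sum fun γ _ =>
    ((h.smooth_christoffel α β γ).mul (hv β)).mul (hv γ))

theorem smooth_sprayVec : ContDiffOn ℝ ∞ (sprayVec ℓ) (slit D) :=
  contDiffOn_euclidean.2 fun α => h.smooth_spray α

theorem nlConn_eq {z : Coord n × Coord n} (hz : z ∈ slit D) (α β : Fin (n + 1)) :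
    nlConn ℓ α β z = fderiv ℝ (sprayVec ℓ) z (0, EuclideanSpace.single β 1) α := by
  have h1 := (EuclideanSpace.proj (𝕜 := ℝ) α).hasFDerivAt.comp z
    (smooth_differentiableAt h.isOpen_slit h.smooth_sprayVec hz).hasFDerivAt
  exact congrArg (fun T : Coord n × Coord n →L[ℝ] ℝ => T (0, EuclideanSpace.single β 1)) h1.fderiv

/-- Contraction with the inverse of `g`, expressed by pairing with `g`. -/
theorem hessian_of_gInv {z : Coord n × Coord n} (hz : z ∈ slit D) {u : Coord n}
    {τ : Coord n →ₗ[ℝ] ℝ} (hu : ∀ α, u α = ∑ δ, (gMat ℓ z)⁻¹ α δ * τ (EuclideanSpace.single δ 1))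
    (w : Coord n) : fderiv ℝ (fderiv ℝ ℓ) z (0, u) (0, w) = τ w := by
  rw [h.symm2 hz, ← h.gMat_sum hz, ← sum_smul_single τ w]
  refine Finset.sum_congr rfl fun α _ => ?_
  simp_rw [mul_assoc, ← Finset.mul_sum, smul_eq_mul]
  congr 1
  have : u.ofLp = (gMat ℓ z)⁻¹.mulVec fun δ => τ (EuclideanSpace.single δ 1) := by
    ext α; exact hu α
  have h2 : (gMat ℓ z).mulVec u.ofLp = fun δ => τ (EuclideanSpace.single δ 1) := by
    rw [this, Matrix.mulVec_mulVec, Matrix.mul_nonsing_inv _ (h.det_gMat_ne_zero hz).isUnit,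
      Matrix.one_mulVec]
  rw [← congrFun h2 α]
  exact Finset.sum_congr rfl fun β _ => mul_comm _ _

/-- `T_δ = ∑ (∂_β g_{δγ} + ∂_γ g_{βδ} - ∂_δ g_{βγ}) a^β b^γ`, without coordinates. -/
theorem christoffel_sum {z : Coord n × Coord n} (hz : z ∈ slit D) (a b : Coord n)
    (δ : Fin (n + 1)) :
    ∑ β, ∑ γ, (dX (fun u => gMat ℓ u δ γ) β z + dX (fun u => gMat ℓ u β δ) γ z
      - dX (fun u => gMat ℓ u β γ) δ z) * a β * b γ =
    fderiv ℝ (fderiv ℝ (fderiv ℝ ℓ)) z (a, 0) (0, EuclideanSpace.single δ 1) (0, b)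
      + fderiv ℝ (fderiv ℝ (fderiv ℝ ℓ)) z (b, 0) (0, a) (0, EuclideanSpace.single δ 1)
      - fderiv ℝ (fderiv ℝ (fderiv ℝ ℓ)) z (EuclideanSpace.single δ 1, 0) (0, a) (0, b) := by
  simp only [dX, h.fderiv_gMat hz]
  set T := fderiv ℝ (fderiv ℝ (fderiv ℝ ℓ)) z
  have h3 : ∀ X Y, ∑ γ, b γ * T X Y (0, EuclideanSpace.single γ 1) = T X Y (0, b) := fun X Y =>
    sum_smul_single ((T X Y).toLinearMap ∘ₗ LinearMap.inr ℝ _ _) b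
  have h1 : ∀ a Y Z, ∑ γ, a γ * T (EuclideanSpace.single γ 1, 0) Y Z = T (a, 0) Y Z :=
    fun a Y Z => sum_smul_single ((ContinuousLinearMap.apply ℝ ℝ Z).toLinearMap ∘ₗ
      (ContinuousLinearMap.apply ℝ _ Y).toLinearMap ∘ₗ T.toLinearMap ∘ₗ LinearMap.inl ℝ _ _) a
  have h2 : ∀ X Z, ∑ γ, a γ * T X (0, EuclideanSpace.single γ 1) Z = T X (0, a) Z :=
    fun X Z => sum_smul_single ((ContinuousLinearMap.apply ℝ ℝ Z).toLinearMap ∘ₗ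
      (T X).toLinearMap ∘ₗ LinearMap.inr ℝ _ _) a
  rw [← h1 a, ← h2 (EuclideanSpace.single δ 1, 0), ← h2 (b, 0), ← Finset.sum_add_distrib,
    ← Finset.sum_sub_distrib]
  refine Finset.sum_congr rfl fun β _ => ?_
  rw [← h3, ← h1 b, ← h3, Finset.mul_sum, Finset.mul_sum, Finset.mul_sum,
    ← Finset.sum_add_distrib, ← Finset.sum_sub_distrib]
  exact Finset.sum_congr rfl fun γ _ => by ring

/-- The Christoffel symbols contracted with two vectors, lowered with `g`. -/
theorem hessian_christoffel {z : Coord n × Coord n} (hz : z ∈ slit D) (a b w : Coord n) :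
    fderiv ℝ (fderiv ℝ ℓ) z
      (0, WithLp.toLp 2 fun α => ∑ β, ∑ γ, christoffel ℓ α β γ z * a β * b γ) (0, w) =
    1 / 2 * (fderiv ℝ (fderiv ℝ (fderiv ℝ ℓ)) z (a, 0) (0, w) (0, b)
      + fderiv ℝ (fderiv ℝ (fderiv ℝ ℓ)) z (b, 0) (0, a) (0, w)
      - fderiv ℝ (fderiv ℝ (fderiv ℝ ℓ)) z (w, 0) (0, a) (0, b)) := by
  set T := fderiv ℝ (fderiv ℝ (fderiv ℝ ℓ)) z with hT
  let τ : Coord n →ₗ[ℝ] ℝ := (1 / 2 : ℝ) •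
    (((ContinuousLinearMap.apply ℝ ℝ ((0 : Coord n), b)).toLinearMap ∘ₗ
      (T (a, 0)).toLinearMap ∘ₗ LinearMap.inr ℝ _ _)
    + ((T (b, 0) (0, a)).toLinearMap ∘ₗ LinearMap.inr ℝ _ _)
    - ((ContinuousLinearMap.apply ℝ ℝ ((0 : Coord n), b)).toLinearMap ∘ₗ
      (ContinuousLinearMap.apply ℝ _ ((0 : Coord n), a)).toLinearMap ∘ₗ T.toLinearMap ∘ₗ
        LinearMap.inl ℝ _ _))
  have hτ : ∀ w, τ w = 1 / 2 * (T (a, 0) (0, w) (0, b) + T (b, 0) (0, a) (0, w)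
      - T (w, 0) (0, a) (0, b)) := fun w => rfl
  rw [← hτ w]
  refine h.hessian_of_gInv hz (fun α => ?_) w
  simp_rw [hτ, hT, ← h.christoffel_sum hz a b, Finset.mul_sum]
  simp only [christoffel, Finset.mul_sum, Finset.sum_mul]
  rw [Finset.sum_congr rfl fun β _ => Finset.sum_comm, Finset.sum_comm]
  exact Finset.sum_congr rfl fun δ _ => Finset.sum_congr rfl fun β _ =>
    Finset.sum_congr rfl fun γ _ => by ring

/-- The Euler–Lagrange equation for the spray. -/
theorem eulerLagrange {z : Coord n × Coord n} (hz : z ∈ slit D) (w : Coord n) :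
    fderiv ℝ (fderiv ℝ ℓ) z (z.2, -(2 : ℝ) • sprayVec ℓ z) (0, w) = fderiv ℝ ℓ z (w, 0) := by
  have h1 := h.hessian_christoffel hz z.2 z.2 w
  have h2 : (WithLp.toLp 2 fun α => ∑ β, ∑ γ, christoffel ℓ α β γ z * z.2 β * z.2 γ : Coord n) =
      (2 : ℝ) • sprayVec ℓ z := by
    ext α; simp [sprayVec, spray]
  have e1 := h.euler3 hz (z.2, 0) (0, w)
  have e2 := h.euler3 hz (w, 0) (0, z.2)
  have e3 := h.euler2 hz (w, 0)
  rw [h2, fderiv3_symm h.isOpen_slit h.smooth hz (z.2, 0) (0, z.2) (0, w)] at h1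
  have e4 : ((z.2, -(2 : ℝ) • sprayVec ℓ z) : Coord n × Coord n) =
      (z.2, 0) - (0, (2 : ℝ) • sprayVec ℓ z) := by simp
  have e5 : ((0 : Coord n), (0 : Coord n)) = 0 := rfl
  simp only [e5, map_zero, sub_zero] at e1 e2 e3
  rw [e4, map_sub, sub_apply, h1]
  linarith

/-- The Lagrangian is constant along the spray. -/
theorem spray_invariant {z : Coord n × Coord n} (hz : z ∈ slit D) :
    fderiv ℝ ℓ z (z.2, -(2 : ℝ) • sprayVec ℓ z) = 0 := by
  have h1 := h.eulerLagrange hz z.2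
  rw [h.euler2 hz] at h1
  have e1 : ((0, -(2 : ℝ) • sprayVec ℓ z) : Coord n × Coord n) =
      (z.2, -(2 : ℝ) • sprayVec ℓ z) - (z.2, 0) := by simp
  rw [e1, map_sub] at h1
  linarith

theorem differentiableAt_sprayVec {z : Coord n × Coord n} (hz : z ∈ slit D) :
    DifferentiableAt ℝ (sprayVec ℓ) z :=
  smooth_differentiableAt h.isOpen_slit h.smooth_sprayVec hz

omit h in
theorem hasFDerivAt_spray_field {z : Coord n × Coord n}
    (hd : DifferentiableAt ℝ (sprayVec ℓ) z) :
    HasFDerivAt (fun y : Coord n × Coord n => (y.2, -(2 : ℝ) • sprayVec ℓ y))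
      ((ContinuousLinearMap.snd ℝ _ _).prod (-(2 : ℝ) • fderiv ℝ (sprayVec ℓ) z)) z :=
  hasFDerivAt_snd.prodMk (hd.hasFDerivAt.const_smul (-(2 : ℝ)))

/-- The invariance of the Lagrangian along the spray, differentiated. -/
theorem spray_invariant_deriv {z : Coord n × Coord n} (hz : z ∈ slit D) (X : Coord n × Coord n) :
    fderiv ℝ (fderiv ℝ ℓ) z X (z.2, -(2 : ℝ) • sprayVec ℓ z)
      + fderiv ℝ ℓ z (X.2, -(2 : ℝ) • fderiv ℝ (sprayVec ℓ) z X) = 0 := by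
  have h1 := (smooth_differentiableAt h.isOpen_slit h.smooth1 hz).hasFDerivAt.clm_apply
    (hasFDerivAt_spray_field (h.differentiableAt_sprayVec hz))
  have h3 := h1.unique ((hasFDerivAt_const (0 : ℝ) z).congr_of_eventuallyEq
    (Filter.eventuallyEq_of_mem (h.isOpen_slit.mem_nhds hz) fun y hy => h.spray_invariant hy))
  have h4 := congrArg (fun T : Coord n × Coord n →L[ℝ] ℝ => T X) h3
  simp at h4
  simp
  linarith

/-- The Lagrangian is constant along horizontal directions. -/
theorem horizontal_invariant {z : Coord n × Coord n} (hz : z ∈ slit D) (w : Coord n) :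
    fderiv ℝ ℓ z (w, -fderiv ℝ (sprayVec ℓ) z (0, w)) = 0 := by
  have h1 := h.spray_invariant_deriv hz (0, w)
  rw [h.symm2 hz, h.eulerLagrange hz, ← map_add] at h1
  have e1 : ((w, 0) + (w, -(2 : ℝ) • fderiv ℝ (sprayVec ℓ) z (0, w)) : Coord n × Coord n) =
      (2 : ℝ) • (w, -fderiv ℝ (sprayVec ℓ) z (0, w)) := by
    rw [Prod.smul_mk, Prod.mk_add_mk, two_smul, zero_add, smul_neg, neg_smul]
  rw [e1, map_smul, smul_eq_mul] at h1
  linarith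

/-- The Euler–Lagrange equation, differentiated. -/
theorem eulerLagrange_deriv {z : Coord n × Coord n} (hz : z ∈ slit D) (w : Coord n)
    (X : Coord n × Coord n) :
    fderiv ℝ (fderiv ℝ (fderiv ℝ ℓ)) z X (z.2, -(2 : ℝ) • sprayVec ℓ z) (0, w)
      + fderiv ℝ (fderiv ℝ ℓ) z (X.2, -(2 : ℝ) • fderiv ℝ (sprayVec ℓ) z X) (0, w)
      = fderiv ℝ (fderiv ℝ ℓ) z X (w, 0) := by
  have h1 := ((smooth_differentiableAt h.isOpen_slit h.smooth2 hz).hasFDerivAt.clm_apply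
    (hasFDerivAt_spray_field (h.differentiableAt_sprayVec hz))).clm_apply
      (hasFDerivAt_const ((0 : Coord n), w) z)
  have h2 := (smooth_differentiableAt h.isOpen_slit h.smooth1 hz).hasFDerivAt.clm_apply
      (hasFDerivAt_const (w, (0 : Coord n)) z)
  have h3 := h1.unique (h2.congr_of_eventuallyEq
    (Filter.eventuallyEq_of_mem (h.isOpen_slit.mem_nhds hz) fun y hy => h.eulerLagrange hy w))
  have h4 := congrArg (fun T : Coord n × Coord n →L[ℝ] ℝ => T X) h3
  simp at h4
  simp
  linarith

end IsLocalLagrangian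

/-! ### Homogeneity of the connection and the curvature -/

/-- Positive `k`-homogeneity in the fibre of a function of the bundle coordinates over `D`. -/
def FibreHomog (D : Set (Coord n)) (k : ℕ) (f : Coord n × Coord n → ℝ) : Prop :=
  ∀ z ∈ slit D, ∀ c : ℝ, 0 < c → f (z.1, c • z.2) = c ^ k * f z

/-- The derivative of a fibre-homogeneous function, at a rescaled vector. -/
theorem FibreHomog.fderiv_smul {D : Set (Coord n)} (hD : IsOpen D) {k : ℕ}
    {f : Coord n × Coord n → ℝ} (hf : FibreHomog D k f) {z : Coord n × Coord n} (hz : z ∈ slit D)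
    {c : ℝ} (hc : 0 < c) (a b : Coord n) :
    fderiv ℝ f (z.1, c • z.2) (a, c • b) = c ^ k * fderiv ℝ f z (a, b) := by
  let σ : (Coord n × Coord n) ≃L[ℝ] (Coord n × Coord n) :=
    (ContinuousLinearEquiv.refl ℝ (Coord n)).prodCongr
      (ContinuousLinearEquiv.smulLeft (Units.mk0 c hc.ne'))
  have h1 : fderiv ℝ (f ∘ σ) z = fderiv ℝ (c ^ k • f) z :=
    fderiv_congr_of_isOpen (isOpen_slit hD) (fun y hy => hf y hy c hc) hz
  rw [σ.comp_right_fderiv, fderiv_const_smul_field] at h1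
  exact congrArg (fun T : Coord n × Coord n →L[ℝ] ℝ => T (a, b)) h1

theorem FibreHomog.dX {D : Set (Coord n)} (hD : IsOpen D) {k : ℕ} {f : Coord n × Coord n → ℝ}
    (hf : FibreHomog D k f) (α : Fin (n + 1)) : FibreHomog D k (dX f α) := fun z hz c hc => by
  have := hf.fderiv_smul hD hz hc (EuclideanSpace.single α 1) 0
  rwa [smul_zero] at this

theorem FibreHomog.dV {D : Set (Coord n)} (hD : IsOpen D) {k : ℕ} {f : Coord n × Coord n → ℝ}
    (hf : FibreHomog D (k + 1) f) (α : Fin (n + 1)) : FibreHomog D k (dV f α) :=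
  fun z hz c hc => by
  have := hf.fderiv_smul hD hz hc 0 (EuclideanSpace.single α 1)
  have e1 : ((0 : Coord n), c • (EuclideanSpace.single α 1 : Coord n)) =
    c • ((0 : Coord n), (EuclideanSpace.single α 1 : Coord n)) := by simp
  rw [e1, map_smul, smul_eq_mul, pow_succ'] at this
  refine mul_left_cancel₀ hc.ne' ?_
  rw [LorentzFinsler.dV, this, LorentzFinsler.dV, mul_assoc]

theorem FibreHomog.add {D : Set (Coord n)} {k : ℕ} {f g : Coord n × Coord n → ℝ}
    (hf : FibreHomog D k f) (hg : FibreHomog D k g) : FibreHomog D k fun z => f z + g z :=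
  fun z hz c hc => by simp only [hf z hz c hc, hg z hz c hc]; ring

theorem FibreHomog.sub {D : Set (Coord n)} {k : ℕ} {f g : Coord n × Coord n → ℝ}
    (hf : FibreHomog D k f) (hg : FibreHomog D k g) : FibreHomog D k fun z => f z - g z :=
  fun z hz c hc => by simp only [hf z hz c hc, hg z hz c hc]; ring

theorem FibreHomog.mul {D : Set (Coord n)} {k l : ℕ} {f g : Coord n × Coord n → ℝ}
    (hf : FibreHomog D k f) (hg : FibreHomog D l g) : FibreHomog D (k + l) fun z => f z * g z :=
  fun z hz c hc => by simp only [hf z hz c hc, hg z hz c hc]; ring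

theorem FibreHomog.const_mul {D : Set (Coord n)} {k : ℕ} {f : Coord n × Coord n → ℝ}
    (hf : FibreHomog D k f) (r : ℝ) : FibreHomog D k fun z => r * f z :=
  fun z hz c hc => by simp only [hf z hz c hc]; ring

theorem FibreHomog.sum {D : Set (Coord n)} {k : ℕ} {ι : Type*} {s : Finset ι}
    {f : ι → Coord n × Coord n → ℝ} (hf : ∀ i ∈ s, FibreHomog D k (f i)) :
    FibreHomog D k fun z => ∑ i ∈ s, f i z := fun z hz c hc => by
  simp only [Finset.mul_sum]
  exact Finset.sum_congr rfl fun i hi => hf i hi z hz c hc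

theorem fibreHomog_snd (D : Set (Coord n)) (β : Fin (n + 1)) : FibreHomog D 1 fun z => z.2 β :=
  fun z _ c _ => by simp

namespace IsLocalLagrangian

variable {ℓ : Coord n × Coord n → ℝ} {D : Set (Coord n)} (h : IsLocalLagrangian ℓ D)
include h

theorem fibreHomog_gMat (α β : Fin (n + 1)) : FibreHomog D 0 fun z => gMat ℓ z α β := by
  have h1 : FibreHomog D 2 ℓ := fun z hz c hc => h.homog z.1 hz.1 z.2 c hc
  exact (h1.dV h.isOpen β).dV h.isOpen α

theorem fibreHomog_gInv (α β : Fin (n + 1)) : FibreHomog D 0 fun z => (gMat ℓ z)⁻¹ α β :=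
  fun z hz c hc => by
  have : gMat ℓ (z.1, c • z.2) = gMat ℓ z := by
    ext i j; simpa using h.fibreHomog_gMat i j z hz c hc
  simp [this]

theorem fibreHomog_christoffel (α β γ : Fin (n + 1)) : FibreHomog D 0 (christoffel ℓ α β γ) :=
  (FibreHomog.sum fun δ _ => (h.fibreHomog_gInv α δ).mul
    ((((h.fibreHomog_gMat δ γ).dX h.isOpen β).add ((h.fibreHomog_gMat β δ).dX h.isOpen γ)).sub
      ((h.fibreHomog_gMat β γ).dX h.isOpen δ))).const_mul _

theorem fibreHomog_spray (α : Fin (n + 1)) : FibreHomog D 2 (spray ℓ α) :=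
  (FibreHomog.sum fun β _ => FibreHomog.sum fun γ _ =>
    ((h.fibreHomog_christoffel α β γ).mul (fibreHomog_snd D β)).mul (fibreHomog_snd D γ)).const_mul _

theorem fibreHomog_nlConn (α β : Fin (n + 1)) : FibreHomog D 1 (nlConn ℓ α β) :=
  (h.fibreHomog_spray α).dV h.isOpen β

theorem fibreHomog_curvMat (α β : Fin (n + 1)) : FibreHomog D 2 fun z => curvMat ℓ z α β :=
  ((((h.fibreHomog_spray α).dX h.isOpen β).const_mul 2).sub
    (FibreHomog.sum fun γ _ => (((h.fibreHomog_nlConn α β).dX h.isOpen γ).mul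
      (fibreHomog_snd D γ)).sub ((((h.fibreHomog_nlConn α β).dV h.isOpen γ).const_mul 2).mul
        (h.fibreHomog_spray γ)))).sub
    (FibreHomog.sum fun γ _ => (h.fibreHomog_nlConn α γ).mul (h.fibreHomog_nlConn γ β))

theorem curvMat_smul {z : Coord n × Coord n} (hz : z ∈ slit D) {c : ℝ} (hc : 0 < c) :
    curvMat ℓ (z.1, c • z.2) = c ^ 2 • curvMat ℓ z := by
  ext α β
  exact h.fibreHomog_curvMat α β z hz c hc

theorem sprayVec_smul {z : Coord n × Coord n} (hz : z ∈ slit D) {c : ℝ} (hc : 0 < c) :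
    sprayVec ℓ (z.1, c • z.2) = c ^ 2 • sprayVec ℓ z := by
  ext α
  exact h.fibreHomog_spray α z hz c hc

/-- `N(v) = 2G`. -/
theorem fderiv_sprayVec_fibre {z : Coord n × Coord n} (hz : z ∈ slit D) :
    fderiv ℝ (sprayVec ℓ) z (0, z.2) = (2 : ℝ) • sprayVec ℓ z := by
  simpa using euler_of_homog (k := 2) (fun z hz c hc => h.sprayVec_smul hz hc) hz
    (h.differentiableAt_sprayVec hz)

theorem smooth_fderiv_sprayVec : ContDiffOn ℝ ∞ (fderiv ℝ (sprayVec ℓ)) (slit D) :=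
  smooth_fderiv h.isOpen_slit h.smooth_sprayVec

/-- Euler's relation for the spray, differentiated. -/
theorem fderiv_sprayVec_fibre_deriv {z : Coord n × Coord n} (hz : z ∈ slit D)
    (X : Coord n × Coord n) :
    fderiv ℝ (fderiv ℝ (sprayVec ℓ)) z X (0, z.2) + fderiv ℝ (sprayVec ℓ) z (0, X.2) =
      (2 : ℝ) • fderiv ℝ (sprayVec ℓ) z X := by
  have h1 := (smooth_differentiableAt h.isOpen_slit h.smooth_fderiv_sprayVec hz).hasFDerivAt.clm_apply
    (hasFDerivAt_zero_snd z)
  have h2 := (h.differentiableAt_sprayVec hz).hasFDerivAt.const_smul (2 : ℝ)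
  have h3 := h1.unique (h2.congr_of_eventuallyEq
    (Filter.eventuallyEq_of_mem (h.isOpen_slit.mem_nhds hz) fun y hy => h.fderiv_sprayVec_fibre hy))
  have h4 := congrArg (fun T : Coord n × Coord n →L[ℝ] Coord n => T X) h3
  simp at h4
  rw [← h4, add_comm]

/-! ### The Chern connection and the curvature endomorphism in terms of the spray -/

/-- The correction term of the Chern connection, contracted with the direction in one slot. By
homogeneity only one of the three fibre derivatives of `g` survives. -/
theorem chern_correction_sum {z : Coord n × Coord n} (hz : z ∈ slit D) (Y : Coord n)
    (δ : Fin (n + 1)) :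
    ∑ β, ∑ γ, (∑ μ, (dV (fun u => gMat ℓ u δ γ) μ z * nlConn ℓ μ β z
      + dV (fun u => gMat ℓ u β δ) μ z * nlConn ℓ μ γ z
      - dV (fun u => gMat ℓ u β γ) μ z * nlConn ℓ μ δ z)) * z.2 β * Y γ =
    fderiv ℝ (fderiv ℝ (fderiv ℝ ℓ)) z (0, (2 : ℝ) • sprayVec ℓ z)
      (0, EuclideanSpace.single δ 1) (0, Y) := by
  simp only [dV, h.fderiv_gMat hz, h.nlConn_eq hz]
  have hN2 := h.fderiv_sprayVec_fibre hz
  have hv2 : ∀ a b : Coord n, fderiv ℝ (fderiv ℝ (fderiv ℝ ℓ)) z (0, a) (0, z.2) (0, b) = 0 :=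
    fun a b => by
    rw [fderiv3_symm h.isOpen_slit h.smooth hz]
    have := h.euler3 hz (0, a) (0, b)
    have h2 := h.symm2 hz (0, b) (0, a)
    simp only at this
    linarith
  generalize fderiv ℝ (sprayVec ℓ) z = N at *
  generalize fderiv ℝ (fderiv ℝ (fderiv ℝ ℓ)) z = T at *
  have k1 : ∀ b Y Z, ∑ μ, b μ * T (0, EuclideanSpace.single μ 1) Y Z = T (0, b) Y Z :=
    fun b Y Z => sum_smul_single ((ContinuousLinearMap.apply ℝ ℝ Z).toLinearMap ∘ₗ
      (ContinuousLinearMap.apply ℝ _ Y).toLinearMap ∘ₗ T.toLinearMap ∘ₗ LinearMap.inr ℝ _ _) b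
  have k2 : ∀ b Y Z, ∑ μ, b μ * T (0, N (0, EuclideanSpace.single μ 1)) Y Z = T (0, N (0, b)) Y Z :=
    fun b Y Z => sum_smul_single ((ContinuousLinearMap.apply ℝ ℝ Z).toLinearMap ∘ₗ
      (ContinuousLinearMap.apply ℝ _ Y).toLinearMap ∘ₗ T.toLinearMap ∘ₗ LinearMap.inr ℝ _ _ ∘ₗ
        N.toLinearMap ∘ₗ LinearMap.inr ℝ _ _) b
  have k3 : ∀ b X Z, ∑ μ, b μ * T X (0, EuclideanSpace.single μ 1) Z = T X (0, b) Z :=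
    fun b X Z => sum_smul_single ((ContinuousLinearMap.apply ℝ ℝ Z).toLinearMap ∘ₗ
      (T X).toLinearMap ∘ₗ LinearMap.inr ℝ _ _) b
  have k4 : ∀ b X Z, ∑ μ, b μ * T X Z (0, EuclideanSpace.single μ 1) = T X Z (0, b) :=
    fun b X Z => sum_smul_single ((T X Z).toLinearMap ∘ₗ LinearMap.inr ℝ _ _) b
  have hb : T (0, (2 : ℝ) • sprayVec ℓ z) (0, EuclideanSpace.single δ 1) (0, Y) =
      T (0, N (0, z.2)) (0, EuclideanSpace.single δ 1) (0, Y)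
      + T (0, N (0, Y)) (0, z.2) (0, EuclideanSpace.single δ 1)
      - T (0, N (0, EuclideanSpace.single δ 1)) (0, z.2) (0, Y) := by
    rw [hv2, hv2, hN2, add_zero, sub_zero]
  rw [hb, ← k2 z.2, ← k3 z.2 (0, N (0, Y)), ← k3 z.2 (0, N (0, EuclideanSpace.single δ 1)),
    ← Finset.sum_add_distrib, ← Finset.sum_sub_distrib]
  refine Finset.sum_congr rfl fun β _ => ?_
  rw [← k4 Y, ← k2 Y, ← k4 Y (0, N (0, EuclideanSpace.single δ 1)), Finset.mul_sum, Finset.mul_sum,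
    Finset.mul_sum, ← Finset.sum_add_distrib, ← Finset.sum_sub_distrib]
  refine Finset.sum_congr rfl fun γ _ => ?_
  rw [Finset.sum_sub_distrib, Finset.sum_add_distrib, ← k1 (N (0, EuclideanSpace.single β 1)),
    ← k1 (N (0, EuclideanSpace.single γ 1)), ← k1 (N (0, EuclideanSpace.single δ 1))]
  simp only [mul_comm (T _ _ _)]
  ring

/-- Along its own direction, the Chern connection reduces to the nonlinear connection. Both sides
are compared after lowering the index with `g`; the identity then is the fibre derivative of the
Euler–Lagrange equation, up to the homogeneity of `ℓ`. -/
theorem chern_sum {z : Coord n × Coord n} (hz : z ∈ slit D) (Y : Coord n) (α : Fin (n + 1)) :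
    ∑ β, ∑ γ, chern ℓ α β γ z * z.2 β * Y γ = fderiv ℝ (sprayVec ℓ) z (0, Y) α := by
  -- `c` is the contribution of the Christoffel symbols, `d` that of the correction term.
  let c : Coord n := WithLp.toLp 2 fun α => ∑ β, ∑ γ, christoffel ℓ α β γ z * z.2 β * Y γ
  let d : Coord n := WithLp.toLp 2 fun α => ∑ δ, (gMat ℓ z)⁻¹ α δ *
    (1 / 2 * fderiv ℝ (fderiv ℝ (fderiv ℝ ℓ)) z (0, (2 : ℝ) • sprayVec ℓ z)
      (0, EuclideanSpace.single δ 1) (0, Y))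
  have e0 : ((0 : Coord n), (0 : Coord n)) = 0 := rfl
  have hu : (WithLp.toLp 2 fun α => ∑ β, ∑ γ, chern ℓ α β γ z * z.2 β * Y γ : Coord n) = c - d := by
    ext α
    simp only [PiLp.sub_apply, c, d, ← h.chern_correction_sum hz, chern]
    generalize hQ : (fun δ μ β γ => (dV (fun u => gMat ℓ u δ γ) μ z * nlConn ℓ μ β z
      + dV (fun u => gMat ℓ u β δ) μ z * nlConn ℓ μ γ z
      - dV (fun u => gMat ℓ u β γ) μ z * nlConn ℓ μ δ z)) = Q
    have hQ' : ∀ δ μ β γ, (dV (fun u => gMat ℓ u δ γ) μ z * nlConn ℓ μ β z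
      + dV (fun u => gMat ℓ u β δ) μ z * nlConn ℓ μ γ z
      - dV (fun u => gMat ℓ u β γ) μ z * nlConn ℓ μ δ z) = Q δ μ β γ := fun δ μ β γ => by rw [← hQ]
    simp_rw [hQ', sub_mul, Finset.sum_sub_distrib]
    congr 1
    simp only [Finset.mul_sum, Finset.sum_mul]
    rw [Finset.sum_congr rfl fun β _ => Finset.sum_comm, Finset.sum_comm]
    exact Finset.sum_congr rfl fun δ _ => Finset.sum_congr rfl fun β _ =>
      Finset.sum_congr rfl fun γ _ => Finset.sum_congr rfl fun μ _ => by ring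
  have hd : ∀ w, fderiv ℝ (fderiv ℝ ℓ) z (0, d) (0, w) =
      1 / 2 * fderiv ℝ (fderiv ℝ (fderiv ℝ ℓ)) z (0, (2 : ℝ) • sprayVec ℓ z) (0, w) (0, Y) :=
    fun w => h.hessian_of_gInv hz (u := d) (τ := (1 / 2 : ℝ) •
      ((ContinuousLinearMap.apply ℝ ℝ ((0 : Coord n), Y)).toLinearMap ∘ₗ
      (fderiv ℝ (fderiv ℝ (fderiv ℝ ℓ)) z (0, (2 : ℝ) • sprayVec ℓ z)).toLinearMap ∘ₗ
        LinearMap.inr ℝ _ _)) (fun α => rfl) w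
  have key : c - d = fderiv ℝ (sprayVec ℓ) z (0, Y) := by
    refine sub_eq_zero.1 (h.nondeg z hz _ fun w => ?_)
    have e1 : ((0, c - d - fderiv ℝ (sprayVec ℓ) z (0, Y)) : Coord n × Coord n) =
      (0, c) - (0, d) - (0, fderiv ℝ (sprayVec ℓ) z (0, Y)) := by simp
    have h1 := h.hessian_christoffel hz z.2 Y w
    have h2 := h.eulerLagrange_deriv hz w (0, Y)
    have h3 := h.euler3 hz (Y, 0) (0, w)
    have h4 := h.euler3 hz (w, 0) (0, Y)
    have e2 : ((Y, -(2 : ℝ) • fderiv ℝ (sprayVec ℓ) z (0, Y)) : Coord n × Coord n) =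
      (Y, 0) - (2 : ℝ) • (0, fderiv ℝ (sprayVec ℓ) z (0, Y)) := by simp
    have e3 : ((z.2, -(2 : ℝ) • sprayVec ℓ z) : Coord n × Coord n) =
      (z.2, 0) - (0, (2 : ℝ) • sprayVec ℓ z) := by simp
    have h5 := h.symm2 hz (0, Y) (w, 0)
    have h6 := fderiv_fderiv_symm h.isOpen_slit h.smooth1 hz (0, Y)
      (z.2, -(2 : ℝ) • sprayVec ℓ z)
    have h7 := fderiv3_symm h.isOpen_slit h.smooth hz (z.2, -(2 : ℝ) • sprayVec ℓ z) (0, Y) (0, w)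
    have s2 := fderiv3_symm h.isOpen_slit h.smooth hz (Y, 0) (0, z.2) (0, w)
    have s3 := fderiv3_symm h.isOpen_slit h.smooth hz (w, 0) (0, z.2) (0, Y)
    have hd' := hd w
    simp only [e0, map_zero, sub_zero] at h2 h3 h4
    rw [e1, map_sub, map_sub, sub_apply, sub_apply, hd', h1]
    rw [h6, h7, e2, e3, map_sub, map_sub, map_smul, sub_apply, sub_apply, sub_apply, smul_apply,
      smul_eq_mul] at h2
    linarith
  rw [← key, ← hu]

theorem fderiv_nlConn {z : Coord n × Coord n} (hz : z ∈ slit D) (α β : Fin (n + 1))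
    (X : Coord n × Coord n) :
    fderiv ℝ (nlConn ℓ α β) z X =
      fderiv ℝ (fderiv ℝ (sprayVec ℓ)) z X (0, EuclideanSpace.single β 1) α := by
  rw [fderiv_congr_of_isOpen h.isOpen_slit (fun y hy => h.nlConn_eq hy α β) hz,
    ← fderiv_fderiv_apply h.isOpen_slit h.smooth_sprayVec hz]
  have h1 := (EuclideanSpace.proj (𝕜 := ℝ) α).hasFDerivAt.comp z
    (smooth_differentiableAt h.isOpen_slit (smooth_fderiv_apply h.isOpen_slit h.smooth_sprayVec
      ((0 : Coord n), EuclideanSpace.single β 1)) hz).hasFDerivAt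
  exact congrArg (fun T : Coord n × Coord n →L[ℝ] ℝ => T X) h1.fderiv

theorem fderiv_spray {z : Coord n × Coord n} (hz : z ∈ slit D) (α : Fin (n + 1))
    (X : Coord n × Coord n) :
    fderiv ℝ (spray ℓ α) z X = fderiv ℝ (sprayVec ℓ) z X α := by
  have h1 := (EuclideanSpace.proj (𝕜 := ℝ) α).hasFDerivAt.comp z
    (h.differentiableAt_sprayVec hz).hasFDerivAt
  exact congrArg (fun T : Coord n × Coord n →L[ℝ] ℝ => T X) h1.fderiv

/-- The curvature endomorphism in terms of the derivatives of the spray. -/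
theorem curvMat_apply {z : Coord n × Coord n} (hz : z ∈ slit D) (w : Coord n) :
    Matrix.toEuclideanLin (curvMat ℓ z) w = (2 : ℝ) • fderiv ℝ (sprayVec ℓ) z (w, 0)
      - fderiv ℝ (fderiv ℝ (sprayVec ℓ)) z (z.2, -(2 : ℝ) • sprayVec ℓ z) (0, w)
      - fderiv ℝ (sprayVec ℓ) z (0, fderiv ℝ (sprayVec ℓ) z (0, w)) := by
  set N := fderiv ℝ (sprayVec ℓ) z with hN
  set T := fderiv ℝ (fderiv ℝ (sprayVec ℓ)) z with hT
  let P : Fin (n + 1) → Coord n →ₗ[ℝ] ℝ := fun α => (EuclideanSpace.proj (𝕜 := ℝ) α).toLinearMap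
  let R : Coord n →ₗ[ℝ] Coord n := (2 : ℝ) • (N.toLinearMap ∘ₗ LinearMap.inl ℝ _ _)
    - (T (z.2, -(2 : ℝ) • sprayVec ℓ z)).toLinearMap ∘ₗ LinearMap.inr ℝ _ _
    - N.toLinearMap ∘ₗ LinearMap.inr ℝ _ _ ∘ₗ N.toLinearMap ∘ₗ LinearMap.inr ℝ _ _
  have hR : ∀ α β, curvMat ℓ z α β = R (EuclideanSpace.single β 1) α := by
    intro α β
    have k1 : ∑ γ, nlConn ℓ α γ z * nlConn ℓ γ β z =
        N (0, N (0, EuclideanSpace.single β 1)) α := by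
      rw [show N (0, N (0, EuclideanSpace.single β 1)) α =
        (P α ∘ₗ N.toLinearMap ∘ₗ LinearMap.inr ℝ _ _) (N (0, EuclideanSpace.single β 1)) from rfl,
        ← sum_smul_single]
      refine Finset.sum_congr rfl fun γ _ => ?_
      rw [h.nlConn_eq hz, h.nlConn_eq hz, mul_comm]; rfl
    have k2 : ∀ a b : Coord n, T (a, -(2 : ℝ) • b) (0, EuclideanSpace.single β 1) α =
        ∑ γ, (T (EuclideanSpace.single γ 1, 0) (0, EuclideanSpace.single β 1) α * a γ
          - 2 * T (0, EuclideanSpace.single γ 1) (0, EuclideanSpace.single β 1) α * b γ) := by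
      intro a b
      have e1 : ((a, -(2 : ℝ) • b) : Coord n × Coord n) = (a, 0) - (2 : ℝ) • (0, b) := by simp
      let A : Coord n × Coord n →ₗ[ℝ] ℝ := P α ∘ₗ (ContinuousLinearMap.apply ℝ (Coord n)
        ((0 : Coord n), (EuclideanSpace.single β 1 : Coord n))).toLinearMap ∘ₗ T.toLinearMap
      change A (a, -(2 : ℝ) • b) = ∑ γ, (A (EuclideanSpace.single γ 1, 0) * a γ
          - 2 * A (0, EuclideanSpace.single γ 1) * b γ)
      rw [e1, map_sub, map_smul, show A (a, 0) = (A ∘ₗ LinearMap.inl ℝ _ _) a from rfl,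
        show A (0, b) = (A ∘ₗ LinearMap.inr ℝ _ _) b from rfl, ← sum_smul_single _ a,
        ← sum_smul_single _ b, Finset.smul_sum, ← Finset.sum_sub_distrib]
      refine Finset.sum_congr rfl fun γ _ => ?_
      simp only [LinearMap.comp_apply, LinearMap.inl_apply, LinearMap.inr_apply, smul_eq_mul]
      ring
    change 2 * dX (spray ℓ α) β z
      - ∑ γ, (dX (nlConn ℓ α β) γ z * z.2 γ - 2 * dV (nlConn ℓ α β) γ z * spray ℓ γ z)
      - ∑ γ, nlConn ℓ α γ z * nlConn ℓ γ β z = 2 * N (EuclideanSpace.single β 1, 0) α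
      - T (z.2, -(2 : ℝ) • sprayVec ℓ z) (0, EuclideanSpace.single β 1) α
      - N (0, N (0, EuclideanSpace.single β 1)) α
    rw [k1, k2]
    simp only [dX, dV, h.fderiv_nlConn hz, h.fderiv_spray hz]
    rfl
  change _ = R w
  ext α
  rw [Matrix.toLpLin_apply]
  change ∑ β, curvMat ℓ z α β * w β = (P α ∘ₗ R) w
  rw [← sum_smul_single]
  exact Finset.sum_congr rfl fun β _ => by rw [hR, mul_comm]; rfl

/-- `R_v v = 0`, from the homogeneity of the spray. -/
theorem curvMat_apply_self {z : Coord n × Coord n} (hz : z ∈ slit D) :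
    Matrix.toEuclideanLin (curvMat ℓ z) z.2 = 0 := by
  have h1 := h.fderiv_sprayVec_fibre_deriv hz (z.2, -(2 : ℝ) • sprayVec ℓ z)
  have e1 : ((z.2, -(2 : ℝ) • sprayVec ℓ z) : Coord n × Coord n) =
      (z.2, 0) + -(2 : ℝ) • (0, sprayVec ℓ z) := by simp
  have e2 : ((0, -(2 : ℝ) • sprayVec ℓ z) : Coord n × Coord n) =
      -(2 : ℝ) • (0, sprayVec ℓ z) := by simp
  have e3 : ((0, (2 : ℝ) • sprayVec ℓ z) : Coord n × Coord n) =
      (2 : ℝ) • (0, sprayVec ℓ z) := by simp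
  rw [h.curvMat_apply hz, h.fderiv_sprayVec_fibre hz, eq_sub_of_add_eq h1]
  simp only
  rw [e2, e1, e3]
  simp only [map_add, map_smul]
  module

/-- The curvature endomorphism takes values in the kernel of `∂ℓ/∂v`. The Lagrangian is constant
along horizontal fields and along the spray, hence also along their brackets, and the vertical part
of the bracket of the spray with a horizontal field is given by the curvature. -/
theorem fderiv_curvMat_apply {z : Coord n × Coord n} (hz : z ∈ slit D) (w : Coord n) :
    fderiv ℝ ℓ z (0, Matrix.toEuclideanLin (curvMat ℓ z) w) = 0 := by
  set G := sprayVec ℓ with hG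
  have h1 := (smooth_differentiableAt h.isOpen_slit h.smooth1 hz).hasFDerivAt.clm_apply
    ((hasFDerivAt_const w z).prodMk
      ((smooth_differentiableAt h.isOpen_slit h.smooth_fderiv_sprayVec hz).hasFDerivAt.clm_apply
        (hasFDerivAt_const ((0 : Coord n), w) z)).neg)
  have h3 := h1.unique ((hasFDerivAt_const (0 : ℝ) z).congr_of_eventuallyEq
    (Filter.eventuallyEq_of_mem (h.isOpen_slit.mem_nhds hz) fun y hy => h.horizontal_invariant hy w))
  have h4 := congrArg (fun T : Coord n × Coord n →L[ℝ] ℝ => T (z.2, -(2 : ℝ) • G z)) h3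
  have h5 := h.spray_invariant_deriv hz (w, -fderiv ℝ G z (0, w))
  have h6 := h.horizontal_invariant hz (fderiv ℝ G z (0, w))
  rw [h.symm2 hz] at h5
  simp only [add_apply, ContinuousLinearMap.coe_comp, Function.comp_apply,
    ContinuousLinearMap.prod_apply, zero_apply, ContinuousLinearMap.flip_apply,
    neg_apply] at h4
  have e1 : ((0, (2 : ℝ) • fderiv ℝ G z (w, 0)
      - fderiv ℝ (fderiv ℝ G) z (z.2, -(2 : ℝ) • G z) (0, w)
      - fderiv ℝ G z (0, fderiv ℝ G z (0, w))) : Coord n × Coord n) =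
      (0, - fderiv ℝ (fderiv ℝ G) z (z.2, -(2 : ℝ) • G z) (0, w))
      - (-fderiv ℝ G z (0, w), -(2 : ℝ) • fderiv ℝ G z (w, -fderiv ℝ G z (0, w)))
      - (fderiv ℝ G z (0, w), -fderiv ℝ G z (0, fderiv ℝ G z (0, w))) := by
    have e2 : ((w, -fderiv ℝ G z (0, w)) : Coord n × Coord n) =
      (w, 0) - (0, fderiv ℝ G z (0, w)) := by simp
    rw [e2, map_sub]
    ext1
    · simp
    · simp only [Prod.snd_sub]; module
  have h7 : fderiv ℝ (fderiv ℝ ℓ) z (z.2, -(2 : ℝ) • G z) (w, -fderiv ℝ G z (0, w))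
      + fderiv ℝ ℓ z (0, -fderiv ℝ (fderiv ℝ G) z (z.2, -(2 : ℝ) • G z) (0, w)) = 0 := by
    rw [← h4, add_comm]
    simp [hG]
  rw [h.curvMat_apply hz, e1, map_sub, map_sub, h6]
  linarith

end IsLocalLagrangian

/-! ### Change of coordinates -/

/-- The change of bundle coordinates induced by a change `φ` of coordinates on the base. -/
def tangentLift (φ : Coord n → Coord n) (z : Coord n × Coord n) : Coord n × Coord n :=
  (φ z.1, fderiv ℝ φ z.1 z.2)

section ChangeOfCoordinates

variable {ℓ₀ ℓ₁ : Coord n × Coord n → ℝ} {D₀ D₁ : Set (Coord n)} {φ : Coord n → Coord n}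
  (h₀ : IsLocalLagrangian ℓ₀ D₀) (h₁ : IsLocalLagrangian ℓ₁ D₁)
  (hφ : ContDiffOn ℝ ∞ φ D₀) (hm : ∀ x ∈ D₀, φ x ∈ D₁)
  (hb : ∀ x ∈ D₀, Function.Bijective (fderiv ℝ φ x))
  (hℓ : ∀ z ∈ slit D₀, ℓ₀ z = ℓ₁ (tangentLift φ z))

include hφ in
theorem hasFDerivAt_tangentLift (hD : IsOpen D₀) {z : Coord n × Coord n} (hz : z.1 ∈ D₀) :
    HasFDerivAt (tangentLift φ) (fderiv ℝ (tangentLift φ) z) z :=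
  (((smooth_differentiableAt hD hφ hz).comp z differentiableAt_fst).prodMk
    (((smooth_differentiableAt hD (smooth_fderiv hD hφ) hz).comp z
      differentiableAt_fst).clm_apply differentiableAt_snd)).hasFDerivAt

include hφ in
theorem fderiv_tangentLift_apply (hD : IsOpen D₀) {z : Coord n × Coord n} (hz : z.1 ∈ D₀)
    (X : Coord n × Coord n) :
    fderiv ℝ (tangentLift φ) z X = (fderiv ℝ φ z.1 X.1,
      fderiv ℝ φ z.1 X.2 + fderiv ℝ (fderiv ℝ φ) z.1 X.1 z.2) := by
  have h1 := (smooth_differentiableAt hD hφ hz).hasFDerivAt.comp z (hasFDerivAt_fst (𝕜 := ℝ))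
  have h2 := ((smooth_differentiableAt hD (smooth_fderiv hD hφ) hz).hasFDerivAt.comp z
    (hasFDerivAt_fst (𝕜 := ℝ))).clm_apply (hasFDerivAt_snd (𝕜 := ℝ) (p := z))
  exact congrArg (fun T : Coord n × Coord n →L[ℝ] Coord n × Coord n => T X) (h1.prodMk h2).fderiv

include hm hb in
theorem tangentLift_mem_slit {z : Coord n × Coord n} (hz : z ∈ slit D₀) :
    tangentLift φ z ∈ slit D₁ :=
  ⟨hm _ hz.1, fun h => hz.2 ((hb z.1 hz.1).1 (by rw [map_zero]; exact h))⟩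

include hφ hm hb hℓ in
theorem fderiv_changeOfCoordinates (hD₀ : IsOpen D₀) (hD₁ : IsOpen D₁)
    (hs₁ : ContDiffOn ℝ ∞ ℓ₁ (slit D₁)) {z : Coord n × Coord n} (hz : z ∈ slit D₀)
    (X : Coord n × Coord n) :
    fderiv ℝ ℓ₀ z X = fderiv ℝ ℓ₁ (tangentLift φ z) (fderiv ℝ φ z.1 X.1,
      fderiv ℝ φ z.1 X.2 + fderiv ℝ (fderiv ℝ φ) z.1 X.1 z.2) := by
  rw [← fderiv_tangentLift_apply hφ hD₀ hz.1, fderiv_congr_of_isOpen (isOpen_slit hD₀) hℓ hz]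
  have h2 := (smooth_differentiableAt (isOpen_slit hD₁) hs₁
    (tangentLift_mem_slit hm hb hz)).hasFDerivAt.comp z (hasFDerivAt_tangentLift hφ hD₀ hz.1)
  exact congrArg (fun T : Coord n × Coord n →L[ℝ] ℝ => T X) h2.fderiv

include hφ hm hb hℓ in
/-- Transformation law of the fibre Hessian in mixed directions. -/
theorem hessian_changeOfCoordinates (hD₀ : IsOpen D₀) (hD₁ : IsOpen D₁)
    (hs₀ : ContDiffOn ℝ ∞ ℓ₀ (slit D₀)) (hs₁ : ContDiffOn ℝ ∞ ℓ₁ (slit D₁))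
    {z : Coord n × Coord n} (hz : z ∈ slit D₀) (X : Coord n × Coord n) (w : Coord n) :
    fderiv ℝ (fderiv ℝ ℓ₀) z X (0, w) =
      fderiv ℝ (fderiv ℝ ℓ₁) (tangentLift φ z) (fderiv ℝ (tangentLift φ) z X)
        (0, fderiv ℝ φ z.1 w)
      + fderiv ℝ ℓ₁ (tangentLift φ z) (0, fderiv ℝ (fderiv ℝ φ) z.1 X.1 w) := by
  have o₀ := isOpen_slit hD₀
  have o₁ := isOpen_slit hD₁
  have hd1 := (smooth_differentiableAt o₁ (smooth_fderiv o₁ hs₁)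
    (tangentLift_mem_slit hm hb hz)).hasFDerivAt.comp z (hasFDerivAt_tangentLift hφ hD₀ hz.1)
  have hd2 := ((smooth_differentiableAt hD₀ (smooth_fderiv hD₀ hφ) hz.1).hasFDerivAt.comp
    z hasFDerivAt_fst).clm_apply (hasFDerivAt_const w z)
  have hd3 := hd1.clm_apply ((hasFDerivAt_const (0 : Coord n) z).prodMk hd2)
  have hd4 := (smooth_differentiableAt o₀ (smooth_fderiv o₀ hs₀) hz).hasFDerivAt.clm_apply
    (hasFDerivAt_const ((0 : Coord n), w) z)
  have hd5 := hd4.unique (hd3.congr_of_eventuallyEq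
    (Filter.eventuallyEq_of_mem (o₀.mem_nhds hz) fun y hy => by
      simpa using fderiv_changeOfCoordinates hφ hm hb hℓ hD₀ hD₁ hs₁ hy (0, w)))
  have hd6 := congrArg (fun T : Coord n × Coord n →L[ℝ] ℝ => T X) hd5
  simp at hd6
  rw [hd6, add_comm]

include h₀ h₁ hφ hm hb hℓ

/-- Transformation law of the spray, from the invariance of the Euler–Lagrange equation. -/
theorem sprayVec_changeOfCoordinates {z : Coord n × Coord n} (hz : z ∈ slit D₀) :
    (2 : ℝ) • sprayVec ℓ₁ (tangentLift φ z) =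
      (2 : ℝ) • fderiv ℝ φ z.1 (sprayVec ℓ₀ z) - fderiv ℝ (fderiv ℝ φ) z.1 z.2 z.2 := by
  have hz1 := tangentLift_mem_slit hm hb hz
  have e0 : ((0 : Coord n), (0 : Coord n)) = 0 := rfl
  refine sub_eq_zero.1 (h₁.nondeg _ hz1 _ fun w' => ?_)
  obtain ⟨w, rfl⟩ := (hb z.1 hz.1).2 w'
  have hd7 := hessian_changeOfCoordinates hφ hm hb hℓ h₀.isOpen h₁.isOpen h₀.smooth h₁.smooth hz
    (z.2, -(2 : ℝ) • sprayVec ℓ₀ z) w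
  rw [h₀.eulerLagrange hz,
    fderiv_changeOfCoordinates hφ hm hb hℓ h₀.isOpen h₁.isOpen h₁.smooth hz,
    fderiv_tangentLift_apply hφ h₀.isOpen hz.1] at hd7
  simp only [map_zero, zero_add] at hd7
  have e1 : ((fderiv ℝ φ z.1 w, fderiv ℝ (fderiv ℝ φ) z.1 w z.2) : Coord n × Coord n) =
    (fderiv ℝ φ z.1 w, 0) + (0, fderiv ℝ (fderiv ℝ φ) z.1 w z.2) := by simp
  rw [e1, map_add, fderiv_fderiv_symm h₀.isOpen hφ hz.1, ← h₁.eulerLagrange hz1] at hd7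
  have e2 : ((0, (2 : ℝ) • sprayVec ℓ₁ (tangentLift φ z) - ((2 : ℝ) • fderiv ℝ φ z.1 (sprayVec ℓ₀ z)
      - fderiv ℝ (fderiv ℝ φ) z.1 z.2 z.2)) : Coord n × Coord n) =
      (fderiv ℝ φ z.1 z.2, fderiv ℝ φ z.1 (-(2 : ℝ) • sprayVec ℓ₀ z) +
        fderiv ℝ (fderiv ℝ φ) z.1 z.2 z.2)
      - ((tangentLift φ z).2, -(2 : ℝ) • sprayVec ℓ₁ (tangentLift φ z)) := by
    ext1
    · simp [tangentLift]
    · simp only [Prod.snd_sub, map_smul]; module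
  rw [e2, map_sub, sub_apply]
  linarith

/-- Transformation law of the nonlinear connection. -/
theorem fderiv_sprayVec_changeOfCoordinates {z : Coord n × Coord n} (hz : z ∈ slit D₀)
    (w : Coord n) :
    fderiv ℝ (sprayVec ℓ₁) (tangentLift φ z) (0, fderiv ℝ φ z.1 w) =
      fderiv ℝ φ z.1 (fderiv ℝ (sprayVec ℓ₀) z (0, w)) - fderiv ℝ (fderiv ℝ φ) z.1 z.2 w := by
  have hz1 := tangentLift_mem_slit hm hb hz
  have i1 : HasFDerivAt (fun v : Coord n => (z.1, v)) (ContinuousLinearMap.inr ℝ _ _) z.2 :=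
    (hasFDerivAt_const z.1 z.2).prodMk (hasFDerivAt_id z.2)
  have a1 := (((h₁.differentiableAt_sprayVec hz1).hasFDerivAt.comp z
    (hasFDerivAt_tangentLift hφ h₀.isOpen hz.1)).comp z.2 i1).const_smul (2 : ℝ)
  have a2 := (((fderiv ℝ φ z.1).hasFDerivAt.comp z
    (h₀.differentiableAt_sprayVec hz).hasFDerivAt).comp z.2 i1).const_smul (2 : ℝ)
  have a3 := (fderiv ℝ (fderiv ℝ φ) z.1).hasFDerivAt (x := z.2) |>.clm_apply (hasFDerivAt_id z.2)
  have hopen : ({0}ᶜ : Set (Coord n)) ∈ nhds z.2 := isOpen_compl_singleton.mem_nhds hz.2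
  have a4 := a1.unique ((a2.sub a3).congr_of_eventuallyEq (Filter.eventuallyEq_of_mem hopen
    fun v hv => sprayVec_changeOfCoordinates h₀ h₁ hφ hm hb hℓ (z := (z.1, v)) ⟨hz.1, hv⟩))
  have a5 := congrArg (fun T : Coord n →L[ℝ] Coord n => T w) a4
  have e : fderiv ℝ (tangentLift φ) z (0, w) = (0, fderiv ℝ φ z.1 w) := by
    rw [fderiv_tangentLift_apply hφ h₀.isOpen hz.1]; simp
  simp [e] at a5
  rw [fderiv_fderiv_symm h₀.isOpen hφ hz.1 w z.2] at a5
  have a6 : (2 : ℝ) • fderiv ℝ (sprayVec ℓ₁) (tangentLift φ z) (0, fderiv ℝ φ z.1 w) =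
    (2 : ℝ) • (fderiv ℝ φ z.1 (fderiv ℝ (sprayVec ℓ₀) z (0, w))
      - fderiv ℝ (fderiv ℝ φ) z.1 z.2 w) := by
    rw [a5]; module
  exact smul_right_injective _ (two_ne_zero) a6

end ChangeOfCoordinates

end LocalLagrangian

/-! ### Bundle charts -/

section Charts

variable {n : ℕ} {M : Type*} [TopologicalSpace M] [ChartedSpace (Coord n) M]
  [IsManifold 𝓘(ℝ, Coord n) ∞ M]

/-- The linear map expressing a tangent vector at `x` (identified with a vector of the model space
through the chart at `x`) in the chart around `x₀`. -/
def coordMap (x₀ x : M) : TangentSpace 𝓘(ℝ, Coord n) x →L[ℝ] Coord n :=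
  tangentCoordChange 𝓘(ℝ, Coord n) x x₀ x

/-- The inverse of `coordMap x₀ x`, for `x` in the domain of the chart around `x₀`. -/
def coordInv (x₀ x : M) : Coord n →L[ℝ] TangentSpace 𝓘(ℝ, Coord n) x :=
  tangentCoordChange 𝓘(ℝ, Coord n) x₀ x x

/-- The transition map from the chart around `x₀` to the chart around `x₁`. -/
def transition (x₀ x₁ : M) : Coord n → Coord n :=
  extChartAt 𝓘(ℝ, Coord n) x₁ ∘ (extChartAt 𝓘(ℝ, Coord n) x₀).symm

/-- The domain of `transition x₀ x₁`. -/
def overlap (x₀ x₁ : M) : Set (Coord n) :=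
  (extChartAt 𝓘(ℝ, Coord n) x₀).target ∩
    (extChartAt 𝓘(ℝ, Coord n) x₀).symm ⁻¹' (chartAt (Coord n) x₁).source

theorem tchart_apply (x₀ : M) (p : TB n M) : tchart x₀ p =
    (extChartAt 𝓘(ℝ, Coord n) x₀ p.1, coordMap x₀ p.1 p.2) := rfl

theorem tchart_symm_apply (x₀ : M) (z : Coord n × Coord n) : ((tchart x₀).symm z : TB n M) =
    ⟨(extChartAt 𝓘(ℝ, Coord n) x₀).symm z.1, coordInv x₀ _ z.2⟩ := rfl

theorem mem_tchart_source {x₀ : M} {p : TB n M} :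
    p ∈ (tchart x₀).source ↔ p.1 ∈ (chartAt (Coord n) x₀).source := by
  simp [tchart]

theorem mem_tchart_target {x₀ : M} {z : Coord n × Coord n} :
    z ∈ (tchart (n := n) x₀).target ↔ z.1 ∈ (extChartAt 𝓘(ℝ, Coord n) x₀).target := by
  have h1 : z ∈ (tchart (n := n) x₀).target ↔
      z ∈ (chartAt (ModelProd (Coord n) (Coord n)) (⟨x₀, 0⟩ : TB n M)).target := by
    simp only [tchart, extChartAt, OpenPartialHomeomorph.extend, PartialEquiv.trans_target,
      Set.mem_inter_iff, Set.mem_preimage]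
    exact ⟨fun h => h.2, fun h => ⟨by simp, h⟩⟩
  rw [h1]
  refine (TangentBundle.mem_chart_target_iff (I := 𝓘(ℝ, Coord n)) z (⟨x₀, 0⟩ : TB n M)).trans ?_
  simp

theorem coordMap_self (x : M) (v : TangentSpace 𝓘(ℝ, Coord n) x) :
    coordMap x x v = components x v :=
  tangentCoordChange_self (I := 𝓘(ℝ, Coord n)) (by simp)

theorem coordInv_coordMap {x₀ x : M} (hx : x ∈ (chartAt (Coord n) x₀).source)
    (v : TangentSpace 𝓘(ℝ, Coord n) x) : coordInv x₀ x (coordMap x₀ x v) = v :=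
  (tangentCoordChange_comp (I := 𝓘(ℝ, Coord n)) (by simp [hx])).trans
    (tangentCoordChange_self (I := 𝓘(ℝ, Coord n)) (by simp))

theorem coordMap_coordInv {x₀ x : M} (hx : x ∈ (chartAt (Coord n) x₀).source)
    (v : Coord n) : coordMap x₀ x (coordInv x₀ x v) = v :=
  (tangentCoordChange_comp (I := 𝓘(ℝ, Coord n)) (by simp [hx])).trans
    (tangentCoordChange_self (I := 𝓘(ℝ, Coord n)) (by simp [hx]))

theorem coordMap_bijective {x₀ x : M} (hx : x ∈ (chartAt (Coord n) x₀).source) :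
    Function.Bijective (coordMap (n := n) x₀ x) :=
  Function.bijective_iff_has_inverse.2 ⟨coordInv x₀ x, coordInv_coordMap hx, coordMap_coordInv hx⟩

omit [IsManifold 𝓘(ℝ, Coord n) ∞ M] in
theorem mem_extChartAt_target {x₀ x : M} (h : x ∈ (chartAt (Coord n) x₀).source) :
    extChartAt 𝓘(ℝ, Coord n) x₀ x ∈ (extChartAt 𝓘(ℝ, Coord n) x₀).target :=
  (extChartAt 𝓘(ℝ, Coord n) x₀).map_source (by simpa using h)

omit [IsManifold 𝓘(ℝ, Coord n) ∞ M] in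
theorem isOpen_overlap (x₀ x₁ : M) : IsOpen (overlap (n := n) x₀ x₁) :=
  (continuousOn_extChartAt_symm x₀).isOpen_inter_preimage (isOpen_extChartAt_target x₀)
    (chartAt (Coord n) x₁).open_source

omit [IsManifold 𝓘(ℝ, Coord n) ∞ M] in
theorem extChartAt_mem_overlap {x₀ x₁ x : M} (h₀ : x ∈ (chartAt (Coord n) x₀).source)
    (h₁ : x ∈ (chartAt (Coord n) x₁).source) :
    extChartAt 𝓘(ℝ, Coord n) x₀ x ∈ overlap x₀ x₁ :=
  ⟨mem_extChartAt_target h₀, by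
    rw [Set.mem_preimage, (extChartAt 𝓘(ℝ, Coord n) x₀).left_inv (by simpa using h₀)]; exact h₁⟩

theorem contDiffOn_transition (x₀ x₁ : M) :
    ContDiffOn ℝ ∞ (transition (n := n) x₀ x₁) (overlap x₀ x₁) := by
  refine ContMDiffOn.contDiffOn ?_
  exact (contMDiffOn_extChartAt (I := 𝓘(ℝ, Coord n)) (n := ∞) (x := x₁)).comp
    ((contMDiffOn_extChartAt_symm x₀).mono Set.inter_subset_left) fun z hz => hz.2

omit [IsManifold 𝓘(ℝ, Coord n) ∞ M] in
theorem mapsTo_transition {x₀ x₁ : M} {z : Coord n} (hz : z ∈ overlap x₀ x₁) :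
    transition x₀ x₁ z ∈ (extChartAt 𝓘(ℝ, Coord n) x₁).target :=
  (extChartAt 𝓘(ℝ, Coord n) x₁).map_source (by simpa using hz.2)

theorem fderiv_transition {x₀ x₁ x : M} (h₀ : x ∈ (chartAt (Coord n) x₀).source)
    (h₁ : x ∈ (chartAt (Coord n) x₁).source) :
    fderiv ℝ (transition x₀ x₁) (extChartAt 𝓘(ℝ, Coord n) x₀ x) =
      tangentCoordChange 𝓘(ℝ, Coord n) x₀ x₁ x := by
  have := hasFDerivWithinAt_tangentCoordChange (I := 𝓘(ℝ, Coord n)) (x := x₀) (y := x₁) (z := x)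
    (by simp [h₀, h₁])
  simp only [modelWithCornersSelf_coe, Set.range_id, hasFDerivWithinAt_univ] at this
  exact this.fderiv

theorem fderiv_transition_coordMap {x₀ x₁ x : M} (h₀ : x ∈ (chartAt (Coord n) x₀).source)
    (h₁ : x ∈ (chartAt (Coord n) x₁).source) (v : TangentSpace 𝓘(ℝ, Coord n) x) :
    fderiv ℝ (transition x₀ x₁) (extChartAt 𝓘(ℝ, Coord n) x₀ x) (coordMap x₀ x v) =
      coordMap x₁ x v := by
  rw [fderiv_transition h₀ h₁]
  exact tangentCoordChange_comp (I := 𝓘(ℝ, Coord n)) (by simp [h₀, h₁])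

theorem tchart_transition {x₀ x₁ : M} {p : TB n M} (h₀ : p.1 ∈ (chartAt (Coord n) x₀).source)
    (h₁ : p.1 ∈ (chartAt (Coord n) x₁).source) :
    tchart x₁ p = tangentLift (transition x₀ x₁) (tchart x₀ p) := by
  rw [tchart_apply, tchart_apply, tangentLift]
  refine Prod.ext ?_ (fderiv_transition_coordMap h₀ h₁ p.2).symm
  simp only [transition, Function.comp_apply]
  rw [(extChartAt 𝓘(ℝ, Coord n) x₀).left_inv (by simpa using h₀)]

theorem bijective_fderiv_transition {x₀ x₁ : M} {z : Coord n} (hz : z ∈ overlap x₀ x₁) :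
    Function.Bijective (fderiv ℝ (transition x₀ x₁) z) := by
  set x := (extChartAt 𝓘(ℝ, Coord n) x₀).symm z with hx
  have h₀ : x ∈ (chartAt (Coord n) x₀).source := by
    rw [← extChartAt_source 𝓘(ℝ, Coord n) x₀]
    exact (extChartAt 𝓘(ℝ, Coord n) x₀).map_target hz.1
  have h₁ : x ∈ (chartAt (Coord n) x₁).source := hz.2
  have hz' : z = extChartAt 𝓘(ℝ, Coord n) x₀ x := ((extChartAt _ x₀).right_inv hz.1).symm
  rw [hz', fderiv_transition h₀ h₁]
  refine Function.bijective_iff_has_inverse.2 ⟨tangentCoordChange 𝓘(ℝ, Coord n) x₁ x₀ x,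
    fun v => ?_, fun v => ?_⟩
  · rw [tangentCoordChange_comp (by simp [h₀, h₁]), tangentCoordChange_self (by simp [h₀])]
  · rw [tangentCoordChange_comp (by simp [h₀, h₁]), tangentCoordChange_self (by simp [h₁])]

theorem localL_transition (L : TB n M → ℝ) {x₀ x₁ : M} {z : Coord n × Coord n}
    (hz : z ∈ slit (overlap x₀ x₁)) :
    localL L x₀ z = localL L x₁ (tangentLift (transition x₀ x₁) z) := by
  have ht : z ∈ (tchart (n := n) x₀).target := mem_tchart_target.2 hz.1.1
  have h₀ : ((tchart x₀).symm z : TB n M).1 ∈ (chartAt (Coord n) x₀).source :=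
    mem_tchart_source.1 ((tchart x₀).map_target ht)
  have h₁ : ((tchart x₀).symm z : TB n M).1 ∈ (chartAt (Coord n) x₁).source := hz.1.2
  have := tchart_transition h₀ h₁
  rw [(tchart x₀).right_inv ht] at this
  rw [localL, localL, ← this, (tchart x₁).left_inv (mem_tchart_source.2 h₁)]

theorem tchart_snd_ne_zero {x₀ : M} {p : TB n M} (h₀ : p.1 ∈ (chartAt (Coord n) x₀).source)
    (hp : p.2 ≠ 0) : (tchart x₀ p).2 ≠ 0 := fun h =>
  hp ((coordMap_bijective h₀).1 (h.trans (map_zero (coordMap x₀ p.1)).symm))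

theorem tchart_mem_slit {x₀ : M} {p : TB n M} (h₀ : p.1 ∈ (chartAt (Coord n) x₀).source)
    (hp : p.2 ≠ 0) : tchart x₀ p ∈ slit (extChartAt 𝓘(ℝ, Coord n) x₀).target :=
  ⟨mem_extChartAt_target h₀, tchart_snd_ne_zero h₀ hp⟩

theorem tchart_mem_slit_overlap {x₀ x₁ : M} {p : TB n M}
    (h₀ : p.1 ∈ (chartAt (Coord n) x₀).source) (h₁ : p.1 ∈ (chartAt (Coord n) x₁).source)
    (hp : p.2 ≠ 0) : tchart x₀ p ∈ slit (overlap x₀ x₁) :=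
  ⟨extChartAt_mem_overlap h₀ h₁, tchart_snd_ne_zero h₀ hp⟩

theorem tchart_symm_snd_ne_zero {x₀ : M} {z : Coord n × Coord n}
    (hz : z ∈ slit (extChartAt 𝓘(ℝ, Coord n) x₀).target) :
    ((tchart x₀).symm z : TB n M).2 ≠ 0 := fun h => hz.2 (by
  have h2 := (tchart (n := n) x₀).right_inv (mem_tchart_target.2 hz.1)
  rw [tchart_apply] at h2
  have h3 := congrArg Prod.snd h2
  simp only [h] at h3
  rw [← h3]
  exact map_zero _)

theorem tchart_smul (x₀ : M) (p : TB n M) (c : ℝ) :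
    tchart x₀ (⟨p.1, c • p.2⟩ : TB n M) = ((tchart x₀ p).1, c • (tchart x₀ p).2) :=
  Prod.ext rfl (map_smul (coordMap x₀ p.1) c p.2)

variable {L : TB n M → ℝ}

theorem IsLorentzFinsler.contDiffOn_localL (hL : IsLorentzFinsler L) (x₀ : M) :
    ContDiffOn ℝ ∞ (localL L x₀) (slit (extChartAt 𝓘(ℝ, Coord n) x₀).target) := by
  refine ContMDiffOn.contDiffOn ?_
  have h1 := contMDiffOn_extChartAt_symm (I := 𝓘(ℝ, Coord n).tangent) (n := ∞) (⟨x₀, 0⟩ : TB n M)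
  have h2 : ContMDiffOn 𝓘(ℝ, Coord n × Coord n) (𝓘(ℝ, Coord n).tangent) ∞
      (tchart (n := n) x₀).symm (slit (extChartAt 𝓘(ℝ, Coord n) x₀).target) :=
    h1.mono fun z hz => mem_tchart_target.2 hz.1
  exact hL.smooth.comp h2 fun z hz => tchart_symm_snd_ne_zero hz

/-- The fibre Hessian in any chart, in terms of the fundamental tensor. -/
theorem IsLorentzFinsler.gForm_eq (hL : IsLorentzFinsler L) {x₀ : M} {p : TB n M}
    (h₀ : p.1 ∈ (chartAt (Coord n) x₀).source) (hp : p.2 ≠ 0)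
    (a b : TangentSpace 𝓘(ℝ, Coord n) p.1) :
    gForm L p a b = fderiv ℝ (fderiv ℝ (localL L x₀)) (tchart x₀ p)
      (0, coordMap x₀ p.1 a) (0, coordMap x₀ p.1 b) := by
  have hc : p.1 ∈ (chartAt (Coord n) p.1).source := mem_chart_source _ _
  have hz := tchart_mem_slit_overlap hc h₀ hp
  have hmono : slit (overlap p.1 x₀) ⊆ slit (extChartAt 𝓘(ℝ, Coord n) p.1).target :=
    fun z hz => ⟨hz.1.1, hz.2⟩
  have h1 : gForm L p a b = fderiv ℝ (fderiv ℝ (localL L p.1)) (tchart p.1 p) (0, components p.1 a)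
      (0, components p.1 b) :=
    gMat_sum_of_smooth (isOpen_overlap p.1 x₀) ((hL.contDiffOn_localL p.1).mono hmono) hz _ _
  rw [h1, hessian_changeOfCoordinates (ℓ₀ := localL L p.1) (ℓ₁ := localL L x₀) (contDiffOn_transition p.1 x₀)
    (fun x hx => mapsTo_transition hx) (fun x hx => bijective_fderiv_transition hx)
    (fun z hz => localL_transition L hz) (isOpen_overlap p.1 x₀) (isOpen_extChartAt_target x₀)
    ((hL.contDiffOn_localL p.1).mono hmono) (hL.contDiffOn_localL x₀) hz,
    fderiv_tangentLift_apply (contDiffOn_transition p.1 x₀) (isOpen_overlap p.1 x₀) hz.1,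
    ← tchart_transition hc h₀]
  have h2 := fderiv_transition_coordMap hc h₀ a
  have h3 := fderiv_transition_coordMap hc h₀ b
  rw [coordMap_self] at h2 h3
  have e0 : ((0 : Coord n), (0 : Coord n)) = 0 := rfl
  rw [tchart_apply p.1 p]
  simp only [map_zero, zero_apply, add_zero, h2, h3, e0]

/-- The coordinate expression of a Lorentz–Finsler structure in every bundle chart. Its fibre
Hessian is nondegenerate because it is diagonal with entries `±1` in a suitable basis. -/
theorem IsLorentzFinsler.isLocalLagrangian (hL : IsLorentzFinsler L) (x₀ : M) :
    IsLocalLagrangian (localL L x₀) (extChartAt 𝓘(ℝ, Coord n) x₀).target where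
  isOpen := isOpen_extChartAt_target x₀
  smooth := hL.contDiffOn_localL x₀
  homog x hx v c hc := by
    rw [localL, localL, tchart_symm_apply, tchart_symm_apply]
    simp only [map_smul]
    exact hL.homog _ _ c hc
  nondeg z hz a ha := by
    set p : TB n M := (tchart x₀).symm z with hp
    have ht : z ∈ (tchart (n := n) x₀).target := mem_tchart_target.2 hz.1
    have h₀ : p.1 ∈ (chartAt (Coord n) x₀).source :=
      mem_tchart_source.1 ((tchart x₀).map_target ht)
    have hp2 : p.2 ≠ 0 := tchart_symm_snd_ne_zero hz
    have hz' : z = tchart x₀ p := ((tchart x₀).right_inv ht).symm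
    obtain ⟨a', rfl⟩ := (coordMap_bijective h₀).2 a
    obtain ⟨b, hb⟩ := hL.signature p hp2
    have h1 : ∀ w, gForm L p a' w = 0 := fun w => by
      rw [hL.gForm_eq h₀ hp2, ← hz']; exact ha _
    have h2 : b.repr a' = 0 := by
      ext i
      have h3 := h1 (b i)
      have h4 : gForm L p a' (b i) = ∑ j, b.repr a' j * gForm L p (b j) (b i) := by
        simp only [hL.gForm_eq h₀ hp2]
        let A : TangentSpace 𝓘(ℝ, Coord n) p.1 →ₗ[ℝ] ℝ := (ContinuousLinearMap.apply ℝ ℝ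
          ((0 : Coord n), coordMap x₀ p.1 (b i))).toLinearMap ∘ₗ
          (fderiv ℝ (fderiv ℝ (localL L x₀)) (tchart x₀ p)).toLinearMap ∘ₗ LinearMap.inr ℝ _ _ ∘ₗ
          (coordMap x₀ p.1).toLinearMap
        change A a' = ∑ j, b.repr a' j * A (b j)
        have h5 := congrArg A (b.sum_repr a')
        rw [map_sum] at h5
        rw [← h5]
        exact Finset.sum_congr rfl fun j _ => map_smul A _ _
      rw [h4, Finset.sum_eq_single i (fun j _ hj => by rw [hb]; simp [hj]) (by simp), hb] at h3
      by_cases hi : i = 0 <;> simpa [hi] using h3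
    have h6 : a' = 0 := by simpa using h2
    rw [h6, map_zero]

/-- `g_v(v, w)` is the fibre derivative of the Lagrangian at `v` in direction `w`, in any chart. -/
theorem IsLorentzFinsler.gForm_self_eq (hL : IsLorentzFinsler L) {x₀ : M} {p : TB n M}
    (h₀ : p.1 ∈ (chartAt (Coord n) x₀).source) (hp : p.2 ≠ 0)
    (w : TangentSpace 𝓘(ℝ, Coord n) p.1) :
    gForm L p p.2 w = fderiv ℝ (localL L x₀) (tchart x₀ p) (0, coordMap x₀ p.1 w) := by
  have h := hL.isLocalLagrangian x₀
  have hz := tchart_mem_slit h₀ hp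
  have h1 := h.euler2 hz (0, coordMap x₀ p.1 w)
  rw [hL.gForm_eq h₀ hp, h.symm2 hz]
  refine h1.trans ?_
  simp only
  ring

end Charts

/-! ### Geodesics and covariant derivatives in charts -/

section Curves

variable {n : ℕ} {M : Type*} [TopologicalSpace M] [ChartedSpace (Coord n) M]
  [IsManifold 𝓘(ℝ, Coord n) ∞ M]

theorem contDiffOn_tchart {x₀ : M} {γ : ℝ → TB n M} {U : Set ℝ}
    (h : ContMDiffOn 𝓘(ℝ, ℝ) (𝓘(ℝ, Coord n).tangent) ∞ γ U)
    (hs : ∀ t ∈ U, (γ t).1 ∈ (chartAt (Coord n) x₀).source) :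
    ContDiffOn ℝ ∞ (fun t => tchart x₀ (γ t)) U := by
  refine ContMDiffOn.contDiffOn ?_
  refine (contMDiffOn_extChartAt (I := 𝓘(ℝ, Coord n).tangent) (n := ∞)
    (x := (⟨x₀, 0⟩ : TB n M))).comp h fun t ht => ?_
  exact (TangentBundle.mem_chart_source_iff (I := 𝓘(ℝ, Coord n)) _ _).2 (hs t ht)

theorem contMDiffOn_of_tchart {x₀ : M} {γ : ℝ → TB n M} {U : Set ℝ}
    (hs : ∀ t ∈ U, (γ t).1 ∈ (chartAt (Coord n) x₀).source)
    (h : ContDiffOn ℝ ∞ (fun t => tchart x₀ (γ t)) U) :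
    ContMDiffOn 𝓘(ℝ, ℝ) (𝓘(ℝ, Coord n).tangent) ∞ γ U := by
  have h1 := contMDiffOn_extChartAt_symm (I := 𝓘(ℝ, Coord n).tangent) (n := ∞) (⟨x₀, 0⟩ : TB n M)
  have h2 : ContMDiffOn 𝓘(ℝ, ℝ) (𝓘(ℝ, Coord n).tangent) ∞
      (fun t => (tchart x₀).symm (tchart x₀ (γ t))) U :=
    h1.comp h.contMDiffOn fun t ht => (tchart x₀).map_source (mem_tchart_source.2 (hs t ht))
  exact h2.congr fun t ht => ((tchart x₀).left_inv (mem_tchart_source.2 (hs t ht))).symm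

/-- The nonlinear connection at `p` in the chart around `x₀`. -/
def conn (L : TB n M → ℝ) (x₀ : M) (p : TB n M) (w : Coord n) : Coord n :=
  fderiv ℝ (sprayVec (localL L x₀)) (tchart x₀ p) (0, w)

variable {L : TB n M → ℝ} {X : ∀ x : M, TangentSpace 𝓘(ℝ, Coord n) x} {η : ℝ → M} {I : Set ℝ}

theorem futureCausal_ne_zero {p : TB n M} (hp : p ∈ futureCausal L X) : p.2 ≠ 0 :=
  (connectedComponentIn_subset _ _ hp).2

theorem uniqueDiffOn_of_ordConnected (h : I.OrdConnected) (hn : I.Nontrivial) :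
    UniqueDiffOn ℝ I := by
  refine uniqueDiffOn_convex h.convex ?_
  obtain ⟨a, ha, b, hb, hab⟩ := hn.exists_lt
  exact (Set.nonempty_Ioo.2 hab).mono
    (interior_maximal (Set.Ioo_subset_Icc_self.trans (h.out ha hb)) isOpen_Ioo)

namespace IsCausalGeodesic

variable (hη : IsCausalGeodesic L X η I)
include hη

theorem uniqueDiffOn : UniqueDiffOn ℝ I := uniqueDiffOn_of_ordConnected hη.interval hη.nontrivial

theorem velocity_ne_zero {t : ℝ} (ht : t ∈ I) : (velocity (n := n) η I t).2 ≠ 0 :=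
  futureCausal_ne_zero (hη.causal t ht)

theorem exists_isOpen {x₀ : M} {t : ℝ} (ht : t ∈ I) (h₀ : η t ∈ (chartAt (Coord n) x₀).source) :
    ∃ O : Set ℝ, IsOpen O ∧ t ∈ O ∧ ∀ s ∈ I ∩ O, η s ∈ (chartAt (Coord n) x₀).source := by
  obtain ⟨O, hO, htO, h⟩ := mem_nhdsWithin.1
    ((hη.smooth.continuousOn t ht) ((chartAt (Coord n) x₀).open_source.mem_nhds h₀))
  exact ⟨O, hO, htO, fun s hs => h ⟨hs.2, hs.1⟩⟩

theorem contDiffOn_base {x₀ : M} {U : Set ℝ} (hU : U ⊆ I)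
    (h₀ : ∀ s ∈ U, η s ∈ (chartAt (Coord n) x₀).source) :
    ContDiffOn ℝ ∞ (fun s => extChartAt 𝓘(ℝ, Coord n) x₀ (η s)) U :=
  ContMDiffOn.contDiffOn ((contMDiffOn_extChartAt (I := 𝓘(ℝ, Coord n)) (n := ∞) (x := x₀)).comp
    (hη.smooth.mono hU) h₀)

/-- The velocity in bundle coordinates. -/
theorem tchart_velocity {x₀ : M} {t : ℝ} (ht : t ∈ I) (h₀ : η t ∈ (chartAt (Coord n) x₀).source) :
    tchart x₀ (velocity η I t) = (extChartAt 𝓘(ℝ, Coord n) x₀ (η t),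
      derivWithin (fun s => extChartAt 𝓘(ℝ, Coord n) x₀ (η s)) I t) := by
  rw [tchart_apply]
  refine Prod.ext rfl ?_
  have h1 : MDifferentiableAt 𝓘(ℝ, Coord n) 𝓘(ℝ, Coord n) (extChartAt 𝓘(ℝ, Coord n) x₀) (η t) :=
    mdifferentiableAt_extChartAt h₀
  have h2 : MDifferentiableWithinAt 𝓘(ℝ, ℝ) 𝓘(ℝ, Coord n) η I t :=
    (hη.smooth t ht).mdifferentiableWithinAt (by simp)
  have h3 := mfderiv_comp_mfderivWithin t h1 h2 (hη.uniqueDiffOn t ht).uniqueMDiffWithinAt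
  have h4 := TangentBundle.continuousLinearMapAt_trivializationAt (I := 𝓘(ℝ, Coord n)) h₀
  have h5 := TangentBundle.continuousLinearMapAt_trivializationAt_eq_core (I := 𝓘(ℝ, Coord n)) h₀
  have h6 : coordMap x₀ (η t) = mfderiv 𝓘(ℝ, Coord n) 𝓘(ℝ, Coord n)
      (extChartAt 𝓘(ℝ, Coord n) x₀) (η t) := h5.symm.trans h4
  rw [mfderivWithin_eq_fderivWithin] at h3
  rw [← fderivWithin_derivWithin]
  change coordMap x₀ (η t) (mfderivWithin 𝓘(ℝ, ℝ) 𝓘(ℝ, Coord n) η I t (1 : ℝ)) = _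
  rw [h6]
  exact (congrArg (fun T : ℝ →L[ℝ] Coord n => T 1) h3).symm

theorem contMDiffOn_velocity :
    ContMDiffOn 𝓘(ℝ, ℝ) (𝓘(ℝ, Coord n).tangent) ∞ (fun t => (velocity η I t : TB n M)) I := by
  intro t ht
  obtain ⟨O, hO, htO, h₀⟩ := hη.exists_isOpen (x₀ := η t) ht (mem_chart_source _ _)
  have hu : UniqueDiffOn ℝ (I ∩ O) := hη.uniqueDiffOn.inter hO
  have h1 := hη.contDiffOn_base (x₀ := η t) Set.inter_subset_left h₀
  have h2 : ContDiffOn ℝ ∞ (fun s => tchart (η t) (velocity (n := n) η I s)) (I ∩ O) := by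
    refine (h1.prodMk (h1.derivWithin hu (m := ∞) (by simp))).congr fun s hs => ?_
    rw [hη.tchart_velocity hs.1 (h₀ s hs), derivWithin_inter (hO.mem_nhds hs.2)]
  exact ((contMDiffOn_of_tchart (fun s hs => h₀ s hs) h2) t ⟨ht, htO⟩).mono_of_mem_nhdsWithin
    (inter_mem_nhdsWithin I (hO.mem_nhds htO))

/-- A smooth lift of `η` to the tangent bundle is differentiable in bundle charts. -/
theorem differentiableWithinAt_tchart {γ : ℝ → TB n M} {O : Set ℝ} (hO : IsOpen O)
    (hγ : ContMDiffOn 𝓘(ℝ, ℝ) (𝓘(ℝ, Coord n).tangent) ∞ γ (I ∩ O)) {x₀ : M} {t : ℝ} (ht : t ∈ I)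
    (htO : t ∈ O) (hbase : ∀ s, (γ s).1 = η s) (h₀ : η t ∈ (chartAt (Coord n) x₀).source) :
    DifferentiableWithinAt ℝ (fun s => tchart x₀ (γ s)) I t := by
  obtain ⟨O', hO', htO', h'⟩ := hη.exists_isOpen ht h₀
  have h1 := contDiffOn_tchart (x₀ := x₀) (U := I ∩ (O ∩ O'))
    (hγ.mono fun s hs => ⟨hs.1, hs.2.1⟩) fun s hs => by rw [hbase]; exact h' s ⟨hs.1, hs.2.2⟩
  exact ((h1 t ⟨ht, htO, htO'⟩).differentiableWithinAt (by simp)).mono_of_mem_nhdsWithin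
    (inter_mem_nhdsWithin I ((hO.inter hO').mem_nhds ⟨htO, htO'⟩))

/-- The curve of velocities is an integral curve of the spray. -/
theorem hasDerivWithinAt_velocity {x₀ : M} {t : ℝ} (ht : t ∈ I)
    (h₀ : η t ∈ (chartAt (Coord n) x₀).source) :
    HasDerivWithinAt (fun s => tchart x₀ (velocity η I s))
      ((tchart x₀ (velocity η I t)).2,
        -(2 : ℝ) • sprayVec (localL L x₀) (tchart x₀ (velocity η I t))) I t := by
  have h1 := (hη.differentiableWithinAt_tchart isOpen_univ (by simpa using hη.contMDiffOn_velocity) ht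
    (Set.mem_univ t) (fun _ => rfl) h₀).hasDerivWithinAt
  have hu := hη.uniqueDiffOn t ht
  have h2 : HasDerivWithinAt (fun s => (tchart x₀ (velocity η I s)).2)
    (derivWithin (fun s => tchart x₀ (velocity η I s)) I t).2 I t := h1.snd
  have h3 : HasDerivWithinAt (fun s => extChartAt 𝓘(ℝ, Coord n) x₀ (η s))
    (derivWithin (fun s => tchart x₀ (velocity η I s)) I t).1 I t := h1.fst
  refine h1.congr_deriv (Prod.ext ?_ ?_)
  · rw [← h3.derivWithin hu, hη.tchart_velocity ht h₀]
  · ext α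
    have h4 : HasDerivWithinAt (fun s => (tchart x₀ (velocity η I s)).2 α)
        ((derivWithin (fun s => tchart x₀ (velocity η I s)) I t).2 α) I t :=
      (EuclideanSpace.proj (𝕜 := ℝ) α).hasFDerivAt.comp_hasDerivWithinAt t h2
    have h5 := hη.geodesic x₀ t ht h₀ α
    rw [h4.derivWithin hu] at h5
    simp only [PiLp.smul_apply, smul_eq_mul, sprayVec, spray]
    linarith

end IsCausalGeodesic

theorem IsLorentzFinsler.chern_sum (hL : IsLorentzFinsler L) {x₀ : M} {p : TB n M}
    (h₀ : p.1 ∈ (chartAt (Coord n) x₀).source) (hp : p.2 ≠ 0) (w : Coord n) (α : Fin (n + 1)) :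
    ∑ β, ∑ γ, chern (localL L x₀) α β γ (tchart x₀ p) * (tchart x₀ p).2 β * w γ =
      conn L x₀ p w α :=
  (hL.isLocalLagrangian x₀).chern_sum (tchart_mem_slit h₀ hp) w α

/-- The covariant derivative along a geodesic does not depend on the chart. -/
theorem IsCausalGeodesic.covDeriv_changeOfCoordinates (hL : IsLorentzFinsler L)
    (hη : IsCausalGeodesic L X η I) {Y : ∀ t : ℝ, TangentSpace 𝓘(ℝ, Coord n) (η t)} {x₀ x₁ : M}
    {t : ℝ} (ht : t ∈ I) (h₀ : η t ∈ (chartAt (Coord n) x₀).source)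
    (h₁ : η t ∈ (chartAt (Coord n) x₁).source) {a : Coord n}
    (ha : HasDerivWithinAt (fun s => coordMap x₀ (η s) (Y s)) a I t) :
    ∃ b, HasDerivWithinAt (fun s => coordMap x₁ (η s) (Y s)) b I t ∧
      b + conn L x₁ (velocity η I t) (coordMap x₁ (η t) (Y t)) =
        fderiv ℝ (transition x₀ x₁) (extChartAt 𝓘(ℝ, Coord n) x₀ (η t))
          (a + conn L x₀ (velocity η I t) (coordMap x₀ (η t) (Y t))) := by
  have ho := isOpen_overlap (n := n) x₀ x₁
  have hφ := contDiffOn_transition (n := n) x₀ x₁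
  have hx := extChartAt_mem_overlap h₀ h₁
  have hv := hη.velocity_ne_zero ht
  have hz := tchart_mem_slit_overlap (p := velocity η I t) h₀ h₁ hv
  have hl₀ : IsLocalLagrangian (localL L x₀) (overlap x₀ x₁) :=
    { isOpen := ho
      smooth := (hL.contDiffOn_localL x₀).mono fun z hz => ⟨hz.1.1, hz.2⟩
      homog := fun x hx => (hL.isLocalLagrangian x₀).homog x hx.1
      nondeg := fun z hz => (hL.isLocalLagrangian x₀).nondeg z ⟨hz.1.1, hz.2⟩ }
  have hc : HasDerivWithinAt (fun s => extChartAt 𝓘(ℝ, Coord n) x₀ (η s))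
      (tchart x₀ (velocity η I t)).2 I t := (hη.hasDerivWithinAt_velocity ht h₀).fst
  have h1 := (smooth_differentiableAt ho (smooth_fderiv ho hφ) hx).hasFDerivAt.comp_hasDerivWithinAt
    t hc
  refine ⟨_, (h1.clm_apply ha).congr_of_eventuallyEq ?_ ?_, ?_⟩
  · obtain ⟨O, hO, htO, h₀'⟩ := hη.exists_isOpen ht h₀
    obtain ⟨O', hO', htO', h₁'⟩ := hη.exists_isOpen ht h₁
    filter_upwards [inter_mem_nhdsWithin I ((hO.inter hO').mem_nhds ⟨htO, htO'⟩)] with s hs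
    exact (fderiv_transition_coordMap (h₀' s ⟨hs.1, hs.2.1⟩) (h₁' s ⟨hs.1, hs.2.2⟩) (Y s)).symm
  · exact (fderiv_transition_coordMap h₀ h₁ (Y t)).symm
  · have h2 := fderiv_sprayVec_changeOfCoordinates hl₀ (hL.isLocalLagrangian x₁) hφ
      (fun x hx => mapsTo_transition hx) (fun x hx => bijective_fderiv_transition hx)
      (fun z hz => localL_transition L hz) hz (coordMap x₀ (η t) (Y t))
    have h3 : (tchart x₀ (velocity η I t)).1 = extChartAt 𝓘(ℝ, Coord n) x₀ (η t) := rfl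
    rw [← tchart_transition (p := velocity η I t) h₀ h₁, h3,
      fderiv_transition_coordMap h₀ h₁ (Y t)] at h2
    rw [conn, h2, map_add, conn]
    simp only [Function.comp_apply]
    abel

/-- A covariant derivative is determined by one chart. -/
theorem IsCausalGeodesic.isCovDeriv_of_chart (hL : IsLorentzFinsler L)
    (hη : IsCausalGeodesic L X η I) {Y Y' : ∀ t : ℝ, TangentSpace 𝓘(ℝ, Coord n) (η t)} {x₀ : M}
    {O : Set ℝ} (hO : IsOpen O) (h₀ : ∀ t ∈ I ∩ O, η t ∈ (chartAt (Coord n) x₀).source)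
    {y : ℝ → Coord n} (hy : ContDiffOn ℝ ∞ y (I ∩ O))
    (hY : ∀ t ∈ I ∩ O, coordMap x₀ (η t) (Y t) = y t)
    (hY' : ∀ t ∈ I ∩ O, coordMap x₀ (η t) (Y' t) =
      derivWithin y I t + conn L x₀ (velocity η I t) (y t)) :
    IsCovDeriv L η I (I ∩ O) Y Y' := by
  refine ⟨contMDiffOn_of_tchart (x₀ := x₀) h₀ ?_, fun x₁ t ht h₁ α => ?_⟩
  · exact ((hη.contDiffOn_base Set.inter_subset_left h₀).prodMk hy).congr fun t ht =>
      Prod.ext rfl (hY t ht)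
  · have hd : HasDerivWithinAt y (derivWithin y I t) I t :=
      (((hy t ht).differentiableWithinAt (by simp)).mono_of_mem_nhdsWithin
        (inter_mem_nhdsWithin I (hO.mem_nhds ht.2))).hasDerivWithinAt
    have hd' : HasDerivWithinAt (fun s => coordMap x₀ (η s) (Y s)) (derivWithin y I t) I t :=
      hd.congr_of_eventuallyEq (by
        filter_upwards [inter_mem_nhdsWithin I (hO.mem_nhds ht.2)] with s hs using hY s hs)
        (hY t ht)
    obtain ⟨b, hb, he⟩ := hη.covDeriv_changeOfCoordinates hL ht.1 (h₀ t ht) h₁ hd'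
    have hbα : HasDerivWithinAt (fun s => (tchart x₁ (⟨η s, Y s⟩ : TB n M)).2 α) (b α) I t :=
      (EuclideanSpace.proj (𝕜 := ℝ) α).hasFDerivAt.comp_hasDerivWithinAt t hb
    rw [hbα.derivWithin (hη.uniqueDiffOn t ht.1),
      hL.chern_sum (p := velocity η I t) h₁ (hη.velocity_ne_zero ht.1)]
    rw [hY t ht, ← hY' t ht, fderiv_transition_coordMap (h₀ t ht) h₁] at he
    exact (congrArg (fun w : Coord n => w α) he).symm

/-- A covariant derivative, read in a chart. -/
theorem IsCausalGeodesic.hasDerivWithinAt_of_isCovDeriv (hL : IsLorentzFinsler L)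
    (hη : IsCausalGeodesic L X η I) {Y Y' : ∀ t : ℝ, TangentSpace 𝓘(ℝ, Coord n) (η t)} {x₀ : M}
    {O : Set ℝ} (hO : IsOpen O) (h : IsCovDeriv L η I (I ∩ O) Y Y') {t : ℝ} (ht : t ∈ I ∩ O)
    (h₀ : η t ∈ (chartAt (Coord n) x₀).source) :
    HasDerivWithinAt (fun s => coordMap x₀ (η s) (Y s)) (coordMap x₀ (η t) (Y' t)
      - conn L x₀ (velocity η I t) (coordMap x₀ (η t) (Y t))) I t := by
  have h1 : HasDerivWithinAt (fun s => coordMap x₀ (η s) (Y s))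
      (derivWithin (fun s => tchart x₀ (⟨η s, Y s⟩ : TB n M)) I t).2 I t :=
    (hη.differentiableWithinAt_tchart hO h.1 ht.1 ht.2 (fun _ => rfl) h₀).hasDerivWithinAt.snd
  refine h1.congr_deriv ?_
  ext α
  have h2 := h.2 x₀ t ht h₀ α
  have h3 : HasDerivWithinAt (fun s => (tchart x₀ (⟨η s, Y s⟩ : TB n M)).2 α) _ I t :=
    (EuclideanSpace.proj (𝕜 := ℝ) α).hasFDerivAt.comp_hasDerivWithinAt t h1
  rw [hL.chern_sum (p := velocity η I t) h₀ (hη.velocity_ne_zero ht.1),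
    h3.derivWithin (hη.uniqueDiffOn t ht.1)] at h2
  exact (sub_eq_of_eq_add h2).symm

end Curves

/-! ### Local frames of the quotient bundle along a lightlike geodesic -/

section Frames

variable {n : ℕ} {M : Type*} [TopologicalSpace M] [ChartedSpace (Coord n) M]
  [IsManifold 𝓘(ℝ, Coord n) ∞ M]

variable {L : TB n M → ℝ} {X : ∀ x : M, TangentSpace 𝓘(ℝ, Coord n) x} {η : ℝ → M} {I : Set ℝ}

/-- The fibre derivative of the Lagrangian at `p` in the chart around `x₀`; for `p ≠ 0` its kernel
represents `orth L p`. -/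
def momentum (L : TB n M → ℝ) (x₀ : M) (p : TB n M) : Coord n →L[ℝ] ℝ :=
  (fderiv ℝ (localL L x₀) (tchart x₀ p)).comp (ContinuousLinearMap.inr ℝ _ _)

theorem momentum_apply (L : TB n M → ℝ) (x₀ : M) (p : TB n M) (w : Coord n) :
    momentum L x₀ p w = fderiv ℝ (localL L x₀) (tchart x₀ p) (0, w) := rfl

theorem IsLorentzFinsler.mem_orth_iff (hL : IsLorentzFinsler L) {x₀ : M} {p : TB n M}
    (h₀ : p.1 ∈ (chartAt (Coord n) x₀).source) (hp : p.2 ≠ 0)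
    (w : TangentSpace 𝓘(ℝ, Coord n) p.1) :
    w ∈ orth L p ↔ momentum L x₀ p (coordMap x₀ p.1 w) = 0 :=
  by rw [momentum_apply, ← hL.gForm_self_eq h₀ hp]; rfl

theorem IsLorentzFinsler.momentum_self (hL : IsLorentzFinsler L) {x₀ : M} {p : TB n M}
    (h₀ : p.1 ∈ (chartAt (Coord n) x₀).source) (hp : p.2 ≠ 0) :
    momentum L x₀ p (tchart x₀ p).2 = 2 * L p := by
  rw [momentum_apply, (hL.isLocalLagrangian x₀).euler1 (tchart_mem_slit h₀ hp), localL,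
    (tchart x₀).left_inv (mem_tchart_source.2 h₀)]

theorem IsLorentzFinsler.momentum_ne_zero (hL : IsLorentzFinsler L) {x₀ : M} {p : TB n M}
    (h₀ : p.1 ∈ (chartAt (Coord n) x₀).source) (hp : p.2 ≠ 0) :
    momentum L x₀ p ≠ 0 := fun h => by
  have hl := hL.isLocalLagrangian x₀
  have hz := tchart_mem_slit h₀ hp
  refine tchart_snd_ne_zero h₀ hp (hl.nondeg _ hz _ fun w => ?_)
  have h1 := hl.euler2 hz (0, w)
  have h2 : fderiv ℝ (localL L x₀) (tchart x₀ p) (0, w) = 0 := by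
    rw [← momentum_apply, h]; rfl
  rw [hl.symm2 hz, h1, h2]
  simp

theorem IsLorentzFinsler.self_mem_orth (hL : IsLorentzFinsler L) {p : TB n M} (hp : p.2 ≠ 0)
    (hn : L p = 0) : p.2 ∈ orth L p := by
  have hc : p.1 ∈ (chartAt (Coord n) p.1).source := mem_chart_source _ _
  rw [hL.mem_orth_iff hc hp]
  exact (hL.momentum_self hc hp).trans (by rw [hn, mul_zero])

instance (p : TB n M) : FiniteDimensional ℝ (TangentSpace 𝓘(ℝ, Coord n) p.1) :=
  inferInstanceAs (FiniteDimensional ℝ (Coord n))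

theorem IsLorentzFinsler.finrank_orth (hL : IsLorentzFinsler L) {p : TB n M} (hp : p.2 ≠ 0) :
    Module.finrank ℝ (orth L p) = n := by
  have hc : p.1 ∈ (chartAt (Coord n) p.1).source := mem_chart_source _ _
  let f : Module.Dual ℝ (TangentSpace 𝓘(ℝ, Coord n) p.1) :=
    (momentum L p.1 p).toLinearMap ∘ₗ (coordMap p.1 p.1).toLinearMap
  have hf : f ≠ 0 := fun h => hL.momentum_ne_zero hc hp (by
    ext w
    obtain ⟨w', rfl⟩ := (coordMap_bijective hc).2 w
    exact congrArg (fun g : Module.Dual ℝ (TangentSpace 𝓘(ℝ, Coord n) p.1) => g w') h)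
  have h1 : orth L p = LinearMap.ker f := by
    ext w; rw [hL.mem_orth_iff hc hp]; rfl
  have h2 := Module.Dual.finrank_ker_add_one_of_ne_zero hf
  have h3 : Module.finrank ℝ (TangentSpace 𝓘(ℝ, Coord n) p.1) = n + 1 :=
    (finrank_euclideanSpace (𝕜 := ℝ) (ι := Fin (n + 1))).trans (Fintype.card_fin _)
  rw [h1]
  omega

theorem IsLorentzFinsler.finrank_quot (hL : IsLorentzFinsler L) {p : TB n M} (hp : p.2 ≠ 0)
    (hn : L p = 0) : Module.finrank ℝ (quot L p) = n - 1 := by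
  have h1 := Submodule.finrank_quotient_add_finrank
    (Submodule.comap (orth L p).subtype (Submodule.span ℝ {p.2}))
  have h2 : Submodule.span ℝ {p.2} ≤ orth L p := by
    rw [Submodule.span_singleton_le_iff_mem]; exact hL.self_mem_orth hp hn
  rw [(Submodule.comapSubtypeEquivOfLe h2).finrank_eq, finrank_span_singleton hp,
    hL.finrank_orth hp] at h1
  exact Nat.eq_sub_of_add_eq h1

/-- Coordinates on the quotient `orth L p / ℝ p`, from a projection `P` of the model space along
`p` and a section `S` with values in the kernel of the momentum. -/
theorem IsLorentzFinsler.exists_quot_coord (hL : IsLorentzFinsler L) {x₀ : M} {p : TB n M}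
    (h₀ : p.1 ∈ (chartAt (Coord n) x₀).source) (hp : p.2 ≠ 0) (hn : L p = 0)
    (P : Coord n →ₗ[ℝ] (Fin (n - 1) → ℝ)) (S : (Fin (n - 1) → ℝ) →ₗ[ℝ] Coord n)
    (hP : P (tchart x₀ p).2 = 0) (hS : ∀ c, momentum L x₀ p (S c) = 0) (hPS : ∀ c, P (S c) = c) :
    ∃ (Φ : quot L p →ₗ[ℝ] (Fin (n - 1) → ℝ)) (Ψ : (Fin (n - 1) → ℝ) →ₗ[ℝ] orth L p),
      (∀ y : orth L p, Φ (toQuot L p y) = P (coordMap x₀ p.1 y)) ∧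
      (∀ c, coordMap x₀ p.1 (Ψ c) = S c) ∧ (∀ c, Φ (toQuot L p (Ψ c)) = c) ∧
      ∀ q, toQuot L p (Ψ (Φ q)) = q := by
  let Ψ : (Fin (n - 1) → ℝ) →ₗ[ℝ] orth L p :=
    LinearMap.codRestrict (orth L p) ((coordInv x₀ p.1).toLinearMap ∘ₗ S) fun c => by
      rw [hL.mem_orth_iff h₀ hp]
      exact (congrArg _ (coordMap_coordInv h₀ (S c))).trans (hS c)
  have hΨ : ∀ c, coordMap x₀ p.1 (Ψ c) = S c := fun c => coordMap_coordInv h₀ (S c)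
  let Φ : quot L p →ₗ[ℝ] (Fin (n - 1) → ℝ) := Submodule.liftQ _
    (P ∘ₗ (coordMap x₀ p.1).toLinearMap ∘ₗ (orth L p).subtype) (by
      rintro ⟨y, hy⟩ hy'
      obtain ⟨a, ha⟩ := Submodule.mem_span_singleton.1 hy'
      have ha' : a • p.2 = y := ha
      rw [LinearMap.mem_ker]
      change P (coordMap x₀ p.1 y) = 0
      rw [← ha', map_smul, map_smul]
      exact (congrArg (a • ·) hP).trans (smul_zero a))
  have hΦ : ∀ y : orth L p, Φ (toQuot L p y) = P (coordMap x₀ p.1 y) := fun y => rfl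
  have h1 : ∀ c, Φ (toQuot L p (Ψ c)) = c := fun c => by rw [hΦ, hΨ, hPS]
  refine ⟨Φ, Ψ, hΦ, hΨ, h1, fun q => ?_⟩
  have hinj : Function.Injective Φ := by
    rw [LinearMap.injective_iff_surjective_of_finrank_eq_finrank
      (by rw [hL.finrank_quot hp hn, Module.finrank_fin_fun])]
    exact fun c => ⟨_, h1 c⟩
  exact hinj (h1 _)

/-- A splitting of the model space adapted to a vector `v` in the kernel of a functional `f`: the
functional `lam` detects `v`, and `P`, `W` project to and include a complement of `span {v, u}`,
where `f u ≠ 0`. -/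
theorem exists_splitting {v : Coord n} {f : Coord n →L[ℝ] ℝ} (hv : v ≠ 0) (hf : f ≠ 0)
    (hfv : f v = 0) :
    ∃ (P : Coord n →L[ℝ] (Fin (n - 1) → ℝ)) (lam : Coord n →L[ℝ] ℝ)
      (W : (Fin (n - 1) → ℝ) →L[ℝ] Coord n) (u : Coord n),
      lam v ≠ 0 ∧ f u ≠ 0 ∧ (∀ c, P (W c) = c) ∧ P u = 0 ∧ (∀ c, lam (W c) = 0) ∧ lam u = 0 := by
  obtain ⟨u, hu⟩ : ∃ u, f u ≠ 0 := by
    by_contra! h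
    exact hf (ContinuousLinearMap.ext h)
  have hli : LinearIndependent ℝ ![v, u] := by
    rw [LinearIndependent.pair_iff]
    intro s t h
    have ht : t = 0 := by
      have := congrArg f h
      simpa [hfv, hu] using this
    subst ht
    simpa [hv] using h
  set A : Submodule ℝ (Coord n) := Submodule.span ℝ (Set.range ![v, u]) with hA
  have hvA : v ∈ A := Submodule.subset_span ⟨0, rfl⟩
  have huA : u ∈ A := Submodule.subset_span ⟨1, rfl⟩
  obtain ⟨C, hC⟩ := Submodule.exists_isCompl A
  have hdA : Module.finrank ℝ A = 2 := by simpa using finrank_span_eq_card hli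
  have hdC : Module.finrank ℝ C = n - 1 := by
    have := Submodule.finrank_add_eq_of_isCompl hC
    rw [hdA, finrank_euclideanSpace, Fintype.card_fin] at this
    omega
  let e : C ≃ₗ[ℝ] (Fin (n - 1) → ℝ) :=
    LinearEquiv.ofFinrankEq C (Fin (n - 1) → ℝ) (by rw [hdC, Module.finrank_fin_fun])
  have hvn : v ∉ C ⊔ Submodule.span ℝ {u} := by
    intro h
    obtain ⟨c, hc, b, hb, hcb⟩ := Submodule.mem_sup.1 h
    obtain ⟨a, rfl⟩ := Submodule.mem_span_singleton.1 hb
    have h1 : c ∈ A := by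
      rw [← sub_eq_of_eq_add hcb.symm]
      exact A.sub_mem hvA (A.smul_mem a huA)
    have h2 : c = 0 := Submodule.disjoint_def.1 hC.disjoint c h1 hc
    have h3 : a * f u = 0 := by
      rw [h2, zero_add] at hcb
      rw [← smul_eq_mul, ← map_smul, hcb, hfv]
    rcases mul_eq_zero.1 h3 with h4 | h4
    · rw [h2, h4] at hcb
      exact hv (by simpa using hcb.symm)
    · exact hu h4
  obtain ⟨g, hg1, hg2⟩ := Submodule.exists_le_ker_of_notMem hvn
  let P : Coord n →ₗ[ℝ] (Fin (n - 1) → ℝ) :=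
    e.toLinearMap ∘ₗ Submodule.projectionOnto C A hC.symm
  let W : (Fin (n - 1) → ℝ) →ₗ[ℝ] Coord n := C.subtype ∘ₗ e.symm.toLinearMap
  refine ⟨P.toContinuousLinearMap, g.toContinuousLinearMap, W.toContinuousLinearMap, u, hg1, hu,
    fun c => ?_, ?_, fun c => ?_, ?_⟩
  · change e (Submodule.projectionOnto C A hC.symm ((e.symm c : C) : Coord n)) = c
    rw [Submodule.projectionOnto_apply_left, e.apply_symm_apply]
  · change e (Submodule.projectionOnto C A hC.symm u) = 0
    rw [Submodule.projectionOnto_apply_of_mem_right hC.symm huA, map_zero]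
  · exact hg2 (Submodule.mem_sup_left (e.symm c).2)
  · exact hg2 (Submodule.mem_sup_right (Submodule.mem_span_singleton_self u))

/-- A vector field orthogonal to the velocity has orthogonal covariant derivative. -/
theorem IsCausalGeodesic.momentum_covDeriv (hL : IsLorentzFinsler L)
    (hη : IsCausalGeodesic L X η I) {x₀ : M} {t : ℝ} (ht : t ∈ I)
    (h₀ : η t ∈ (chartAt (Coord n) x₀).source) {y : ℝ → Coord n} {y' : Coord n}
    (hy : HasDerivWithinAt y y' I t)
    (h : ∀ᶠ s in nhdsWithin t I, momentum L x₀ (velocity η I s) (y s) = 0) :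
    momentum L x₀ (velocity η I t) (y' + conn L x₀ (velocity η I t) (y t)) = 0 := by
  have hl := hL.isLocalLagrangian x₀
  have hz := tchart_mem_slit (p := velocity η I t) h₀ (hη.velocity_ne_zero ht)
  have h1 := (smooth_differentiableAt hl.isOpen_slit hl.smooth1 hz).hasFDerivAt.comp_hasDerivWithinAt
    t (hη.hasDerivWithinAt_velocity ht h₀)
  have h2 := h1.clm_apply ((hasDerivWithinAt_const t I (0 : Coord n)).prodMk hy)
  have h3 : HasDerivWithinAt (fun s => momentum L x₀ (velocity η I s) (y s)) 0 I t :=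
    (hasDerivWithinAt_const t I (0 : ℝ)).congr_of_eventuallyEq h (h.self_of_nhdsWithin ht)
  have h4 := (hη.uniqueDiffOn t ht).eq_deriv _ h2 h3
  have h5 := hl.horizontal_invariant hz (y t)
  have e1 : ((y t, -fderiv ℝ (sprayVec (localL L x₀)) (tchart x₀ (velocity η I t)) (0, y t)) :
      Coord n × Coord n) = (y t, 0)
      - (0, fderiv ℝ (sprayVec (localL L x₀)) (tchart x₀ (velocity η I t)) (0, y t)) := by simp
  simp only [Function.comp_apply] at h4
  rw [hl.eulerLagrange hz] at h4
  rw [e1, map_sub] at h5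
  rw [map_add, momentum_apply, momentum_apply, conn]
  linarith

/-- A smooth frame of the quotient bundle `Q_η` over `I ∩ O`, given by the isomorphisms of its
fibres with `ℝⁿ⁻¹`, together with the matrix of connection coefficients. -/
structure LocalFrame (L : TB n M → ℝ) (η : ℝ → M) (I O : Set ℝ) where
  /-- Coordinates of an element of a fibre. -/
  toCoord : ∀ t : ℝ, quot L (velocity η I t) →ₗ[ℝ] (Fin (n - 1) → ℝ)
  /-- The element of a fibre with given coordinates. -/
  ofCoord : ∀ t : ℝ, (Fin (n - 1) → ℝ) →ₗ[ℝ] quot L (velocity η I t)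
  /-- The connection coefficients: column `j` is the derivative of the `j`-th frame section. -/
  coeff : ℝ → Matrix (Fin (n - 1)) (Fin (n - 1)) ℝ
  ofCoord_toCoord : ∀ t ∈ I ∩ O, ∀ q, ofCoord t (toCoord t q) = q
  toCoord_ofCoord : ∀ t ∈ I ∩ O, ∀ c, toCoord t (ofCoord t c) = c
  isCovDerivSection : ∀ j, IsCovDerivSection L η I (I ∩ O)
    (fun t => ofCoord t (Pi.single j 1)) fun t => ofCoord t ((coeff t).col j)
  hasDerivWithinAt : ∀ q q' : ∀ t : ℝ, quot L (velocity η I t),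
    IsCovDerivSection L η I (I ∩ O) q q' → ∀ t ∈ I ∩ O,
      HasDerivWithinAt (fun s => toCoord s (q s))
        (toCoord t (q' t) - (coeff t).mulVec (toCoord t (q t))) I t

/-- The Leibniz rule for `∑ c_j S_j + f v` with `v` parallel: here `Sd`, `-Nv` are the coordinate
derivatives of `S`, `v`, and `NS`, `Nv` the connection terms. -/
theorem sum_smul_rearrange {E ι : Type*} [AddCommGroup E] [Module ℝ E] [Fintype ι] (c c' : ι → ℝ)
    (S Sd NS : ι → E) (f f' : ℝ) (v Nv : E) :
    ∑ j, (c j • Sd j + c' j • S j) + (f • -Nv + f' • v) + (∑ j, c j • NS j + f • Nv) =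
      ∑ j, (c' j • S j + c j • (Sd j + NS j)) + f' • v := by
  simp only [smul_add, smul_neg, Finset.sum_add_distrib]
  abel

/-- Coordinates of the derivative of a section, read off from its expansion in a frame `S` whose
members have derivatives `S'`. -/
theorem coord_of_expansion {E : Type*} [AddCommGroup E] [Module ℝ E] {m : ℕ}
    (P : E →ₗ[ℝ] (Fin m → ℝ)) (S S' : Fin m → E) (hPS : ∀ j, P (S j) = Pi.single j 1)
    (c c' : Fin m → ℝ) :
    P (∑ j, (c' j • S j + c j • S' j)) - (Matrix.of fun i j => P (S' j) i).mulVec c = c' := by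
  ext i
  have h7 : ∑ j, c' j * (Pi.single j 1 : Fin m → ℝ) i = c' i := by
    simp [Pi.single_apply]
  simp only [map_sum, map_add, map_smul, hPS, Finset.sum_apply, Pi.sub_apply, Pi.add_apply,
    Pi.smul_apply, smul_eq_mul, Matrix.mulVec, dotProduct, Matrix.of_apply, Finset.sum_add_distrib,
    h7]
  simp [mul_comm]

set_option maxHeartbeats 1000000 in
/-- Every point of `I` has a neighbourhood with a local frame of `Q_η`. In a chart, the constant
splitting of `exists_splitting` at `t₁` is deformed into one adapted to the velocity and the
momentum at `s`: `PP s` is the projection corrected so as to kill the velocity, and `SS s` is the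
section corrected so as to take values in the orthogonal space. -/
theorem IsLightlikeGeodesic.exists_localFrame (hL : IsLorentzFinsler L)
    (hη : IsLightlikeGeodesic L X η I) {t₁ : ℝ} (ht₁ : t₁ ∈ I) :
    ∃ O : Set ℝ, IsOpen O ∧ t₁ ∈ O ∧ Nonempty (LocalFrame L η I O) := by
  have hg := hη.toIsCausalGeodesic
  set x₀ := η t₁ with hx₀
  have hl := hL.isLocalLagrangian x₀
  have hs₁ : η t₁ ∈ (chartAt (Coord n) x₀).source := mem_chart_source _ _
  set z : ℝ → Coord n × Coord n := fun s => tchart x₀ (velocity η I s) with hz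
  set π : ℝ → Coord n →L[ℝ] ℝ := fun s => momentum L x₀ (velocity η I s) with hπ
  have hself : ∀ s ∈ I, η s ∈ (chartAt (Coord n) x₀).source → π s (z s).2 = 0 := fun s hs h₀ =>
    (hL.momentum_self (p := velocity η I s) h₀ (hg.velocity_ne_zero hs)).trans
      (by rw [hη.null s hs, mul_zero])
  obtain ⟨P, lam, W, u, hlam, hu, hPW, hPu, hlW, hlu⟩ := exists_splitting
    (tchart_snd_ne_zero (p := velocity η I t₁) hs₁ (hg.velocity_ne_zero ht₁))
    (hL.momentum_ne_zero (p := velocity η I t₁) hs₁ (hg.velocity_ne_zero ht₁)) (hself t₁ ht₁ hs₁)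
  obtain ⟨O₁, hO₁, htO₁, hsrc₁⟩ := hg.exists_isOpen ht₁ hs₁
  have hzs₁ : ContDiffOn ℝ ∞ z (I ∩ O₁) :=
    contDiffOn_tchart (hg.contMDiffOn_velocity.mono Set.inter_subset_left) hsrc₁
  have hmem₁ : ∀ s ∈ I ∩ O₁, z s ∈ slit (extChartAt 𝓘(ℝ, Coord n) x₀).target := fun s hs =>
    tchart_mem_slit (p := velocity η I s) (hsrc₁ s hs) (hg.velocity_ne_zero hs.1)
  have hπs₁ : ContDiffOn ℝ ∞ π (I ∩ O₁) :=
    (hl.smooth1.comp hzs₁ hmem₁).clm_comp contDiffOn_const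
  -- Near `t₁`, the functional `lam` keeps detecting the velocity, and `π u ≠ 0`.
  obtain ⟨O, hO, htO, hsrc, hlamO, huO, hzs, hπs, hmem⟩ : ∃ O : Set ℝ, IsOpen O ∧ t₁ ∈ O ∧
      (∀ s ∈ I ∩ O, η s ∈ (chartAt (Coord n) x₀).source) ∧ (∀ s ∈ I ∩ O, lam (z s).2 ≠ 0) ∧
      (∀ s ∈ I ∩ O, π s u ≠ 0) ∧ ContDiffOn ℝ ∞ z (I ∩ O) ∧ ContDiffOn ℝ ∞ π (I ∩ O) ∧
      ∀ s ∈ I ∩ O, z s ∈ slit (extChartAt 𝓘(ℝ, Coord n) x₀).target := by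
    have c1 : ContinuousOn (fun s => lam (z s).2 * π s u) (I ∩ O₁) :=
      ((lam.continuous.comp continuous_snd).comp_continuousOn hzs₁.continuousOn).mul
        (hπs₁.continuousOn.clm_apply continuousOn_const)
    obtain ⟨O₂, hO₂, htO₂, h2⟩ := mem_nhdsWithin.1
      (c1 t₁ ⟨ht₁, htO₁⟩ (isOpen_compl_singleton.mem_nhds (mul_ne_zero hlam hu)))
    have hsub : I ∩ (O₁ ∩ O₂) ⊆ I ∩ O₁ := fun s hs => ⟨hs.1, hs.2.1⟩
    have h3 : ∀ s ∈ I ∩ (O₁ ∩ O₂), lam (z s).2 * π s u ≠ 0 := fun s hs =>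
      h2 ⟨hs.2.2, hs.1, hs.2.1⟩
    exact ⟨O₁ ∩ O₂, hO₁.inter hO₂, ⟨htO₁, htO₂⟩, fun s hs => hsrc₁ s (hsub hs),
      fun s hs => left_ne_zero_of_mul (h3 s hs), fun s hs => right_ne_zero_of_mul (h3 s hs),
      hzs₁.mono hsub, hπs₁.mono hsub, fun s hs => hmem₁ s (hsub hs)⟩
  refine ⟨O, hO, htO, ?_⟩
  let PP : ℝ → Coord n →ₗ[ℝ] (Fin (n - 1) → ℝ) := fun s =>
    P.toLinearMap - ((lam (z s).2)⁻¹ • lam.toLinearMap).smulRight (P (z s).2)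
  let SS : ℝ → (Fin (n - 1) → ℝ) →ₗ[ℝ] Coord n := fun s =>
    W.toLinearMap - (((π s u)⁻¹ • (π s).toLinearMap) ∘ₗ W.toLinearMap).smulRight u
  have hPPapp : ∀ s w, PP s w = P w - ((lam (z s).2)⁻¹ * lam w) • P (z s).2 := fun s w => rfl
  have hSSapp : ∀ s c, SS s c = W c - ((π s u)⁻¹ * π s (W c)) • u := fun s w => rfl
  have hlS : ∀ s c, lam (SS s c) = 0 := fun s c => by simp [hSSapp, hlW, hlu]
  have hPS : ∀ s c, PP s (SS s c) = c := fun s c => by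
    rw [hPPapp, hlS]; simp [hSSapp, hPW, hPu]
  have hPv : ∀ s ∈ I ∩ O, PP s (z s).2 = 0 := fun s hs => by
    rw [hPPapp, inv_mul_cancel₀ (hlamO s hs), one_smul, sub_self]
  have hπS : ∀ s ∈ I ∩ O, ∀ c, π s (SS s c) = 0 := fun s hs c => by
    rw [hSSapp, map_sub, map_smul, smul_eq_mul, mul_right_comm, inv_mul_cancel₀ (huO s hs), one_mul,
      sub_self]
  have hfib : ∀ s, ∃ (Φ : quot L (velocity η I s) →ₗ[ℝ] (Fin (n - 1) → ℝ))
      (Ψ : (Fin (n - 1) → ℝ) →ₗ[ℝ] orth L (velocity η I s)), s ∈ I ∩ O →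
      (∀ y : orth L (velocity η I s), Φ (toQuot L _ y) =
        PP s (coordMap x₀ (velocity (n := n) η I s).1 y)) ∧
      (∀ c, coordMap x₀ (velocity (n := n) η I s).1
        (Ψ c) = SS s c) ∧ (∀ c, Φ (toQuot L _ (Ψ c)) = c) ∧
      ∀ q, toQuot L _ (Ψ (Φ q)) = q := fun s => by
    by_cases hs : s ∈ I ∩ O
    · obtain ⟨Φ, Ψ, h⟩ := hL.exists_quot_coord (p := velocity η I s) (hsrc s hs)
        (hg.velocity_ne_zero hs.1) (hη.null s hs.1) (PP s) (SS s) (hPv s hs) (hπS s hs) (hPS s)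
      exact ⟨Φ, Ψ, fun _ => h⟩
    · exact ⟨0, 0, fun h => absurd h hs⟩
  choose Φ Ψ hΦΨ using hfib
  -- The frame sections in the chart, and their derivatives.
  have hSsm : ∀ c, ContDiffOn ℝ ∞ (fun s => SS s c) (I ∩ O) := fun c =>
    contDiffOn_const.sub ((((hπs.clm_apply contDiffOn_const).inv huO).mul
      (hπs.clm_apply contDiffOn_const)).smul contDiffOn_const)
  have hSder : ∀ c, ∀ s ∈ I ∩ O, HasDerivWithinAt (fun s => SS s c)
      (derivWithin (fun s => SS s c) I s) I s := fun c s hs =>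
    ((((hSsm c) s hs).differentiableWithinAt (by simp)).mono_of_mem_nhdsWithin
      (inter_mem_nhdsWithin I (hO.mem_nhds hs.2))).hasDerivWithinAt
  let S' : (Fin (n - 1) → ℝ) → ℝ → Coord n := fun c s =>
    derivWithin (fun s => SS s c) I s + conn L x₀ (velocity η I s) (SS s c)
  have hπS' : ∀ c, ∀ s ∈ I ∩ O, π s (S' c s) = 0 := fun c s hs =>
    hg.momentum_covDeriv hL hs.1 (hsrc s hs) (hSder c s hs) (by
      filter_upwards [inter_mem_nhdsWithin I (hO.mem_nhds hs.2)] with r hr using hπS r hr c)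
  have hlift : ∀ c s, ∃ y : orth L (velocity η I s), s ∈ I ∩ O →
      coordMap x₀ (velocity (n := n) η I s).1 y =
        S' c s := fun c s => by
    by_cases hs : s ∈ I ∩ O
    · refine ⟨⟨coordInv x₀ (velocity (n := n) η I s).1 (S' c s), ?_⟩, fun _ => coordMap_coordInv (hsrc s hs) _⟩
      rw [hL.mem_orth_iff (p := velocity η I s) (hsrc s hs) (hg.velocity_ne_zero hs.1)]
      exact (congrArg (π s) (coordMap_coordInv (hsrc s hs) _)).trans (hπS' c s hs)
    · exact ⟨0, fun h => absurd h hs⟩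
  choose E' hE' using hlift
  refine ⟨{ toCoord := Φ
            ofCoord := fun s => toQuot L _ ∘ₗ Ψ s
            coeff := fun s => Matrix.of fun i j => PP s (S' (Pi.single j 1) s) i
            ofCoord_toCoord := fun s hs q => (hΦΨ s hs).2.2.2 q
            toCoord_ofCoord := fun s hs c => (hΦΨ s hs).2.2.1 c
            isCovDerivSection := fun j => ?_
            hasDerivWithinAt := ?_ }⟩
  · refine ⟨fun s => Ψ s (Pi.single j 1), fun s => E' (Pi.single j 1) s,
      hg.isCovDeriv_of_chart hL (x₀ := x₀) hO hsrc (hSsm (Pi.single j 1))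
        (fun s hs => (hΦΨ s hs).2.1 _) (fun s hs => hE' _ s hs), fun s hs => ⟨rfl, ?_⟩⟩
    have h1 : Φ s (toQuot L _ (E' (Pi.single j 1) s)) = PP s (S' (Pi.single j 1) s) := by
      rw [(hΦΨ s hs).1, hE' _ s hs]
    have h2 := (hΦΨ s hs).2.2.2 (toQuot L _ (E' (Pi.single j 1) s))
    rw [h1] at h2
    exact h2.symm
  · rintro q q' ⟨Y, Y', hcov, hq⟩ t ht
    set y : ℝ → Coord n := fun s => coordMap x₀ (velocity (n := n) η I s).1 (Y s) with hy
    have hyd : HasDerivWithinAt y (coordMap x₀ (velocity (n := n) η I t).1 (Y' t)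
      - conn L x₀ (velocity η I t) (y t)) I t :=
      hg.hasDerivWithinAt_of_isCovDeriv hL hO hcov ht (hsrc t ht)
    have hvd : HasDerivWithinAt (fun s => (z s).2) (-conn L x₀ (velocity η I t) (z t).2) I t := by
      have h1 : HasDerivWithinAt (fun s => (z s).2) (-(2 : ℝ) • sprayVec (localL L x₀) (z t)) I t :=
        (hg.hasDerivWithinAt_velocity ht.1 (hsrc t ht)).snd
      refine h1.congr_deriv ?_
      rw [conn, hl.fderiv_sprayVec_fibre (hmem t ht)]
      exact neg_smul _ _
    have hnear : ∀ᶠ s in nhdsWithin t I, s ∈ I ∩ O :=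
      inter_mem_nhdsWithin I (hO.mem_nhds ht.2)
    have hcoord : ∀ s ∈ I ∩ O, Φ s (q s) = PP s (y s) := fun s hs => by
      rw [← (hq s hs).1, (hΦΨ s hs).1]
    have hfd : DifferentiableWithinAt ℝ (fun s => (lam (z s).2)⁻¹ * lam (y s)) I t :=
      ((lam.hasFDerivAt.comp_hasDerivWithinAt t hvd).differentiableWithinAt.inv
        (hlamO t ht)).mul (lam.hasFDerivAt.comp_hasDerivWithinAt t hyd).differentiableWithinAt
    have hcd : DifferentiableWithinAt ℝ (fun s => Φ s (q s)) I t := by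
      have h1 : DifferentiableWithinAt ℝ (fun s => PP s (y s)) I t :=
        (P.hasFDerivAt.comp_hasDerivWithinAt t hyd).differentiableWithinAt.sub
          (hfd.smul (P.hasFDerivAt.comp_hasDerivWithinAt t hvd).differentiableWithinAt)
      exact h1.congr_of_eventuallyEq (hnear.mono hcoord) (hcoord t ht)
    obtain ⟨f', hf'⟩ : ∃ f', HasDerivWithinAt (fun s => (lam (z s).2)⁻¹ * lam (y s)) f' I t :=
      ⟨_, hfd.hasDerivWithinAt⟩
    obtain ⟨c', hc'⟩ : ∃ c', HasDerivWithinAt (fun s => Φ s (q s)) c' I t :=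
      ⟨_, hcd.hasDerivWithinAt⟩
    have hc'j : ∀ j, HasDerivWithinAt (fun s => Φ s (q s) j) (c' j) I t := fun j =>
      hasDerivWithinAt_pi.1 hc' j
    refine hc'.congr_deriv ?_
    have hsum : ∀ s c, SS s c = ∑ j, c j • SS s (Pi.single j 1) := fun s c => by
      conv_lhs => rw [pi_eq_sum_univ' c]
      rw [map_sum]
      refine Finset.sum_congr rfl fun j _ => ?_
      rw [map_smul]
    -- A representative differs from its frame expansion by a multiple of the velocity, which is
    -- parallel.
    have hdec : ∀ s ∈ I ∩ O, y s = ∑ j, Φ s (q s) j • SS s (Pi.single j 1)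
        + ((lam (z s).2)⁻¹ * lam (y s)) • (z s).2 := fun s hs => by
      have h1 : toQuot L _ (Y s - Ψ s (Φ s (q s))) = 0 := by
        rw [map_sub, (hq s hs).1, (hΦΨ s hs).2.2.2, sub_self]
      rw [toQuot, Submodule.mkQ_apply, Submodule.Quotient.mk_eq_zero, Submodule.mem_comap] at h1
      obtain ⟨a, ha⟩ := Submodule.mem_span_singleton.1 h1
      have h2 : a • (z s).2 = y s - SS s (Φ s (q s)) := by
        have h3 := congrArg (coordMap x₀ (velocity (n := n) η I s).1) ha
        rw [map_smul] at h3
        refine h3.trans ?_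
        rw [← (hΦΨ s hs).2.1]
        exact map_sub (coordMap x₀ (velocity (n := n) η I s).1) _ _
      have h4 : a = (lam (z s).2)⁻¹ * lam (y s) := by
        have h5 := congrArg lam h2
        rw [map_smul, map_sub, hlS, sub_zero, smul_eq_mul] at h5
        rw [← h5, mul_comm a, inv_mul_cancel_left₀ (hlamO s hs)]
      rw [← hsum, ← h4, h2]
      abel
    have hyd2 := (HasDerivWithinAt.fun_sum (u := Finset.univ) fun j _ =>
      (hc'j j).smul (hSder (Pi.single j 1) t ht)).add (hf'.smul hvd)
    have hyd3 := (hη.uniqueDiffOn t ht.1).eq_deriv _ hyd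
      (hyd2.congr_of_eventuallyEq (hnear.mono hdec) (hdec t ht))
    have hY' : coordMap x₀ (velocity (n := n) η I t).1 (Y' t) =
        ∑ j, (c' j • SS t (Pi.single j 1) + Φ t (q t) j • S' (Pi.single j 1) t)
          + f' • (z t).2 := by
      have hN : conn L x₀ (velocity η I t) (y t) =
          ∑ j, Φ t (q t) j • conn L x₀ (velocity η I t) (SS t (Pi.single j 1))
          + ((lam (z t).2)⁻¹ * lam (y t)) • conn L x₀ (velocity η I t) (z t).2 := by
        let Nl : Coord n →ₗ[ℝ] Coord n :=
          (fderiv ℝ (sprayVec (localL L x₀)) (z t)).toLinearMap ∘ₗ LinearMap.inr ℝ _ _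
        change Nl (y t) = ∑ j, Φ t (q t) j • Nl (SS t (Pi.single j 1))
          + ((lam (z t).2)⁻¹ * lam (y t)) • Nl (z t).2
        conv_lhs => rw [hdec t ht]
        rw [map_add, map_sum, map_smul]
        congr 1
        exact Finset.sum_congr rfl fun j _ => map_smul _ _ _
      rw [eq_add_of_sub_eq hyd3, hN]
      exact sum_smul_rearrange _ _ _ _ _ _ _ _ _
    have h6 := congrArg (PP t) hY'
    rw [map_add, map_smul, hPv t ht, smul_zero, add_zero, ← (hΦΨ t ht).1, (hq t ht).2] at h6
    rw [h6]
    exact (coord_of_expansion (PP t) _ (fun j => S' (Pi.single j 1) t) (fun j => hPS t _) _ _).symm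

end Frames

/-! ### Derivatives of matrix-valued functions -/

section MatrixCalculus

variable {m : ℕ} {I : Set ℝ} {t : ℝ}

/-- Entrywise derivative of a matrix-valued function. -/
def HasMatDeriv (A : ℝ → Matrix (Fin m) (Fin m) ℝ) (A' : Matrix (Fin m) (Fin m) ℝ) (I : Set ℝ)
    (t : ℝ) : Prop :=
  ∀ i j, HasDerivWithinAt (fun s => A s i j) (A' i j) I t

theorem HasMatDeriv.mul {A B : ℝ → Matrix (Fin m) (Fin m) ℝ} {A' B' : Matrix (Fin m) (Fin m) ℝ}
    (hA : HasMatDeriv A A' I t) (hB : HasMatDeriv B B' I t) :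
    HasMatDeriv (fun s => A s * B s) (A' * B t + A t * B') I t := fun i j => by
  simp only [Matrix.mul_apply, Matrix.add_apply, ← Finset.sum_add_distrib]
  exact HasDerivWithinAt.fun_sum fun k _ => (hA i k).mul (hB k j)

theorem HasMatDeriv.trace {A : ℝ → Matrix (Fin m) (Fin m) ℝ} {A' : Matrix (Fin m) (Fin m) ℝ}
    (hA : HasMatDeriv A A' I t) : HasDerivWithinAt (fun s => (A s).trace) A'.trace I t :=
  HasDerivWithinAt.fun_sum fun i _ => hA i i

theorem differentiableWithinAt_det {A : ℝ → Matrix (Fin m) (Fin m) ℝ}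
    (hA : ∀ i j, DifferentiableWithinAt ℝ (fun s => A s i j) I t) :
    DifferentiableWithinAt ℝ (fun s => (A s).det) I t := by
  simp_rw [Matrix.det_apply']
  exact DifferentiableWithinAt.fun_sum fun σ _ =>
    (differentiableWithinAt_const _).mul (DifferentiableWithinAt.fun_finsetProd fun i _ => hA _ _)

/-- The derivative of the inverse matrix. Differentiability follows from Cramer's rule. -/
theorem HasMatDeriv.inv {A : ℝ → Matrix (Fin m) (Fin m) ℝ} {A' : Matrix (Fin m) (Fin m) ℝ}
    (hu : UniqueDiffWithinAt ℝ I t) (ht : t ∈ I) (hA : HasMatDeriv A A' I t)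
    (hdet : ∀ᶠ s in nhdsWithin t I, IsUnit (A s).det) :
    HasMatDeriv (fun s => (A s)⁻¹) (-((A t)⁻¹ * A' * (A t)⁻¹)) I t := by
  have hdt : IsUnit (A t).det := hdet.self_of_nhdsWithin ht
  have hd : ∀ i j, DifferentiableWithinAt ℝ (fun s => (A s)⁻¹ i j) I t := fun i j => by
    have hAd : ∀ i j, DifferentiableWithinAt ℝ (fun s => A s i j) I t := fun i j =>
      (hA i j).differentiableWithinAt
    simp only [Matrix.inv_def, Ring.inverse_eq_inv', Matrix.smul_apply, smul_eq_mul,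
      Matrix.adjugate_apply]
    refine ((differentiableWithinAt_det hAd).inv hdt.ne_zero).mul
      (differentiableWithinAt_det fun k l => ?_)
    by_cases hk : k = j
    · simp only [Matrix.updateRow_apply, hk, if_true]; exact differentiableWithinAt_const _
    · simp only [Matrix.updateRow_apply, hk, if_false]; exact hAd k l
  obtain ⟨C, hC⟩ : ∃ C : Matrix (Fin m) (Fin m) ℝ, HasMatDeriv (fun s => (A s)⁻¹) C I t :=
    ⟨Matrix.of fun i j => derivWithin (fun s => (A s)⁻¹ i j) I t,
      fun i j => (hd i j).hasDerivWithinAt⟩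
  have h1 : A' * (A t)⁻¹ + A t * C = 0 := by
    ext i j
    refine hu.eq_deriv _ (hA.mul hC i j) ?_
    refine (hasDerivWithinAt_const t I ((1 : Matrix (Fin m) (Fin m) ℝ) i j)).congr_of_eventuallyEq
      ?_ (congrFun (congrFun (Matrix.mul_nonsing_inv _ hdt) i) j)
    filter_upwards [hdet] with s hs
    exact congrFun (congrFun (Matrix.mul_nonsing_inv _ hs) i) j
  have h2 : C = -((A t)⁻¹ * A' * (A t)⁻¹) := by
    have h3 : C = (A t)⁻¹ * (A t * C) := by
      rw [← mul_assoc, Matrix.nonsing_inv_mul _ hdt, one_mul]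
    rw [h3, eq_neg_of_add_eq_zero_right h1, mul_neg, mul_assoc]
  rwa [h2] at hC

/-- The trace of `B A⁻¹` satisfies a Riccati equation if `A` and `B` are differentiated with
respect to a connection with matrix `Γ`; the connection terms cancel. -/
theorem hasDerivWithinAt_trace_mul_inv {A B : ℝ → Matrix (Fin m) (Fin m) ℝ}
    {C Γ : Matrix (Fin m) (Fin m) ℝ} (hu : UniqueDiffWithinAt ℝ I t) (ht : t ∈ I)
    (hA : HasMatDeriv A (B t + A t * Γ - Γ * A t) I t)
    (hB : HasMatDeriv B (C + B t * Γ - Γ * B t) I t)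
    (hdet : ∀ᶠ s in nhdsWithin t I, IsUnit (A s).det) :
    HasDerivWithinAt (fun s => (B s * (A s)⁻¹).trace)
      ((C * (A t)⁻¹).trace - (B t * (A t)⁻¹ * (B t * (A t)⁻¹)).trace) I t := by
  have hdt : IsUnit (A t).det := hdet.self_of_nhdsWithin ht
  refine (hB.mul (hA.inv hu ht hdet)).trace.congr_deriv ?_
  have e1 : A t * (A t)⁻¹ = 1 := Matrix.mul_nonsing_inv _ hdt
  have e2 : (A t)⁻¹ * A t = 1 := Matrix.nonsing_inv_mul _ hdt
  generalize (A t)⁻¹ = D at *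
  have e3 : (C + B t * Γ - Γ * B t) * D + B t * -(D * (B t + A t * Γ - Γ * A t) * D) =
      C * D - B t * D * (B t * D) + (B t * D * Γ - Γ * (B t * D)) := by
    have h1 : D * (B t + A t * Γ - Γ * A t) * D = D * B t * D + Γ * D - D * Γ := by
      have : D * (B t + A t * Γ - Γ * A t) * D =
        D * B t * D + (D * A t) * Γ * D - D * Γ * (A t * D) := by noncomm_ring
      rw [this, e1, e2, one_mul, mul_one]
    rw [h1]
    noncomm_ring
  rw [e3, Matrix.trace_add, Matrix.trace_sub, Matrix.trace_sub, Matrix.trace_mul_comm (B t * D) Γ,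
    sub_self, add_zero]

end MatrixCalculus

/-! ### Endomorphism fields of the quotient bundle -/

section EndFields

variable {n : ℕ} {M : Type*} [TopologicalSpace M] [ChartedSpace (Coord n) M]
  [IsManifold 𝓘(ℝ, Coord n) ∞ M]
  {L : TB n M → ℝ} {X : ∀ x : M, TangentSpace 𝓘(ℝ, Coord n) x} {η : ℝ → M} {I O : Set ℝ}

namespace LocalFrame

variable (F : LocalFrame L η I O)

/-- The matrix of an endomorphism of a fibre in a local frame. -/
def mat (t : ℝ) (A : Module.End ℝ (quot L (velocity η I t))) :
    Matrix (Fin (n - 1)) (Fin (n - 1)) ℝ :=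
  LinearMap.toMatrix' (F.toCoord t ∘ₗ A ∘ₗ F.ofCoord t)

theorem mat_apply (t : ℝ) (A : Module.End ℝ (quot L (velocity η I t))) (i j : Fin (n - 1)) :
    F.mat t A i j = F.toCoord t (A (F.ofCoord t (Pi.single j 1))) i := by
  rw [mat, LinearMap.toMatrix'_apply]
  rfl

theorem mat_mulVec (t : ℝ) (ht : t ∈ I ∩ O) (A : Module.End ℝ (quot L (velocity η I t)))
    (q : quot L (velocity η I t)) :
    (F.mat t A).mulVec (F.toCoord t q) = F.toCoord t (A q) := by
  rw [mat, LinearMap.toMatrix'_mulVec]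
  simp [F.ofCoord_toCoord t ht]

theorem mat_mul (t : ℝ) (ht : t ∈ I ∩ O) (A B : Module.End ℝ (quot L (velocity η I t))) :
    F.mat t (A * B) = F.mat t A * F.mat t B := by
  rw [mat, mat, mat, ← LinearMap.toMatrix'_comp]
  congr 1
  ext1 c
  ext1
  simp [F.ofCoord_toCoord t ht]

theorem mat_one (t : ℝ) (ht : t ∈ I ∩ O) : F.mat t 1 = 1 := by
  rw [mat, ← LinearMap.toMatrix'_id]
  congr 1
  ext1 c
  ext1
  simp [F.toCoord_ofCoord t ht]

theorem mat_injective (t : ℝ) (ht : t ∈ I ∩ O) : Function.Injective (F.mat t) := fun A B h => by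
  refine LinearMap.ext fun q => ?_
  rw [← F.ofCoord_toCoord t ht (A q), ← F.ofCoord_toCoord t ht (B q), ← F.mat_mulVec t ht,
    ← F.mat_mulVec t ht, h]

theorem trace_mat (t : ℝ) (ht : t ∈ I ∩ O) (A : Module.End ℝ (quot L (velocity η I t))) :
    (F.mat t A).trace = LinearMap.trace ℝ _ A := by
  rw [mat, ← Matrix.trace_toLin'_eq, Matrix.toLin'_toMatrix']
  rw [LinearMap.trace_comp_comm']
  congr 1
  refine LinearMap.ext fun q => ?_
  simp [F.ofCoord_toCoord t ht]

theorem hasMatDeriv (hO : IsOpen O) {A A' : EndField L η I} (hA : IsCovDerivEnd L η I A A') (t : ℝ)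
    (ht : t ∈ I ∩ O) : HasMatDeriv (fun s => F.mat s (A s))
      (F.mat t (A' t) + F.mat t (A t) * F.coeff t - F.coeff t * F.mat t (A t)) I t := fun i j => by
  have h1 := F.hasDerivWithinAt _ _ (hA O hO _ _ (F.isCovDerivSection j)) t ht
  have h2 := hasDerivWithinAt_pi.1 h1 i
  simp only [mat_apply]
  refine h2.congr_deriv ?_
  rw [map_add, ← F.mat_mulVec t ht (A t), F.toCoord_ofCoord t ht]
  simp only [Pi.sub_apply, Pi.add_apply, Matrix.sub_apply, Matrix.add_apply, mat_apply]
  rfl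

end LocalFrame

/-- The covariant derivative of a field of endomorphisms is unique on `I`. -/
theorem IsLightlikeGeodesic.isCovDerivEnd_unique (hL : IsLorentzFinsler L)
    (hη : IsLightlikeGeodesic L X η I) {A A₁ A₂ : EndField L η I} (h₁ : IsCovDerivEnd L η I A A₁)
    (h₂ : IsCovDerivEnd L η I A A₂) {t : ℝ} (ht : t ∈ I) : A₁ t = A₂ t := by
  obtain ⟨O, hO, htO, ⟨F⟩⟩ := hη.exists_localFrame hL ht
  refine F.mat_injective t ⟨ht, htO⟩ ?_
  ext i j
  have h := (hη.uniqueDiffOn t ht).eq_deriv _ (F.hasMatDeriv hO h₁ t ⟨ht, htO⟩ i j)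
    (F.hasMatDeriv hO h₂ t ⟨ht, htO⟩ i j)
  simpa using h

theorem isCovDerivEnd_covDerivEnd {A : EndField L η I} (h : IsSmoothEnd L η I A) :
    IsCovDerivEnd L η I A (covDerivEnd L η I A) := by
  rw [covDerivEnd, dif_pos h]
  exact Classical.choose_spec h

/-- The Leibniz rule for the product of a function with a vector field along a geodesic. -/
theorem IsCausalGeodesic.isCovDeriv_smul (hη : IsCausalGeodesic L X η I) (hO : IsOpen O)
    {f : ℝ → ℝ} (hf : ContDiffOn ℝ ∞ f I) {Y Y' : ∀ t : ℝ, TangentSpace 𝓘(ℝ, Coord n) (η t)}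
    (h : IsCovDeriv L η I (I ∩ O) Y Y') :
    IsCovDeriv L η I (I ∩ O) (fun t => f t • Y t)
      (fun t => derivWithin f I t • Y t + f t • Y' t) := by
  refine ⟨fun t ht => ?_, fun x₀ t ht h₀ α => ?_⟩
  · obtain ⟨O', hO', htO', h'⟩ := hη.exists_isOpen (x₀ := η t) ht.1 (mem_chart_source _ _)
    have h1 := contDiffOn_tchart (x₀ := η t) (U := I ∩ (O ∩ O'))
      (h.1.mono fun s hs => ⟨hs.1, hs.2.1⟩) fun s hs => h' s ⟨hs.1, hs.2.2⟩
    have h2 : ContDiffOn ℝ ∞ (fun s => tchart (η t) (⟨η s, f s • Y s⟩ : TB n M))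
        (I ∩ (O ∩ O')) :=
      (h1.fst.prodMk ((hf.mono Set.inter_subset_left).smul h1.snd)).congr fun s _ =>
        tchart_smul (η t) (⟨η s, Y s⟩ : TB n M) (f s)
    refine ((contMDiffOn_of_tchart (fun s hs => h' s ⟨hs.1, hs.2.2⟩) h2) t
      ⟨ht.1, ht.2, htO'⟩).mono_of_mem_nhdsWithin ?_
    filter_upwards [inter_mem_nhdsWithin (I ∩ O) (hO'.mem_nhds htO')] with s hs
    exact ⟨hs.1.1, hs.1.2, hs.2⟩
  · have h1 : HasDerivWithinAt (fun s => (tchart x₀ (⟨η s, Y s⟩ : TB n M)).2 α)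
        (derivWithin (fun s => (tchart x₀ (⟨η s, Y s⟩ : TB n M)).2 α) I t) I t :=
      ((EuclideanSpace.proj (𝕜 := ℝ) α).hasFDerivAt.comp_hasDerivWithinAt t
        (hη.differentiableWithinAt_tchart hO h.1 ht.1 ht.2
          (fun _ => rfl) h₀).hasDerivWithinAt.snd).differentiableWithinAt.hasDerivWithinAt
    have h2 : HasDerivWithinAt f (derivWithin f I t) I t :=
      ((hf t ht.1).differentiableWithinAt (by simp)).hasDerivWithinAt
    have h3 : ∀ s γ, (tchart x₀ (⟨η s, f s • Y s⟩ : TB n M)).2 γ =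
        f s * (tchart x₀ (⟨η s, Y s⟩ : TB n M)).2 γ := fun s γ => by
      rw [tchart_smul x₀ (⟨η s, Y s⟩ : TB n M) (f s)]; rfl
    have h4 : (tchart x₀ (⟨η t, derivWithin f I t • Y t + f t • Y' t⟩ : TB n M)).2 α =
        derivWithin f I t * (tchart x₀ (⟨η t, Y t⟩ : TB n M)).2 α
          + f t * (tchart x₀ (⟨η t, Y' t⟩ : TB n M)).2 α := by
      change coordMap x₀ (η t) (derivWithin f I t • Y t + f t • Y' t) α =
        derivWithin f I t * coordMap x₀ (η t) (Y t) α + f t * coordMap x₀ (η t) (Y' t) α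
      rw [map_add, map_smul, map_smul]
      rfl
    have h5 : HasDerivWithinAt (fun s => f s * (tchart x₀ (⟨η s, Y s⟩ : TB n M)).2 α)
        (derivWithin f I t * (tchart x₀ (⟨η t, Y t⟩ : TB n M)).2 α + f t *
          derivWithin (fun s => (tchart x₀ (⟨η s, Y s⟩ : TB n M)).2 α) I t) I t := h2.mul h1
    simp only [h3]
    rw [h4, h5.derivWithin (hη.uniqueDiffOn t ht.1), h.2 x₀ t ht h₀ α, mul_add,
      Finset.mul_sum, ← add_assoc]
    congr 1
    refine Finset.sum_congr rfl fun β _ => ?_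
    rw [Finset.mul_sum]
    exact Finset.sum_congr rfl fun γ _ => by ring

/-- Leibniz rule in the quotient, from a Leibniz rule for representatives. -/
theorem map_leibniz {V Q : Type*} [AddCommGroup V] [Module ℝ V] [AddCommGroup Q] [Module ℝ Q]
    (π : V →ₗ[ℝ] Q) {A A' : Module.End ℝ Q} {q q' : Q} {y y' : V} (h : π y = A q)
    (h' : π y' = A' q + A q') {a b : ℝ} :
    π (a • y + b • y') = (a • A + b • A') q + (b • A) q' := by
  rw [map_add, map_smul, map_smul, h, h', smul_add, ← add_assoc]
  rfl

/-- The Leibniz rule for the product of a function with a field of endomorphisms. -/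
theorem IsCausalGeodesic.isCovDerivEnd_smul (hη : IsCausalGeodesic L X η I)
    {f : ℝ → ℝ} (hf : ContDiffOn ℝ ∞ f I) {A A' : EndField L η I} (h : IsCovDerivEnd L η I A A') :
    IsCovDerivEnd L η I (fun t => f t • A t) (fun t => derivWithin f I t • A t + f t • A' t) := by
  intro O hO q q' hq
  obtain ⟨Z, Z', hZ, hZq⟩ := h O hO q q' hq
  have h1 := hη.isCovDeriv_smul hO hf (Y := fun t => (orth L (velocity η I t)).subtype (Z t))
    (Y' := fun t => (orth L (velocity η I t)).subtype (Z' t)) hZ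
  refine ⟨fun t => f t • Z t, fun t => derivWithin f I t • Z t + f t • Z' t, ?_,
    fun t ht => ⟨?_, ?_⟩⟩
  · simp only [map_add, map_smul]
    exact h1
  · exact (map_smul _ _ _).trans (congrArg (f t • ·) (hZq t ht).1)
  · exact map_leibniz _ (hZq t ht).1 (hZq t ht).2

/-! ### The curvature on the quotient -/

/-- `R_v` takes values in the orthogonal space of `v`. -/
theorem IsLorentzFinsler.curv_mem_orth (hL : IsLorentzFinsler L) {p : TB n M} (hp : p.2 ≠ 0)
    (w : TangentSpace 𝓘(ℝ, Coord n) p.1) : curv L p w ∈ orth L p := by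
  have hc : p.1 ∈ (chartAt (Coord n) p.1).source := mem_chart_source _ _
  rw [hL.mem_orth_iff hc hp, coordMap_self]
  exact (hL.isLocalLagrangian p.1).fderiv_curvMat_apply (tchart_mem_slit hc hp) _

theorem IsLorentzFinsler.curv_self (hL : IsLorentzFinsler L) {p : TB n M} (hp : p.2 ≠ 0) :
    curv L p p.2 = 0 := by
  have hc : p.1 ∈ (chartAt (Coord n) p.1).source := mem_chart_source _ _
  have h1 := (hL.isLocalLagrangian p.1).curvMat_apply_self (tchart_mem_slit hc hp)
  have h2 : (tchart p.1 p).2 = components p.1 p.2 := coordMap_self p.1 p.2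
  rw [h2] at h1
  exact h1

/-- The Ricci curvature of a lightlike vector is the trace of the curvature on the quotient:
`R_v` kills `v` and takes values in the orthogonal space of `v`. -/
theorem IsLorentzFinsler.trace_quot_curv (hL : IsLorentzFinsler L) {p : TB n M} (hp : p.2 ≠ 0)
    {D : Module.End ℝ (quot L p)}
    (hD : ∀ z : orth L p, D (toQuot L p z) = toQuot L p ⟨curv L p z, hL.curv_mem_orth hp z⟩) :
    LinearMap.trace ℝ _ D = ric L p := by
  let R : TangentSpace 𝓘(ℝ, Coord n) p.1 →ₗ[ℝ] orth L p :=
    LinearMap.codRestrict (orth L p) (curv L p) (hL.curv_mem_orth hp)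
  let Rl : quot L p →ₗ[ℝ] orth L p := Submodule.liftQ _ (R ∘ₗ (orth L p).subtype) (by
    rintro ⟨y, hy⟩ hy'
    obtain ⟨a, ha⟩ := Submodule.mem_span_singleton.1 hy'
    have ha' : a • p.2 = y := ha
    rw [LinearMap.mem_ker]
    change R y = 0
    rw [← ha', map_smul]
    have : R p.2 = 0 := Subtype.ext (hL.curv_self hp)
    rw [this, smul_zero])
  have h1 : Rl ∘ₗ toQuot L p = R ∘ₗ (orth L p).subtype := LinearMap.ext fun y => rfl
  have h2 : D = toQuot L p ∘ₗ Rl := by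
    refine LinearMap.ext fun q => ?_
    obtain ⟨z, rfl⟩ := Submodule.mkQ_surjective _ q
    exact hD z
  rw [h2, LinearMap.trace_comp_comm', h1, LinearMap.trace_comp_comm', ric]
  congr 1

/-- By the Jacobi equation, `J'' J⁻¹` is minus the curvature on the quotient. -/
theorem IsJacobiTensor.trace_deriv_deriv_mul_inverse (hL : IsLorentzFinsler L)
    (hη : IsLightlikeGeodesic L X η I) {J : EndField L η I} (hJ : IsJacobiTensor L η I J)
    (hns : ∀ t ∈ I, IsUnit (J t)) {t : ℝ} (ht : t ∈ I) :
    LinearMap.trace ℝ _ (covDerivEnd L η I (covDerivEnd L η I J) t * Ring.inverse (J t)) =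
      -ric L (velocity η I t) := by
  have hv := hη.toIsCausalGeodesic.velocity_ne_zero ht
  have h5 := hJ.jacobi t ht
  have h6 := hns t ht
  clear hJ hns
  generalize covDerivEnd L η I (covDerivEnd L η I J) t = D at *
  generalize J t = E at *
  have h2 := hL.trace_quot_curv hv (D := -(D * Ring.inverse E)) fun z => by
    have hq : E (Ring.inverse E (toQuot L _ z)) = toQuot L _ z := by
      rw [← Module.End.mul_apply, Ring.mul_inverse_cancel _ h6, Module.End.one_apply]
    obtain ⟨y, hy⟩ := Submodule.mkQ_surjective _ (D (Ring.inverse E (toQuot L _ z)))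
    have h3 := h5 (Ring.inverse E (toQuot L _ z)) y z hy hq.symm
    have h4 : toQuot L _ (y + ⟨curv L _ z, hL.curv_mem_orth hv z⟩) = 0 :=
      (Submodule.Quotient.mk_eq_zero _).2 h3
    rw [map_add] at h4
    have h7 : toQuot L _ y = D (Ring.inverse E (toQuot L _ z)) := hy
    rw [LinearMap.neg_apply, Module.End.mul_apply, ← h7]
    exact neg_eq_of_add_eq_zero_right h4
  rw [← h2, map_neg, neg_neg]

set_option maxHeartbeats 1000000 in
/-- The Raychaudhuri equation `θ' = - Ric - trace B²` for `B = J' J⁻¹`. -/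
theorem IsJacobiTensor.raychaudhuri (hL : IsLorentzFinsler L) (hη : IsLightlikeGeodesic L X η I)
    {J : EndField L η I} (hJ : IsJacobiTensor L η I J) (hns : ∀ t ∈ I, IsUnit (J t)) {t : ℝ}
    (ht : t ∈ I) :
    HasDerivWithinAt
      (fun s => LinearMap.trace ℝ _ (covDerivEnd L η I J s * Ring.inverse (J s)))
      (-ric L (velocity η I t) - LinearMap.trace ℝ _
        (covDerivEnd L η I J t * Ring.inverse (J t) * (covDerivEnd L η I J t * Ring.inverse (J t))))
      I t := by
  obtain ⟨O, hO, htO, ⟨F⟩⟩ := hη.exists_localFrame hL ht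
  have hnear : ∀ᶠ s in nhdsWithin t I, s ∈ I ∩ O := inter_mem_nhdsWithin I (hO.mem_nhds htO)
  have hinv : ∀ s ∈ I ∩ O, IsUnit (F.mat s (J s)).det ∧
      F.mat s (Ring.inverse (J s)) = (F.mat s (J s))⁻¹ := fun s hs => by
    have h1 : F.mat s (J s) * F.mat s (Ring.inverse (J s)) = 1 := by
      rw [← F.mat_mul s hs, Ring.mul_inverse_cancel _ (hns s hs.1), F.mat_one s hs]
    exact ⟨Matrix.isUnit_det_of_right_inverse h1, (Matrix.inv_eq_right_inv h1).symm⟩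
  have h1 := hasDerivWithinAt_trace_mul_inv (hη.uniqueDiffOn t ht) ht
    (F.hasMatDeriv hO (isCovDerivEnd_covDerivEnd hJ.smooth) t ⟨ht, htO⟩)
    (F.hasMatDeriv hO (isCovDerivEnd_covDerivEnd hJ.smooth_deriv) t ⟨ht, htO⟩)
    (hnear.mono fun s hs => (hinv s hs).1)
  have htr : ∀ s ∈ I ∩ O, LinearMap.trace ℝ _ (covDerivEnd L η I J s * Ring.inverse (J s)) =
      (F.mat s (covDerivEnd L η I J s) * (F.mat s (J s))⁻¹).trace := fun s hs => by
    rw [← F.trace_mat s hs, F.mat_mul s hs, (hinv s hs).2]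
  refine (h1.congr_of_eventuallyEq (hnear.mono htr) (htr t ⟨ht, htO⟩)).congr_deriv ?_
  rw [← (hinv t ⟨ht, htO⟩).2, ← F.mat_mul t ⟨ht, htO⟩, ← F.mat_mul t ⟨ht, htO⟩,
    ← F.mat_mul t ⟨ht, htO⟩, F.trace_mat t ⟨ht, htO⟩, F.trace_mat t ⟨ht, htO⟩,
    hJ.trace_deriv_deriv_mul_inverse hL hη hns ht]

end EndFields

/-! ### Derivatives of the weight along geodesics -/

/-- The first two derivatives of a `C²` function along an integral curve of a vector field `V`
depend only on the base point. This also holds at boundary points of non-open sets `s`, where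
the derivatives of `f` within `s` need not be unique. -/
theorem exists_second_order {E : Type*} [NormedAddCommGroup E] [NormedSpace ℝ E] {f : E → ℝ}
    {s : Set E} {x : E} (hx : x ∈ s) (hf : ContDiffWithinAt ℝ 2 f s x) {V : E → E}
    (hV : DifferentiableAt ℝ V x) :
    ∃ a b : ℝ, ∀ (z : ℝ → E) (g : ℝ → ℝ) (S : Set ℝ) (t : ℝ), UniqueDiffOn ℝ S → t ∈ S → z t = x →
      (∀ᶠ r in nhdsWithin t S, z r ∈ s ∧ HasDerivWithinAt z (V (z r)) S r) →
      (∀ᶠ r in nhdsWithin t S, g r = f (z r)) →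
      HasDerivWithinAt g a S t ∧ HasDerivWithinAt (derivWithin g S) b S t := by
  obtain ⟨u, hu, hus, -, f', hf', hf''⟩ :=
    (contDiffWithinAt_succ_iff_hasFDerivWithinAt' (n := 1) (by simp)).1 hf
  rw [Set.insert_eq_of_mem hx] at hu hus
  obtain ⟨D, hD⟩ : ∃ D, HasFDerivWithinAt f' D s x := hf''.differentiableWithinAt (by simp)
  refine ⟨f' x (V x), D (V x) (V x) + f' x (fderiv ℝ V x (V x)),
    fun z g S t hS ht hzt hz hg => ?_⟩
  subst hzt
  have hz1 := (hz.self_of_nhdsWithin ht).2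
  have hzs : Filter.Tendsto z (nhdsWithin t S) (nhdsWithin (z t) s) :=
    tendsto_nhdsWithin_iff.2 ⟨hz1.continuousWithinAt, hz.mono fun r hr => hr.1⟩
  have hzs' : HasDerivWithinAt z (V (z t)) (S ∩ z ⁻¹' s) t := hz1.mono Set.inter_subset_left
  -- Near `t`, the curve lies in the set `u`, where `f'` is a derivative of `f`.
  have h1 : ∀ᶠ r in nhdsWithin t S, r ∈ S → HasDerivWithinAt g (f' (z r) (V (z r))) S r := by
    have hz' := eventually_eventually_nhdsWithin.2 hz
    have hg' := eventually_eventually_nhdsWithin.2 hg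
    filter_upwards [hz, hz', hg, hg', hzs hu] with r hr hr' hgr hgr' hru hrS
    have h2 : HasDerivWithinAt (f ∘ z) (f' (z r) (V (z r))) (S ∩ z ⁻¹' s) r :=
      (hf' _ hru).comp_hasDerivWithinAt r (hr.2.mono Set.inter_subset_left)
        fun y hy => hy.2
    have h3 : HasDerivWithinAt (f ∘ z) (f' (z r) (V (z r))) S r :=
      h2.mono_of_mem_nhdsWithin (by
        filter_upwards [self_mem_nhdsWithin, hr'] with y hy hy' using ⟨hy, hy'.1⟩)
    exact h3.congr_of_eventuallyEq hgr' hgr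
  refine ⟨h1.self_of_nhdsWithin ht ht, ?_⟩
  have h4 : HasDerivWithinAt (fun r => f' (z r)) (D (V (z t))) S t :=
    (hD.comp_hasDerivWithinAt t hzs' fun y hy => hy.2).mono_of_mem_nhdsWithin (by
      filter_upwards [self_mem_nhdsWithin, hz] with y hy hy' using ⟨hy, hy'.1⟩)
  have h5 : HasDerivWithinAt (fun r => V (z r)) (fderiv ℝ V (z t) (V (z t))) S t :=
    hV.hasFDerivAt.comp_hasDerivWithinAt t hz1
  refine (h4.clm_apply h5).congr_of_eventuallyEq ?_ ?_
  · filter_upwards [h1, self_mem_nhdsWithin] with r hr hrS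
    exact (hr hrS).derivWithin (hS r hrS)
  · exact (h1.self_of_nhdsWithin ht ht).derivWithin (hS t ht)

section Weight

variable {n : ℕ} {M : Type*} [TopologicalSpace M] [ChartedSpace (Coord n) M]
  [IsManifold 𝓘(ℝ, Coord n) ∞ M]
  {L : TB n M → ℝ} {X : ∀ x : M, TangentSpace 𝓘(ℝ, Coord n) x} {ψ : TB n M → ℝ}
  {η : ℝ → M} {I : Set ℝ}

/-- The future causal cone is invariant under positive scaling: the ray through `p` is connected
and consists of causal vectors. -/
theorem IsLorentzFinsler.smul_mem_futureCausal (hL : IsLorentzFinsler L) {p : TB n M}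
    (hp : p ∈ futureCausal L X) {c : ℝ} (hc : 0 < c) :
    (⟨p.1, c • p.2⟩ : TB n M) ∈ futureCausal L X := by
  have h1 := connectedComponentIn_eq hp
  have h0 := connectedComponentIn_subset _ _ hp
  have h2 : IsPreconnected ((fun a : ℝ => a • p.2) '' Set.Ioi 0) :=
    isPreconnected_Ioi.image _ (by fun_prop)
  change c • p.2 ∈ connectedComponentIn _ _
  rw [h1]
  refine h2.subset_connectedComponentIn ⟨1, Set.mem_Ioi.2 one_pos, one_smul _ _⟩ ?_
    ⟨c, hc, rfl⟩
  rintro _ ⟨a, ha, rfl⟩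
  have ha : 0 < a := ha
  refine ⟨map_mem_closure (f := fun v : TangentSpace 𝓘(ℝ, Coord n) p.1 => a • v) (by fun_prop) h0.1
    fun v hv => ?_, smul_ne_zero ha.ne' h0.2⟩
  change L ⟨p.1, a • v⟩ < 0
  rw [hL.homog p.1 v a ha]
  exact mul_neg_of_pos_of_neg (by positivity) hv

/-- Along causal geodesics, the first two derivatives of the weight depend only on the velocity. -/
theorem IsWeight.exists_derivs (hL : IsLorentzFinsler L) (hψ : IsWeight L X ψ) {p : TB n M}
    (hp : p ∈ futureCausal L X) :
    ∃ a b : ℝ, ∀ (η : ℝ → M) (I : Set ℝ) (t : ℝ), IsCausalGeodesic L X η I → t ∈ I →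
      velocity η I t = p → HasDerivWithinAt (psiAlong ψ η I) a I t ∧
        HasDerivWithinAt (derivWithin (psiAlong ψ η I) I) b I t := by
  have h₀ : p.1 ∈ (chartAt (Coord n) p.1).source := mem_chart_source _ _
  have hps : p ∈ (tchart (n := n) p.1).source := mem_tchart_source.2 h₀
  have hx : tchart p.1 p ∈ (tchart (n := n) p.1).target ∩ (tchart p.1).symm ⁻¹' futureCausal L X := by
    refine ⟨(tchart p.1).map_source hps, ?_⟩
    rw [Set.mem_preimage, (tchart p.1).left_inv hps]
    exact hp
  have h1 : ContMDiffOn 𝓘(ℝ, Coord n × Coord n) 𝓘(ℝ, ℝ) ∞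
      (fun z => ψ ((tchart (n := n) p.1).symm z))
      ((tchart (n := n) p.1).target ∩ (tchart p.1).symm ⁻¹' futureCausal L X) :=
    hψ.smooth.comp ((contMDiffOn_extChartAt_symm (I := 𝓘(ℝ, Coord n).tangent) (n := ∞)
      (⟨p.1, 0⟩ : TB n M)).mono Set.inter_subset_left) fun z hz => hz.2
  have h2 := contDiffWithinAt_infty.1 (h1.contDiffOn _ hx) 2
  have hV : DifferentiableAt ℝ (fun z : Coord n × Coord n =>
      ((z.2, -(2 : ℝ) • sprayVec (localL L p.1) z) : Coord n × Coord n)) (tchart p.1 p) :=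
    differentiableAt_snd.prodMk (((hL.isLocalLagrangian p.1).differentiableAt_sprayVec
      (tchart_mem_slit h₀ (futureCausal_ne_zero hp))).fun_const_smul _)
  obtain ⟨a, b, hab⟩ := exists_second_order hx h2 hV
  refine ⟨a, b, fun η I t hη ht hv => ?_⟩
  have hc : η t ∈ (chartAt (Coord n) p.1).source := by rw [← hv]; exact mem_chart_source _ _
  obtain ⟨O, hO, htO, h₀⟩ := hη.exists_isOpen ht hc
  have hnear := inter_mem_nhdsWithin I (hO.mem_nhds htO)
  refine hab (fun s => tchart p.1 (velocity η I s)) (psiAlong ψ η I) I t hη.uniqueDiffOn ht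
    (by rw [hv]) ?_ ?_
  · filter_upwards [hnear] with s hs
    have hs' : velocity (n := n) η I s ∈ (tchart (n := n) p.1).source :=
      mem_tchart_source.2 (h₀ s hs)
    refine ⟨⟨(tchart p.1).map_source hs', ?_⟩, hη.hasDerivWithinAt_velocity hs.1 (h₀ s hs)⟩
    rw [Set.mem_preimage, (tchart p.1).left_inv hs']
    exact hη.causal s hs.1
  · filter_upwards [hnear] with s hs
    rw [(tchart p.1).left_inv (mem_tchart_source.2 (h₀ s hs)), psiAlong]

/-- The curve `s ↦ η (t + c s)` has velocity `c η̇`. -/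
theorem IsCausalGeodesic.velocity_affine (hη : IsCausalGeodesic L X η I) (c t : ℝ)
    (hS : UniqueDiffOn ℝ ((fun s => t + c * s) ⁻¹' I)) {s : ℝ} (hs : t + c * s ∈ I) :
    velocity (fun s => η (t + c * s)) ((fun s => t + c * s) ⁻¹' I) s =
      (⟨η (t + c * s), c • (velocity η I (t + c * s)).2⟩ : TB n M) := by
  have hf : HasDerivAt (fun s : ℝ => t + c * s) c s := by
    simpa using ((hasDerivAt_id s).const_mul c).const_add t
  have h1 : HasMFDerivWithinAt 𝓘(ℝ, ℝ) 𝓘(ℝ, ℝ) (fun s : ℝ => t + c * s)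
      ((fun s => t + c * s) ⁻¹' I) s (ContinuousLinearMap.toSpanSingleton ℝ c) :=
    hf.hasFDerivAt.hasFDerivWithinAt.hasMFDerivWithinAt
  have h2 := ((hη.smooth _ hs).mdifferentiableWithinAt (by simp)).hasMFDerivWithinAt
  have h3 := (h2.comp s h1 fun r hr => hr).mfderivWithin (hS s hs).uniqueMDiffWithinAt
  change (⟨η (t + c * s), mfderivWithin 𝓘(ℝ, ℝ) 𝓘(ℝ, Coord n) (η ∘ fun s => t + c * s)
    ((fun s => t + c * s) ⁻¹' I) s (1 : ℝ)⟩ : TB n M) = _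
  rw [h3]
  have h4 : (mfderivWithin 𝓘(ℝ, ℝ) 𝓘(ℝ, Coord n) η I (t + c * s)) (((1 : ℝ) • c : ℝ)) =
      c • (mfderivWithin 𝓘(ℝ, ℝ) 𝓘(ℝ, Coord n) η I (t + c * s)) (1 : ℝ) := by
    have e : (1 : ℝ) • c = c • (1 : ℝ) := by simp
    rw [e]
    exact (mfderivWithin 𝓘(ℝ, ℝ) 𝓘(ℝ, Coord n) η I (t + c * s)).map_smul c (1 : ℝ)
  exact congrArg (fun v => (⟨η (t + c * s), v⟩ : TB n M)) h4

/-- Affine reparametrizations with positive speed preserve causal geodesics. -/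
theorem IsCausalGeodesic.affine (hL : IsLorentzFinsler L) (hη : IsCausalGeodesic L X η I) {c : ℝ}
    (hc : 0 < c) (t : ℝ) :
    IsCausalGeodesic L X (fun s => η (t + c * s)) ((fun s => t + c * s) ⁻¹' I) := by
  have hmono : Monotone fun s : ℝ => t + c * s := fun a b hab => by
    simpa using mul_le_mul_of_nonneg_left hab hc.le
  have hsurj : Function.Surjective fun s : ℝ => t + c * s := fun y =>
    ⟨(y - t) / c, by field_simp; ring⟩
  have hI : ((fun s => t + c * s) ⁻¹' I).OrdConnected := hη.interval.preimage_mono hmono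
  have hI' : ((fun s => t + c * s) ⁻¹' I).Nontrivial := hη.nontrivial.preimage hsurj
  have hS := uniqueDiffOn_of_ordConnected hI hI'
  refine ⟨hI, hI', ?_, fun s hs => ?_, fun x₀ s hs h₀ α => ?_⟩
  · have h1 : ContMDiff 𝓘(ℝ, ℝ) 𝓘(ℝ, ℝ) ∞ fun s : ℝ => t + c * s :=
      ContDiff.contMDiff (by fun_prop)
    exact hη.smooth.comp h1.contMDiffOn fun s hs => hs
  · rw [hη.velocity_affine c t hS hs]
    exact hL.smul_mem_futureCausal (hη.causal _ hs) hc
  · have hv : ∀ r ∈ (fun s => t + c * s) ⁻¹' I,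
        tchart x₀ (velocity (fun s => η (t + c * s)) ((fun s => t + c * s) ⁻¹' I) r : TB n M) =
          ((tchart x₀ (velocity η I (t + c * r))).1,
            c • (tchart x₀ (velocity η I (t + c * r))).2) := fun r hr => by
      rw [hη.velocity_affine c t hS hr]
      exact tchart_smul x₀ (velocity η I (t + c * r)) c
    set z := tchart x₀ (velocity (n := n) η I (t + c * s)) with hz
    have hzs : z ∈ slit (extChartAt 𝓘(ℝ, Coord n) x₀).target :=
      tchart_mem_slit (p := velocity η I (t + c * s)) h₀ (hη.velocity_ne_zero hs)
    have h1 : HasDerivWithinAt (fun r => (tchart x₀ (velocity (n := n) η I r)).2)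
        (-(2 : ℝ) • sprayVec (localL L x₀) z) I (t + c * s) :=
      (hη.hasDerivWithinAt_velocity hs h₀).snd
    have hf : HasDerivAt (fun s : ℝ => t + c * s) c s := by
      simpa using ((hasDerivAt_id s).const_mul c).const_add t
    have h2 : HasDerivWithinAt (fun r => c • (tchart x₀ (velocity (n := n) η I (t + c * r))).2)
        (c • c • (-(2 : ℝ) • sprayVec (localL L x₀) z)) ((fun s => t + c * s) ⁻¹' I) s :=
      (h1.scomp s hf.hasDerivWithinAt fun r hr => hr).const_smul c
    have h3 : HasDerivWithinAt (fun r => (tchart x₀ (velocity (n := n) (fun s => η (t + c * s))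
        ((fun s => t + c * s) ⁻¹' I) r)).2 α)
        ((c • c • (-(2 : ℝ) • sprayVec (localL L x₀) z)) α) ((fun s => t + c * s) ⁻¹' I) s :=
      ((EuclideanSpace.proj (𝕜 := ℝ) α).hasFDerivAt.comp_hasDerivWithinAt s h2).congr
        (fun r hr => by rw [hv r hr]; rfl) (by rw [hv s hs]; rfl)
    rw [h3.derivWithin (hS s hs), hv s hs]
    have h4 := congrArg (fun w : Coord n => w α)
      ((hL.isLocalLagrangian x₀).sprayVec_smul hzs hc)
    have h5 : ∀ y : Coord n × Coord n, ∑ β, ∑ γ, christoffel (localL L x₀) α β γ y * y.2 β * y.2 γ =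
        2 * sprayVec (localL L x₀) y α := fun y => by simp [sprayVec, spray]
    have h6 := h5 (z.1, c • z.2)
    rw [← hz]
    refine (congrArg (_ + ·) h6).trans ?_
    rw [h4]
    simp only [PiLp.smul_apply, smul_eq_mul]
    ring

/-- The derivatives of the weight at a positive multiple `c η̇(t)` of the velocity of a geodesic.
The curve `s ↦ η (t + c s)` shows that a geodesic with this initial velocity exists, and the
derivatives of `ψ` along the chosen geodesic agree with those along this curve, where `ψ_η` is merely
rescaled by the `0`-homogeneity of `ψ`. -/
theorem IsWeight.psiDot_smul_velocity (hL : IsLorentzFinsler L) (hψ : IsWeight L X ψ)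
    (hη : IsCausalGeodesic L X η I) {t c : ℝ} (ht : t ∈ I) (hc : 0 < c) :
    psiDot L X ψ ⟨η t, c • (velocity η I t).2⟩ = c * derivWithin (psiAlong ψ η I) I t ∧
    psiDDot L X ψ ⟨η t, c • (velocity η I t).2⟩ =
      c ^ 2 * derivWithin (derivWithin (psiAlong ψ η I) I) I t ∧
    DifferentiableWithinAt ℝ (psiAlong ψ η I) I t ∧
    DifferentiableWithinAt ℝ (derivWithin (psiAlong ψ η I) I) I t := by
  set S := (fun s => t + c * s) ⁻¹' I with hSdef
  set ζ := fun s => η (t + c * s) with hζ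
  have hζg : IsCausalGeodesic L X ζ S := hη.affine hL hc t
  have hS := hζg.uniqueDiffOn
  have h0 : (0 : ℝ) ∈ S := by simpa [hSdef] using ht
  have hvel : ∀ s ∈ S, velocity ζ S s =
      (⟨η (t + c * s), c • (velocity η I (t + c * s)).2⟩ : TB n M) := fun s hs =>
    hη.velocity_affine c t hS hs
  have hv0 : velocity ζ S 0 = (⟨η t, c • (velocity η I t).2⟩ : TB n M) := by
    have h := hvel 0 h0
    rwa [mul_zero, add_zero] at h
  have hp := hL.smul_mem_futureCausal (hη.causal t ht) hc
  obtain ⟨a, b, hab⟩ := hψ.exists_derivs hL hp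
  have hspec : (0 : ℝ) ∈ (geodesicFrom L X (⟨η t, c • (velocity η I t).2⟩ : TB n M)).1 ∧
      IsCausalGeodesic L X (geodesicFrom L X (⟨η t, c • (velocity η I t).2⟩ : TB n M)).2
        (geodesicFrom L X (⟨η t, c • (velocity η I t).2⟩ : TB n M)).1 ∧
      velocity (geodesicFrom L X (⟨η t, c • (velocity η I t).2⟩ : TB n M)).2
        (geodesicFrom L X (⟨η t, c • (velocity η I t).2⟩ : TB n M)).1 0 =
        (⟨η t, c • (velocity η I t).2⟩ : TB n M) :=
    Classical.epsilon_spec (p := fun Sγ : Set ℝ × (ℝ → M) => (0 : ℝ) ∈ Sγ.1 ∧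
      IsCausalGeodesic L X Sγ.2 Sγ.1 ∧
      velocity Sγ.2 Sγ.1 0 = (⟨η t, c • (velocity η I t).2⟩ : TB n M)) ⟨(S, ζ), h0, hζg, hv0⟩
  obtain ⟨h1, h2⟩ := hab _ _ 0 hspec.2.1 hspec.1 hspec.2.2
  have hu := hspec.2.1.uniqueDiffOn 0 hspec.1
  obtain ⟨h3, h4⟩ := hab ζ S 0 hζg h0 hv0
  obtain ⟨a', b', hab'⟩ := hψ.exists_derivs hL (hη.causal t ht)
  obtain ⟨h5, h6⟩ := hab' η I t hη ht rfl
  have hψζ : ∀ s ∈ S, psiAlong ψ ζ S s = psiAlong ψ η I (t + c * s) := fun s hs => by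
    rw [psiAlong, hvel s hs]
    exact hψ.homog _ (hη.causal _ hs) c hc
  have hf : ∀ s, HasDerivWithinAt (fun s : ℝ => t + c * s) c S s := fun s => by
    simpa using (((hasDerivAt_id s).const_mul c).const_add t).hasDerivWithinAt
  have hmaps : Set.MapsTo (fun s => t + c * s) S I := fun s hs => hs
  have ht0 : t + c * 0 = t := by ring
  have h7 : ∀ s ∈ S, HasDerivWithinAt (psiAlong ψ ζ S)
      (c * derivWithin (psiAlong ψ η I) I (t + c * s)) S s := fun s hs => by
    obtain ⟨a₁, b₁, h₁⟩ := hψ.exists_derivs hL (hη.causal _ hs)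
    have h8 := (h₁ η I _ hη hs rfl).1.differentiableWithinAt.hasDerivWithinAt
    have h9 : HasDerivWithinAt (fun r => psiAlong ψ η I (t + c * r))
        (c * derivWithin (psiAlong ψ η I) I (t + c * s)) S s := h8.scomp (g₁ := psiAlong ψ η I) s (hf s) hmaps
    exact h9.congr hψζ (hψζ s hs)
  have h9 : HasDerivWithinAt (derivWithin (psiAlong ψ ζ S) S) (c * (c * b')) S 0 := by
    rw [← ht0] at h6
    have h10 : HasDerivWithinAt (fun r => derivWithin (psiAlong ψ η I) I (t + c * r)) (c * b') S 0 :=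
      h6.scomp (g₁ := derivWithin (psiAlong ψ η I) I) 0 (hf 0) hmaps
    exact (h10.const_mul c).congr
      (fun s hs => (h7 s hs).derivWithin (hS s hs)) ((h7 0 h0).derivWithin (hS 0 h0))
  refine ⟨?_, ?_, h5.differentiableWithinAt, h6.differentiableWithinAt⟩
  · rw [psiDot, h1.derivWithin hu, (hS 0 h0).eq_deriv _ h3 (h7 0 h0), ht0]
  · rw [psiDDot, h2.derivWithin hu, (hS 0 h0).eq_deriv _ h4 h9,
      h6.derivWithin (hη.uniqueDiffOn t ht)]
    ring

theorem IsLorentzFinsler.ric_smul (hL : IsLorentzFinsler L) {p : TB n M} (hp : p.2 ≠ 0) {c : ℝ}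
    (hc : 0 < c) : ric L (⟨p.1, c • p.2⟩ : TB n M) = c ^ 2 * ric L p := by
  have h₀ : p.1 ∈ (chartAt (Coord n) p.1).source := mem_chart_source _ _
  have h1 : curv L (⟨p.1, c • p.2⟩ : TB n M) = c ^ 2 • curv L p := by
    rw [curv, tchart_smul p.1 p c,
      (hL.isLocalLagrangian p.1).curvMat_smul (tchart_mem_slit h₀ hp) hc, map_smul]
    rfl
  rw [ric, h1, map_smul, ric, smul_eq_mul]

end Weight

/-! ### Change of parameter on an interval -/

section Reparametrization

variable {I : Set ℝ}

/-- Every point `t` of an interval `I` has, relative to `I`, a neighbourhood that is a compact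
subinterval and contains a second given point `t₀`. -/
theorem exists_Icc_mem_nhdsWithin (hI : I.OrdConnected) {t₀ t : ℝ} (ht₀ : t₀ ∈ I) (ht : t ∈ I) :
    ∃ a b : ℝ, a ≤ b ∧ Set.Icc a b ⊆ I ∧ t₀ ∈ Set.Icc a b ∧ Set.Icc a b ∈ nhdsWithin t I := by
  have hl : ∃ a ∈ I, a ≤ t ∧ ∀ᶠ s in nhdsWithin t I, a ≤ s := by
    by_cases h : ∃ a ∈ I, a < t
    · obtain ⟨a, ha, hat⟩ := h
      exact ⟨a, ha, hat.le, mem_nhdsWithin_of_mem_nhds (Ici_mem_nhds hat)⟩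
    · push Not at h
      exact ⟨t, ht, le_rfl, eventually_mem_nhdsWithin.mono h⟩
  have hr : ∃ b ∈ I, t ≤ b ∧ ∀ᶠ s in nhdsWithin t I, s ≤ b := by
    by_cases h : ∃ b ∈ I, t < b
    · obtain ⟨b, hb, htb⟩ := h
      exact ⟨b, hb, htb.le, mem_nhdsWithin_of_mem_nhds (Iic_mem_nhds htb)⟩
    · push Not at h
      exact ⟨t, ht, le_rfl, eventually_mem_nhdsWithin.mono h⟩
  obtain ⟨a, ha, hat, ha'⟩ := hl
  obtain ⟨b, hb, htb, hb'⟩ := hr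
  refine ⟨min t₀ a, max t₀ b, (min_le_left _ _).trans (le_max_left _ _), hI.out ?_ ?_,
    ⟨min_le_left _ _, le_max_left _ _⟩, ?_⟩
  · rcases min_choice t₀ a with h | h <;> rwa [h]
  · rcases max_choice t₀ b with h | h <;> rwa [h]
  · filter_upwards [ha', hb'] with s h1 h2
    exact ⟨(min_le_right _ _).trans h1, h2.trans (le_max_right _ _)⟩

/-- The fundamental theorem of calculus on an arbitrary interval, with one-sided derivatives at
end points. -/
theorem hasDerivWithinAt_integral (hI : I.OrdConnected) {g : ℝ → ℝ} (hg : ContinuousOn g I)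
    {t₀ t : ℝ} (ht₀ : t₀ ∈ I) (ht : t ∈ I) :
    HasDerivWithinAt (fun u => ∫ s in t₀..u, g s) (g t) I t := by
  obtain ⟨a, b, hab, hsub, h₀, hn⟩ := exists_Icc_mem_nhdsWithin hI ht₀ ht
  have hta : t ∈ Set.Icc a b := mem_of_mem_nhdsWithin ht hn
  set G := Set.IccExtend hab ((Set.Icc a b).domRestrict g) with hG
  have hGc : Continuous G := (hg.mono hsub).domRestrict.Icc_extend'
  have hGg : ∀ s ∈ Set.Icc a b, G s = g s := fun s hs => Set.IccExtend_of_mem hab _ hs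
  have h1 := (hGc.integral_hasStrictDerivAt t₀ t).hasDerivAt.hasDerivWithinAt (s := I)
  rw [hGg t hta] at h1
  have h2 : ∀ u ∈ Set.Icc a b, ∫ s in t₀..u, g s = ∫ s in t₀..u, G s := fun u hu =>
    intervalIntegral.integral_congr fun s hs => (hGg s (Set.uIcc_subset_Icc h₀ hu hs)).symm
  exact h1.congr_of_eventuallyEq (Filter.mem_of_superset hn h2) (h2 t hta)

/-- The inverse of a strictly monotone continuous function on an interval is continuous. -/
theorem continuousOn_invFunOn (hI : I.OrdConnected) {τ : ℝ → ℝ} (hτ : StrictMonoOn τ I)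
    (hτc : ContinuousOn τ I) : ContinuousOn (Function.invFunOn τ I) (τ '' I) := by
  have : (τ '' I).OrdConnected := (hI.isPreconnected.image τ hτc).ordConnected
  rw [continuousOn_iff_continuous_domRestrict]
  have h1 : (τ '' I).domRestrict (Function.invFunOn τ I) =
      fun r => ((hτ.orderIso τ I).symm r : ℝ) := by
    funext r
    refine hτ.injOn (Function.invFunOn_mem r.2) ((hτ.orderIso τ I).symm r).2 ?_
    rw [Function.invFunOn_eq r.2]
    exact (congrArg Subtype.val ((hτ.orderIso τ I).apply_symm_apply r)).symm
  rw [h1]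
  exact continuous_subtype_val.comp (hτ.orderIso τ I).symm.continuous

/-- The chain rule for a function expressed in a new parameter `τ`. -/
theorem derivWithin_comp_invFunOn (hI : I.OrdConnected) (hI' : I.Nontrivial) {τ d : ℝ → ℝ}
    (hτ : ∀ t ∈ I, HasDerivWithinAt τ (d t) I t) (hd : ∀ t ∈ I, 0 < d t) {f : ℝ → ℝ} {f' t : ℝ}
    (ht : t ∈ I) (hf : HasDerivWithinAt f f' I t) :
    derivWithin (fun r => f (Function.invFunOn τ I r)) (τ '' I) (τ t) = (d t)⁻¹ * f' := by
  have hc : ContinuousOn τ I := fun t ht => (hτ t ht).continuousWithinAt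
  have hmono : StrictMonoOn τ I := strictMonoOn_of_hasDerivWithinAt_pos hI.convex hc
    (fun x hx => (hτ x (interior_subset hx)).mono interior_subset)
    fun x hx => hd x (interior_subset hx)
  have himage : (τ '' I).OrdConnected := (hI.isPreconnected.image τ hc).ordConnected
  have hu := uniqueDiffOn_of_ordConnected himage (hI'.image_of_injOn hmono.injOn)
  have hmem : τ t ∈ τ '' I := ⟨t, ht, rfl⟩
  have hσ : Function.invFunOn τ I (τ t) = t :=
    hmono.injOn (Function.invFunOn_mem hmem) ht (Function.invFunOn_eq hmem)
  have h1 : HasFDerivWithinAt τ ((ContinuousLinearEquiv.unitsEquivAut ℝ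
      (Units.mk0 (d t) (hd t ht).ne') : ℝ ≃L[ℝ] ℝ) : ℝ →L[ℝ] ℝ) I
      (Function.invFunOn τ I (τ t)) := by
    rw [hσ]
    refine (hτ t ht).hasFDerivWithinAt.congr_fderiv ?_
    ext
    simp
  have h2 : HasDerivWithinAt (Function.invFunOn τ I) (d t)⁻¹ (τ '' I) (τ t) := by
    have h3 := HasFDerivWithinAt.of_local_left_inverse (s := τ '' I) (tendsto_nhdsWithin_iff.2
      ⟨continuousOn_invFunOn hI hmono hc _ hmem,
        eventually_mem_nhdsWithin.mono fun r hr => Function.invFunOn_mem hr⟩) h1 hmem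
      (eventually_mem_nhdsWithin.mono fun r hr => Function.invFunOn_eq hr)
    refine h3.hasDerivWithinAt.congr_deriv ?_
    simp
  have h4 : HasDerivWithinAt f f' I (Function.invFunOn τ I (τ t)) := by rwa [hσ]
  have h5 : HasDerivWithinAt (fun r => f (Function.invFunOn τ I r)) ((d t)⁻¹ * f') (τ '' I) (τ t) :=
    h4.scomp (g₁ := f) (τ t) h2 fun r hr => Function.invFunOn_mem hr
  exact h5.derivWithin (hu _ hmem)

end Reparametrization

/-! ### The trace of the square of the trace-free part -/

theorem trace_sq_traceFree {V : Type*} [AddCommGroup V] [Module ℝ V] {m : ℝ} (hm : m ≠ 0)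
    (h1 : LinearMap.trace ℝ V 1 = m) (B : Module.End ℝ V) :
    LinearMap.trace ℝ V ((B - (LinearMap.trace ℝ V B / m) • 1) *
      (B - (LinearMap.trace ℝ V B / m) • 1)) =
      LinearMap.trace ℝ V (B * B) - LinearMap.trace ℝ V B ^ 2 / m := by
  have h2 : ∀ c : ℝ, (B - c • 1) * (B - c • 1) = B * B - (2 * c) • B + (c ^ 2) • 1 := fun c => by
    simp only [sub_mul, mul_sub, smul_mul_assoc, mul_smul_comm, mul_one, one_mul, two_mul, add_smul,
      sq, mul_smul, smul_sub]
    abel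
  rw [h2, map_add, map_sub, map_smul, map_smul, h1, smul_eq_mul, smul_eq_mul]
  field_simp
  ring

theorem inverse_smul_end {V : Type*} [AddCommGroup V] [Module ℝ V] {a : ℝ} (ha : a ≠ 0)
    {J : Module.End ℝ V} (hJ : IsUnit J) : Ring.inverse (a • J) = a⁻¹ • Ring.inverse J := by
  obtain ⟨u, rfl⟩ := hJ
  let w : (Module.End ℝ V)ˣ := ⟨a • u, a⁻¹ • (u⁻¹ : (Module.End ℝ V)ˣ),
    by rw [smul_mul_smul_comm, mul_inv_cancel₀ ha, Units.mul_inv, one_smul],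
    by rw [smul_mul_smul_comm, inv_mul_cancel₀ ha, Units.inv_mul, one_smul]⟩
  rw [Ring.inverse_unit u]
  exact Ring.inverse_unit w

/-- The algebra behind `J_ψ^* J_ψ⁻¹`, where `J_ψ = a J`, `a' = - a d` and `d/dτ = r d/dt`. -/
theorem weighted_mul_inverse {V : Type*} [AddCommGroup V] [Module ℝ V] {a : ℝ} (ha : a ≠ 0)
    {J J' K : Module.End ℝ V} (hJ : J * K = 1) (r d : ℝ) :
    (r • ((a * -d) • J + a • J')) * (a⁻¹ • K) = r • (J' * K - d • 1) := by
  rw [smul_mul_assoc, add_mul, smul_mul_smul_comm, smul_mul_smul_comm, hJ, mul_inv_cancel₀ ha,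
    one_smul, mul_right_comm, mul_inv_cancel₀ ha, one_mul, neg_smul, neg_add_eq_sub]

/-- Adding a multiple of the identity does not change the trace-free part. -/
theorem trace_sq_traceFree_smul_sub {V : Type*} [AddCommGroup V] [Module ℝ V] {m : ℝ} (hm : m ≠ 0)
    (h1 : LinearMap.trace ℝ V 1 = m) (B : Module.End ℝ V) (r d : ℝ) :
    LinearMap.trace ℝ V
      ((r • (B - (d / m) • 1) - (r * (LinearMap.trace ℝ V B - d) / m) • 1) *
        (r • (B - (d / m) • 1) - (r * (LinearMap.trace ℝ V B - d) / m) • 1)) =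
      r ^ 2 * (LinearMap.trace ℝ V (B * B) - LinearMap.trace ℝ V B ^ 2 / m) := by
  have h2 : r • (B - (d / m) • 1) - (r * (LinearMap.trace ℝ V B - d) / m) • 1 =
      r • (B - (LinearMap.trace ℝ V B / m) • 1) := by
    rw [smul_sub, smul_sub, smul_smul, smul_smul, sub_sub, ← add_smul]
    congr 2
    ring
  rw [h2, smul_mul_smul_comm, map_smul, smul_eq_mul, sq r, trace_sq_traceFree hm h1]

/-! ### The weighted Raychaudhuri equation -/

section Weighted

variable {n : ℕ} {M : Type*} [TopologicalSpace M] [ChartedSpace (Coord n) M]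
  [IsManifold 𝓘(ℝ, Coord n) ∞ M]
  {L : TB n M → ℝ} {X : ∀ x : M, TangentSpace 𝓘(ℝ, Coord n) x} {ψ : TB n M → ℝ}
  {η : ℝ → M} {I : Set ℝ} {t₀ t : ℝ}

theorem IsWeight.contDiffOn_psiAlong (hψ : IsWeight L X ψ) (hη : IsCausalGeodesic L X η I) :
    ContDiffOn ℝ ∞ (psiAlong ψ η I) I :=
  (hψ.smooth.comp hη.contMDiffOn_velocity hη.causal).contDiffOn

theorem IsWeight.hasDerivWithinAt_epsTime (hψ : IsWeight L X ψ) (hη : IsCausalGeodesic L X η I)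
    (ε : ℝ) (ht₀ : t₀ ∈ I) (ht : t ∈ I) :
    HasDerivWithinAt (epsTime ψ ε η I t₀)
      (Real.exp (2 * (ε - 1) / ((n : ℝ) - 1) * psiAlong ψ η I t)) I t :=
  hasDerivWithinAt_integral hη.interval
    (Real.continuous_exp.comp_continuousOn
      (continuousOn_const.mul (hψ.contDiffOn_psiAlong hη).continuousOn)) ht₀ ht

theorem IsWeight.timeRate_eq (hψ : IsWeight L X ψ) (hη : IsCausalGeodesic L X η I)
    (ε : ℝ) (ht₀ : t₀ ∈ I) (ht : t ∈ I) :
    timeRate ψ ε η I t₀ t = Real.exp (2 * (1 - ε) / ((n : ℝ) - 1) * psiAlong ψ η I t) := by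
  rw [timeRate, (hψ.hasDerivWithinAt_epsTime hη ε ht₀ ht).derivWithin (hη.uniqueDiffOn t ht),
    ← Real.exp_neg]
  congr 1
  ring

/-- The derivative with respect to `τ_ε` is `dt/dτ_ε` times the derivative with respect to `t`. -/
theorem IsWeight.starDeriv_eq (hψ : IsWeight L X ψ) (hη : IsCausalGeodesic L X η I)
    (ε : ℝ) (ht₀ : t₀ ∈ I) (ht : t ∈ I) {f : ℝ → ℝ} {f' : ℝ} (hf : HasDerivWithinAt f f' I t) :
    starDeriv ψ ε η I t₀ f t = timeRate ψ ε η I t₀ t * f' := by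
  rw [starDeriv, derivWithin_comp_invFunOn hη.interval hη.nontrivial
    (fun s hs => hψ.hasDerivWithinAt_epsTime hη ε ht₀ hs) (fun s _ => Real.exp_pos _) ht hf,
    timeRate, (hψ.hasDerivWithinAt_epsTime hη ε ht₀ ht).derivWithin (hη.uniqueDiffOn t ht)]

/-- The effect of the weight and of the change of parameter on `B = J' J⁻¹`. -/
theorem IsWeight.epsB_eq (hL : IsLorentzFinsler L) (hψ : IsWeight L X ψ)
    (hη : IsLightlikeGeodesic L X η I) {J : EndField L η I} (hJ : IsSmoothEnd L η I J)
    (hns : ∀ t ∈ I, IsUnit (J t)) (ε t₀ : ℝ) (ht : t ∈ I) :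
    epsB L ψ ε η I t₀ J t = timeRate ψ ε η I t₀ t •
      (covDerivEnd L η I J t * Ring.inverse (J t)
        - (derivWithin (psiAlong ψ η I) I t / ((n : ℝ) - 1)) • 1) := by
  have hψη := hψ.contDiffOn_psiAlong hη.toIsCausalGeodesic
  set f : ℝ → ℝ := fun t => Real.exp (-psiAlong ψ η I t / ((n : ℝ) - 1)) with hf
  have hfs : ContDiffOn ℝ ∞ f I := (hψη.neg.div_const _).exp
  have hu := hη.toIsCausalGeodesic.uniqueDiffOn t ht
  have h1 : derivWithin f I t = f t * -(derivWithin (psiAlong ψ η I) I t / ((n : ℝ) - 1)) := by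
    rw [← neg_div]
    exact ((((hψη t ht).differentiableWithinAt (by simp)).hasDerivWithinAt.fun_neg.div_const
      ((n : ℝ) - 1)).exp).derivWithin hu
  have h2 : IsCovDerivEnd L η I (weightedJ L ψ η I J)
      (fun t => derivWithin f I t • J t + f t • covDerivEnd L η I J t) :=
    hη.toIsCausalGeodesic.isCovDerivEnd_smul hfs (isCovDerivEnd_covDerivEnd hJ)
  have h3 : covDerivEnd L η I (weightedJ L ψ η I J) t =
      derivWithin f I t • J t + f t • covDerivEnd L η I J t :=
    hη.isCovDerivEnd_unique hL (isCovDerivEnd_covDerivEnd ⟨_, h2⟩) h2 ht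
  have hft : f t ≠ 0 := (Real.exp_pos _).ne'
  have h4 : Ring.inverse (weightedJ L ψ η I J t) = (f t)⁻¹ • Ring.inverse (J t) :=
    inverse_smul_end hft (hns t ht)
  have h5 := h3.trans (congrArg (fun a : ℝ => a • J t + f t • covDerivEnd L η I J t) h1)
  exact (congrArg₂ (fun A B : Module.End ℝ (quot L (velocity η I t)) =>
    (timeRate ψ ε η I t₀ t • A) * B) h5 h4).trans
    (weighted_mul_inverse hft (Ring.mul_inverse_cancel _ (hns t ht)) _ _)

theorem IsLightlikeGeodesic.trace_one (hn : 2 ≤ n) (hL : IsLorentzFinsler L)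
    (hη : IsLightlikeGeodesic L X η I) (ht : t ∈ I) :
    LinearMap.trace ℝ (quot L (velocity η I t)) 1 = (n : ℝ) - 1 := by
  rw [LinearMap.trace_one, hL.finrank_quot (hη.ne_zero t ht) (hη.null t ht),
    Nat.cast_sub (by omega), Nat.cast_one]

/-- The trace of `J' J⁻¹`, the unweighted expansion. -/
def expansion (L : TB n M → ℝ) (η : ℝ → M) (I : Set ℝ) (J : EndField L η I) (t : ℝ) : ℝ :=
  LinearMap.trace ℝ (quot L (velocity η I t)) (covDerivEnd L η I J t * Ring.inverse (J t))

theorem IsWeight.epsTheta_eq (hn : 2 ≤ n) (hL : IsLorentzFinsler L) (hψ : IsWeight L X ψ)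
    (hη : IsLightlikeGeodesic L X η I) {J : EndField L η I} (hJ : IsSmoothEnd L η I J)
    (hns : ∀ t ∈ I, IsUnit (J t)) (ε t₀ : ℝ) (ht : t ∈ I) :
    epsTheta L ψ ε η I t₀ J t = timeRate ψ ε η I t₀ t *
      (expansion L η I J t - derivWithin (psiAlong ψ η I) I t) := by
  have hm : (n : ℝ) - 1 ≠ 0 := by
    have : (2 : ℝ) ≤ n := by exact_mod_cast hn
    linarith
  rw [epsTheta, hψ.epsB_eq hL hη hJ hns ε t₀ ht, map_smul, map_sub, map_smul,
    hη.trace_one hn hL ht, smul_eq_mul, smul_eq_mul, div_mul_cancel₀ _ hm, expansion]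

theorem IsWeight.epsShearSq_eq (hn : 2 ≤ n) (hL : IsLorentzFinsler L) (hψ : IsWeight L X ψ)
    (hη : IsLightlikeGeodesic L X η I) {J : EndField L η I} (hJ : IsSmoothEnd L η I J)
    (hns : ∀ t ∈ I, IsUnit (J t)) (ε t₀ : ℝ) (ht : t ∈ I) :
    epsShearSq L ψ ε η I t₀ J t = timeRate ψ ε η I t₀ t ^ 2 *
      (LinearMap.trace ℝ (quot L (velocity η I t))
        (covDerivEnd L η I J t * Ring.inverse (J t) * (covDerivEnd L η I J t * Ring.inverse (J t)))
        - expansion L η I J t ^ 2 / ((n : ℝ) - 1)) := by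
  have hm : (n : ℝ) - 1 ≠ 0 := by
    have : (2 : ℝ) ≤ n := by exact_mod_cast hn
    linarith
  have h1 : epsSigma L ψ ε η I t₀ J t = _ :=
    congrArg₂ (fun (A : Module.End ℝ (quot L (velocity η I t))) (a : ℝ) =>
      A - (a / ((n : ℝ) - 1)) • (1 : Module.End ℝ (quot L (velocity η I t))))
      (hψ.epsB_eq hL hη hJ hns ε t₀ ht) (hψ.epsTheta_eq hn hL hη hJ hns ε t₀ ht)
  exact (congrArg (fun A => LinearMap.trace ℝ (quot L (velocity η I t)) (A * A)) h1).trans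
    (trace_sq_traceFree_smul_sub hm (hη.trace_one hn hL ht) _ _ _)

/-- The derivative of `θ_ε = (dt/dτ_ε) (θ - ψ_η')`, by the unweighted Raychaudhuri equation. -/
theorem IsWeight.hasDerivWithinAt_epsTheta (hn : 2 ≤ n) (hL : IsLorentzFinsler L)
    (hψ : IsWeight L X ψ) (hη : IsLightlikeGeodesic L X η I) {J : EndField L η I}
    (hJ : IsJacobiTensor L η I J) (hns : ∀ t ∈ I, IsUnit (J t)) (ε : ℝ) (ht₀ : t₀ ∈ I)
    (ht : t ∈ I) :
    HasDerivWithinAt (epsTheta L ψ ε η I t₀ J) (timeRate ψ ε η I t₀ t *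
      (2 * (1 - ε) / ((n : ℝ) - 1) * derivWithin (psiAlong ψ η I) I t *
          (expansion L η I J t - derivWithin (psiAlong ψ η I) I t)
        - ric L (velocity η I t) - LinearMap.trace ℝ (quot L (velocity η I t))
          (covDerivEnd L η I J t * Ring.inverse (J t) *
            (covDerivEnd L η I J t * Ring.inverse (J t)))
        - derivWithin (derivWithin (psiAlong ψ η I) I) I t)) I t := by
  obtain ⟨-, -, h1, h2⟩ :=
    hψ.psiDot_smul_velocity hL hη.toIsCausalGeodesic ht one_pos
  have h3 : HasDerivWithinAt (expansion L η I J) _ I t := hJ.raychaudhuri hL hη hns ht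
  have h4 := (h1.hasDerivWithinAt.const_mul (2 * (1 - ε) / ((n : ℝ) - 1))).exp.mul
    (h3.sub h2.hasDerivWithinAt)
  have h5 : ∀ s ∈ I, epsTheta L ψ ε η I t₀ J s =
      Real.exp (2 * (1 - ε) / ((n : ℝ) - 1) * psiAlong ψ η I s) *
      (expansion L η I J s - derivWithin (psiAlong ψ η I) I s) := fun s hs => by
    rw [hψ.epsTheta_eq hn hL hη hJ.smooth hns ε t₀ hs,
      hψ.timeRate_eq hη.toIsCausalGeodesic ε ht₀ hs]
  refine (h4.congr h5 (h5 t ht)).congr_deriv ?_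
  rw [hψ.timeRate_eq hη.toIsCausalGeodesic ε ht₀ ht, Pi.sub_apply]
  ring

end Weighted

end LorentzFinsler

end

theorem mainTheorem9 {n : ℕ} (hn : 2 ≤ n)
    {M : Type*} [TopologicalSpace M] [T2Space M] [SecondCountableTopology M] [ConnectedSpace M]
    [ChartedSpace (Coord n) M] [IsManifold 𝓘(ℝ, Coord n) ∞ M]
    (L : TB n M → ℝ) (hL : IsLorentzFinsler L)
    (X : ∀ x : M, TangentSpace 𝓘(ℝ, Coord n) x) (hX : IsTimeOrientation L X)
    (ψ : TB n M → ℝ) (hψ : IsWeight L X ψ)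
    (η : ℝ → M) (I : Set ℝ) (hη : IsLightlikeGeodesic L X η I)
    (J : EndField L η I) (hJ : IsLagrangeTensor L η I J) (hns : ∀ t ∈ I, IsUnit (J t))
    (ε : ℝ) (t₀ : ℝ) (ht₀ : t₀ ∈ I) :
    DifferentiableOn ℝ (epsTheta L ψ ε η I t₀ J) I ∧
    (∀ t ∈ I,
      starDeriv ψ ε η I t₀ (epsTheta L ψ ε η I t₀ J) t
        + 2 * ε / ((n : ℝ) - 1) * starDeriv ψ ε η I t₀ (psiAlong ψ η I) t
            * epsTheta L ψ ε η I t₀ J t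
        + epsTheta L ψ ε η I t₀ J t ^ 2 / ((n : ℝ) - 1)
        + epsShearSq L ψ ε η I t₀ J t
        + ricN L X ψ 1 (etaStar ψ ε η I t₀ t) = 0) ∧
    (∀ N : ℝ, N ≠ 1 → N ≠ n → ∀ t ∈ I,
      starDeriv ψ ε η I t₀ (epsTheta L ψ ε η I t₀ J) t
        + (1 - ε ^ 2 * ((N - n) / (N - 1)))
            * (epsTheta L ψ ε η I t₀ J t ^ 2 / ((n : ℝ) - 1))
        + (N - 1) * (N - n) / ((n : ℝ) - 1)
            * (ε * epsTheta L ψ ε η I t₀ J t / (N - 1)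
                + starDeriv ψ ε η I t₀ (psiAlong ψ η I) t / (N - n)) ^ 2
        + epsShearSq L ψ ε η I t₀ J t
        + ricN L X ψ N (etaStar ψ ε η I t₀ t) = 0) ∧
    (∀ t ∈ I,
      starDeriv ψ ε η I t₀ (epsTheta L ψ ε η I t₀ J) t
        + (1 - ε ^ 2) * (epsTheta L ψ ε η I t₀ J t ^ 2 / ((n : ℝ) - 1))
        + 1 / ((n : ℝ) - 1)
            * (ε * epsTheta L ψ ε η I t₀ J t
                + starDeriv ψ ε η I t₀ (psiAlong ψ η I) t) ^ 2
        + epsShearSq L ψ ε η I t₀ J t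
        + ricInfty L X ψ (etaStar ψ ε η I t₀ t) = 0) := by
  have hg := hη.toIsCausalGeodesic
  have hm : (n : ℝ) - 1 ≠ 0 := by
    have : (2 : ℝ) ≤ n := by exact_mod_cast hn
    linarith
  have hθ : ∀ t ∈ I, HasDerivWithinAt (epsTheta L ψ ε η I t₀ J) _ I t := fun t ht =>
    hψ.hasDerivWithinAt_epsTheta hn hL hη hJ.toIsJacobiTensor hns ε ht₀ ht
  -- Every quantity, in terms of `r = dt/dτ`, the unweighted expansion `u`, `trace B²`, the Ricci
  -- curvature and the first two derivatives of `ψ` along `η`.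
  have key : ∀ t ∈ I, ∃ r u b ρ d d₂ : ℝ,
      epsTheta L ψ ε η I t₀ J t = r * (u - d) ∧
      epsShearSq L ψ ε η I t₀ J t = r ^ 2 * (b - u ^ 2 / ((n : ℝ) - 1)) ∧
      starDeriv ψ ε η I t₀ (epsTheta L ψ ε η I t₀ J) t =
        r * (r * (2 * (1 - ε) / ((n : ℝ) - 1) * d * (u - d) - ρ - b - d₂)) ∧
      starDeriv ψ ε η I t₀ (psiAlong ψ η I) t = r * d ∧
      ric L (etaStar ψ ε η I t₀ t) = r ^ 2 * ρ ∧
      psiDot L X ψ (etaStar ψ ε η I t₀ t) = r * d ∧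
      psiDDot L X ψ (etaStar ψ ε η I t₀ t) = r ^ 2 * d₂ := fun t ht => by
    have hr : 0 < timeRate ψ ε η I t₀ t := by
      rw [hψ.timeRate_eq hg ε ht₀ ht]; exact Real.exp_pos _
    obtain ⟨h1, h2, h3, -⟩ := hψ.psiDot_smul_velocity hL hg ht hr
    exact ⟨timeRate ψ ε η I t₀ t, expansion L η I J t, _, ric L (velocity η I t),
      derivWithin (psiAlong ψ η I) I t, derivWithin (derivWithin (psiAlong ψ η I) I) I t,
      hψ.epsTheta_eq hn hL hη hJ.smooth hns ε t₀ ht,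
      hψ.epsShearSq_eq hn hL hη hJ.smooth hns ε t₀ ht, hψ.starDeriv_eq hg ε ht₀ ht (hθ t ht),
      hψ.starDeriv_eq hg ε ht₀ ht h3.hasDerivWithinAt,
      hL.ric_smul (p := velocity η I t) (hη.ne_zero t ht) hr, h1, h2⟩
  refine ⟨fun t ht => (hθ t ht).differentiableWithinAt, fun t ht => ?_, fun N hN1 hNn t ht => ?_,
    fun t ht => ?_⟩
  all_goals
    obtain ⟨r, u, b, ρ, d, d₂, e1, e2, e3, e4, e5, e6, e7⟩ := key t ht
  · have hm' : 1 - (n : ℝ) ≠ 0 := fun h => hm (by linarith)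
    have e : 1 - (n : ℝ) = -((n : ℝ) - 1) := by ring
    rw [ricN, e1, e2, e3, e4, e5, e6, e7, e]
    field_simp
    ring
  · have h1 : N - 1 ≠ 0 := sub_ne_zero.2 hN1
    have h2 : N - n ≠ 0 := sub_ne_zero.2 hNn
    rw [ricN, e1, e2, e3, e4, e5, e6, e7]
    field_simp
    ring
  · rw [ricInfty, e1, e2, e3, e4, e5, e7]
    field_simp
    ring
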